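/- Let $\alpha,\tau,\mu,l>0$, $\gamma_0,\gamma_l\ge 0$, $\beta=\alpha/\tau$, $\theta=\mu^2/\tau$. Let $(e,q)$ be a classical solution, regular up to the boundary ($e,\partial_te,\partial_xe,q,\partial_tq,\partial_xq,\partial_x^2q$ exist and are continuous on $[0,l]\times[0,\infty)$), of $$\partial_t e+\partial_x q=f,\qquad \tau\partial_t q+q-\mu^2\partial_x^2q+\alpha\partial_x e=0\qquad (0<x<l,\ t>0),$$ $$e|_{t=0}=\varphi,\quad q|_{t=0}=\psi,\qquad (\gamma_0e+q)|_{x=0}=g(t),\quad(\gamma_le-q)|_{x=l}=h(t),$$ with $f$ continuous on $[0,l]\times[0,\infty)$. **Notation.** For $k\in\mathbb C$ put $$\Lambda(k)=\begin{pmatrix}0&ik\\ ik\beta&\theta k^2+1/\tau\end{pmatrix},\quad \omega_{1,2}(k)=\frac{1+\mu^2k^2\pm\sqrt{(1+\mu^2k^2)^2-4\alpha\tau k^2}}{2\tau},\quad S(k)=\frac1{\omega_1-\omega_2}\begin{pmatrix}1&1\\ \omega_1/ik&\omega_2/ik\end{pmatrix}.$$ For a function $y$ on $[0,l]$ let $\hat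 y(k)=\int_0^le^{-ikx}y(x)\,dx$, and for a function $y$ of time let $\tilde y^{(m)}(t)=\int_0^te^{-\omega_m(k)(t-s)}y(s)\,ds$, $m=1,2$; hats of $f(\cdot,t)$ and tildes of $f(x,\cdot)$ are written $\hat f(k,t)$, $\tilde f^{(m)}(x,t)$. Put $\hat u_0=(\hat\varphi,\hat\psi)^T$, $\hat F=(\hat f,0)^T$. For $\gamma\in\{\gamma_0,\gamma_l\}$, writing $\sigma_0,\sigma_l$ respectively, $$\sigma^{(1)}(k)=ik(\beta-\theta\omega_1)+\gamma(\omega_2-\theta k^2),\qquad \sigma^{(2)}(k)=ik(\beta-\theta\omega_2)+\gamma(\omega_1-\theta k^2),$$ $$\Delta_m(k)=e^{ikl}\sigma_0^{(m)}(k)\sigma_l^{(m)}(k)-e^{-ikl}\sigma_0^{(m)}(-k)\sigma_l^{(m)}(-k),$$ $$L_m=\varphi(0)e^{-\omega_mt}+\tilde f^{(m)}(0,t),\qquad R_m=\varphi(l)e^{-\omega_mt}+\tilde f^{(m)}(l,t),$$ $$V_1=-\omega_2e^{-\omega_1t}\hat\varphi+ike^{-\omega_1t}\hat\psi-\int_0^t\omega_2e^{-\omega_1(t-s)}\hat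 f(k,s)\,ds-(\omega_2-\theta k^2)\big[\tilde g^{(1)}+e^{-ikl}\tilde h^{(1)}\big],$$ $$V_2=\omega_1e^{-\omega_2t}\hat\varphi-ike^{-\omega_2t}\hat\psi+\int_0^t\omega_1e^{-\omega_2(t-s)}\hat f(k,s)\,ds+(\omega_1-\theta k^2)\big[\tilde g^{(2)}+e^{-ikl}\tilde h^{(2)}\big],$$ $$W_1=-ik\theta\,[L_1-e^{-ikl}R_1],\qquad W_2=ik\theta\,[L_2-e^{-ikl}R_2],$$ all at $(k,t)$. With $s_1=1$, $s_2=-1$ and $Y_m=V_m+W_m$ define $$\epsilon_0^{(m)}(k,t)=\frac{s_m}{\Delta_m(k)}\Big[-e^{ikl}\sigma_l^{(m)}(k)Y_m(k,t)+e^{-ikl}\sigma_l^{(m)}(-k)Y_m(-k,t)\Big],$$ $$\epsilon_l^{(m)}(k,t)=\frac{s_m}{\Delta_m(k)}\Big[\sigma_0^{(m)}(-k)Y_m(k,t)-\sigma_0^{(m)}(k)Y_m(-k,t)\Big]$$ (if $\alpha\tau=\mu^2$, one of the roots is identically $1/\tau$ and the corresponding $\sigma$ and $\Delta$ vanish identically;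 for this root $\epsilon_0,\epsilon_l$ are read as $0$), and $$a'(k,t)=\begin{pmatrix}-\sigma_0^{(1)}(k)\epsilon_0^{(1)}+(\omega_2-\theta k^2)\tilde g^{(1)}+ik\theta L_1\\ \sigma_0^{(2)}(k)\epsilon_0^{(2)}-(\omega_1-\theta k^2)\tilde g^{(2)}-ik\theta L_2\end{pmatrix},\qquad b'(k,t)=\begin{pmatrix}\sigma_l^{(1)}(-k)\epsilon_l^{(1)}-(\omega_2-\theta k^2)\tilde h^{(1)}+ik\theta R_1\\ -\sigma_l^{(2)}(-k)\epsilon_l^{(2)}+(\omega_1-\theta k^2)\tilde h^{(2)}-ik\theta R_2\end{pmatrix}.$$ **Paths.** Let $D=\{k:\operatorname{Re}\omega_1(k)<0\text{ or }\operatorname{Re}\omega_2(k)<0\}$ and, for $R>0$, $D_0^\pm=\{k\in D:\pm\operatorname{Im}k>0,\ |k|>R\}$; the boundary $\partial D_0^\pm$ is oriented so that $D_0^\pm$ lies on its left. Call $R$ admissible if, on the closure of $D_0^+\cup D_0^-$, $\Delta_m(k)\ne0$ whenever $\omega_m(k)\ne1/\tau$ ($m=1,2$). (For $\alpha\tau\ne\mu^2$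 this says that $\Delta_1$ and $\Delta_2$ have no zeros there.) **Claim.** There is $R_0>0$, depending only on $\alpha,\tau,\mu,l,\gamma_0,\gamma_l$, such that all $R\ge R_0$ are admissible. For every admissible $R>0$, all data, every solution $(e,q)$ as above, and all $0<x<l$, $t>0$, $$\begin{pmatrix}e(x,t)\\ q(x,t)\end{pmatrix}=\frac1{2\pi}\int_{-\infty}^{\infty}e^{ikx}e^{-\Lambda(k)t}\hat u_0(k)\,dk+\frac1{2\pi}\int_{-\infty}^\infty e^{ikx}\int_0^te^{-\Lambda(k)(t-s)}\hat F(k,s)\,ds\,dk$$ $$-\frac1{2\pi}\int_{\partial D_0^+}e^{ikx}S(k)a'(k,t)\,dk-\frac1{2\pi}\int_{\partial D_0^-}e^{ik(x-l)}S(k)b'(k,t)\,dk,$$ where the first two integrals converge as improper integrals and the two contour integrals converge absolutely. -/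

import Mathlib

open MeasureTheory Set Filter Topology
open Complex (I)

noncomputable section

namespace GK

/-! ## The initial-boundary value problem -/

/-- The coefficients of the problem: `α`, `τ`, `μ` of the equations, the length `l` of the interval,
and the coefficients `γ0`, `γl` of the boundary conditions. -/
structure Params where
  α : ℝ
  τ : ℝ
  μ : ℝ
  l : ℝ
  γ0 : ℝ
  γl : ℝ

/-- The sign conditions on the coefficients. -/
structure Params.Admissible (p : Params) : Prop where
  α_pos : 0 < p.α
  τ_pos : 0 < p.τ
  μ_pos : 0 < p.μ
  l_pos : 0 < p.l
  γ0_nonneg : 0 ≤ p.γ0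
  γl_nonneg : 0 ≤ p.γl

/-- The data: source `f x t`, initial values `φ x`, `ψ x`, boundary values `g t`, `h t`. -/
structure Data where
  f : ℝ → ℝ → ℝ
  φ : ℝ → ℝ
  ψ : ℝ → ℝ
  g : ℝ → ℝ
  h : ℝ → ℝ

/-- Time derivative on `[0, ∞)` (one-sided at `t = 0`). -/
def dt (u : ℝ → ℝ → ℝ) (x t : ℝ) : ℝ := derivWithin (fun s => u x s) (Ici 0) t

/-- Space derivative on `[0, l]` (one-sided at the end points). -/
def dx (l : ℝ) (u : ℝ → ℝ → ℝ) (x t : ℝ) : ℝ := derivWithin (fun y => u y t) (Icc 0 l) x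

/-- `u(x, t)` has a time derivative, continuous on `[0, l] × [0, ∞)`. -/
def HasContDt (l : ℝ) (u : ℝ → ℝ → ℝ) : Prop :=
  (∀ x ∈ Icc 0 l, DifferentiableOn ℝ (fun s => u x s) (Ici 0)) ∧
    ContinuousOn (fun z : ℝ × ℝ => dt u z.1 z.2) (Icc 0 l ×ˢ Ici 0)

/-- `u(x, t)` has a space derivative, continuous on `[0, l] × [0, ∞)`. -/
def HasContDx (l : ℝ) (u : ℝ → ℝ → ℝ) : Prop :=
  (∀ t ∈ Ici (0 : ℝ), DifferentiableOn ℝ (fun y => u y t) (Icc 0 l)) ∧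
    ContinuousOn (fun z : ℝ × ℝ => dx l u z.1 z.2) (Icc 0 l ×ˢ Ici 0)

/-- `(e, q)` is a classical solution, regular up to the boundary, of
`e_t + q_x = f`, `τ q_t + q - μ² q_xx + α e_x = 0` on `(0, l) × (0, ∞)` with `e = φ`, `q = ψ` at
`t = 0`, `γ0 e + q = g` at `x = 0` and `γl e - q = h` at `x = l`. -/
structure IsSolution (p : Params) (d : Data) (e q : ℝ → ℝ → ℝ) : Prop where
  f_cont : ContinuousOn (fun z : ℝ × ℝ => d.f z.1 z.2) (Icc 0 p.l ×ˢ Ici 0)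
  e_dt : HasContDt p.l e
  e_dx : HasContDx p.l e
  q_dt : HasContDt p.l q
  q_dx : HasContDx p.l q
  q_dxx : HasContDx p.l (dx p.l q)
  energy : ∀ x ∈ Ioo 0 p.l, ∀ t > 0, dt e x t + dx p.l q x t = d.f x t
  guyerKrumhansl : ∀ x ∈ Ioo 0 p.l, ∀ t > 0,
    p.τ * dt q x t + q x t - p.μ ^ 2 * dx p.l (dx p.l q) x t + p.α * dx p.l e x t = 0
  init_e : ∀ x ∈ Icc 0 p.l, e x 0 = d.φ x
  init_q : ∀ x ∈ Icc 0 p.l, q x 0 = d.ψ x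
  bdry_left : ∀ t > 0, p.γ0 * e 0 t + q 0 t = d.g t
  bdry_right : ∀ t > 0, p.γl * e p.l t - q p.l t = d.h t

/-! ## Dispersion relations, the matrices `Λ` and `S` -/

namespace Params

variable (p : Params)

def β : ℝ := p.α / p.τ

def θ : ℝ := p.μ ^ 2 / p.τ

/-- `Λ(k)`. -/
def Lam (k : ℂ) : Matrix (Fin 2) (Fin 2) ℂ :=
  !![0, I * k; I * k * p.β, p.θ * k ^ 2 + 1 / p.τ]

/-- The square root in the dispersion relations (principal branch). -/
def root (k : ℂ) : ℂ :=
  ((1 + p.μ ^ 2 * k ^ 2) ^ 2 - 4 * p.α * p.τ * k ^ 2 : ℂ) ^ (1 / 2 : ℂ)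

def ω₁ (k : ℂ) : ℂ := (1 + p.μ ^ 2 * k ^ 2 + p.root k) / (2 * p.τ)

def ω₂ (k : ℂ) : ℂ := (1 + p.μ ^ 2 * k ^ 2 - p.root k) / (2 * p.τ)

/-- `S(k)`, whose columns are eigenvectors of `Λ(k)`. -/
def S (k : ℂ) : Matrix (Fin 2) (Fin 2) ℂ :=
  (1 / (p.ω₁ k - p.ω₂ k)) • !![1, 1; p.ω₁ k / (I * k), p.ω₂ k / (I * k)]

/-- `σ^{(1)}` for the boundary coefficient `γ` (`γ0` gives `σ_0`, `γl` gives `σ_l`). -/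
def σ₁ (γ : ℝ) (k : ℂ) : ℂ :=
  I * k * (p.β - p.θ * p.ω₁ k) + γ * (p.ω₂ k - p.θ * k ^ 2)

/-- `σ^{(2)}` for the boundary coefficient `γ`. -/
def σ₂ (γ : ℝ) (k : ℂ) : ℂ :=
  I * k * (p.β - p.θ * p.ω₂ k) + γ * (p.ω₁ k - p.θ * k ^ 2)

/-- The determinants of the two systems of global relations. -/
def Δ₁ (k : ℂ) : ℂ :=
  Complex.exp (I * k * p.l) * p.σ₁ p.γ0 k * p.σ₁ p.γl k
    - Complex.exp (-(I * k * p.l)) * p.σ₁ p.γ0 (-k) * p.σ₁ p.γl (-k)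

def Δ₂ (k : ℂ) : ℂ :=
  Complex.exp (I * k * p.l) * p.σ₂ p.γ0 k * p.σ₂ p.γl k
    - Complex.exp (-(I * k * p.l)) * p.σ₂ p.γ0 (-k) * p.σ₂ p.γl (-k)

/-! ## The paths of integration -/

/-- The domain `D`. -/
def D : Set ℂ := {k | (p.ω₁ k).re < 0 ∨ (p.ω₂ k).re < 0}

/-- `D⁺`. -/
def Dplus : Set ℂ := {k | k ∈ p.D ∧ 0 < k.im}

/-- `D⁻`. -/
def Dminus : Set ℂ := {k | k ∈ p.D ∧ k.im < 0}

/-- The value of `k²` that belongs to the purely imaginary root `ω = iν` of the dispersion equation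
`τ ω² - (1 + μ² k²) ω + α k² = 0`. -/
def kSq (ν : ℝ) : ℂ := I * ν * (1 - p.τ * (I * ν)) / (p.α - p.μ ^ 2 * (I * ν))

/-- The curve `∂D⁺`, run through from left to right (the domain `D⁺` being on the left) when `ν`
runs from `-∞` to `∞`. The curve `∂D⁻ = -∂D⁺` is `ν ↦ -κ(ν)`. -/
def κ (ν : ℝ) : ℂ := I * (-p.kSq ν) ^ (1 / 2 : ℂ)

theorem κ_sq (ν : ℝ) : p.κ ν ^ 2 = p.kSq ν := by
  have h : ((-p.kSq ν) ^ (1 / 2 : ℂ)) ^ 2 = -p.kSq ν := by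
    rw [← Complex.cpow_nat_mul]; norm_num
  rw [κ, mul_pow, h, Complex.I_sq]; ring

theorem κ_im_nonneg (ν : ℝ) : 0 ≤ (p.κ ν).im := by
  have h : 0 ≤ ((-p.kSq ν) ^ (1 / 2 : ℂ)).re := by
    by_cases h0 : -p.kSq ν = 0
    · rw [h0, Complex.zero_cpow (by norm_num)]; simp
    · rw [Complex.cpow_def_of_ne_zero h0, Complex.exp_re]
      refine mul_nonneg (Real.exp_nonneg _) (Real.cos_nonneg_of_mem_Icc ?_)
      have e : (Complex.log (-p.kSq ν) * (1 / 2)).im = (-p.kSq ν).arg / 2 := by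
        have e2 : (1 / 2 : ℂ) = ((1 / 2 : ℝ) : ℂ) := by push_cast; rfl
        rw [e2, Complex.im_mul_ofReal, Complex.log_im]; ring
      rw [e]
      have h1 := Complex.neg_pi_lt_arg (-p.kSq ν)
      have h2 := Complex.arg_le_pi (-p.kSq ν)
      constructor <;> linarith
  rw [κ]; simpa using h

/-- The points of the curve `κ` in the open upper half-plane are exactly those at which one of the
roots `ω₁`, `ω₂` is purely imaginary. -/
theorem exists_κ_iff (hp : p.Admissible) {k : ℂ} (hk : 0 < k.im) :
    (∃ ν : ℝ, ν ≠ 0 ∧ p.κ ν = k) ↔ (p.ω₁ k).re = 0 ∨ (p.ω₂ k).re = 0 := by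
  have hτ : (p.τ : ℂ) ≠ 0 := by exact_mod_cast hp.τ_pos.ne'
  have hα : p.α ≠ 0 := hp.α_pos.ne'
  have hr : p.root k ^ 2 = (1 + p.μ ^ 2 * k ^ 2) ^ 2 - 4 * p.α * p.τ * k ^ 2 := by
    rw [root, ← Complex.cpow_nat_mul]; norm_num
  have hden (ν : ℝ) : (p.α - p.μ ^ 2 * (I * ν) : ℂ) ≠ 0 := by
    intro h
    have := congrArg Complex.re h
    have e : ((p.α : ℂ) - p.μ ^ 2 * (I * ν)).re = p.α := by
      have e3 : ((p.μ : ℂ) ^ 2 * (I * ν)) = ((p.μ ^ 2 * ν : ℝ) : ℂ) * I := by push_cast; ring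
      rw [e3, Complex.sub_re, Complex.re_ofReal_mul]; simp
    rw [e] at this
    exact hα (by simpa using this)
  have hroot (w : ℂ) : p.τ * w ^ 2 - (1 + p.μ ^ 2 * k ^ 2) * w + p.α * k ^ 2
      = p.τ * ((w - p.ω₁ k) * (w - p.ω₂ k)) := by
    rw [ω₁, ω₂]; field_simp; linear_combination hr
  have hiff (ν : ℝ) : k ^ 2 = p.kSq ν ↔ (I * ν = p.ω₁ k ∨ I * ν = p.ω₂ k) := by
    have h := hroot (I * ν)
    rw [kSq, eq_div_iff (hden ν)]
    constructor
    · intro h2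
      have : (p.τ : ℂ) * ((I * ν - p.ω₁ k) * (I * ν - p.ω₂ k)) = 0 := by
        rw [← h]; linear_combination h2
      rcases mul_eq_zero.1 ((mul_eq_zero.1 this).resolve_left hτ) with h3 | h3
      · exact Or.inl (sub_eq_zero.1 h3)
      · exact Or.inr (sub_eq_zero.1 h3)
    · intro h2
      have : (I * ν - p.ω₁ k) * (I * ν - p.ω₂ k) = 0 := by
        rcases h2 with h2 | h2 <;> rw [h2] <;> ring
      rw [this, mul_zero] at h
      linear_combination h
  constructor
  · rintro ⟨ν, -, h⟩
    have h2 := (hiff ν).1 (by rw [← h, κ_sq])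
    rcases h2 with h2 | h2
    · left; rw [← h2]; simp
    · right; rw [← h2]; simp
  · intro h
    have : ∃ ν : ℝ, k ^ 2 = p.kSq ν := by
      rcases h with h | h
      · exact ⟨(p.ω₁ k).im, (hiff _).2 (Or.inl (by apply Complex.ext <;> simp [h]))⟩
      · exact ⟨(p.ω₂ k).im, (hiff _).2 (Or.inr (by apply Complex.ext <;> simp [h]))⟩
    obtain ⟨ν, hν⟩ := this
    refine ⟨ν, ?_, ?_⟩
    · rintro rfl
      have : k ^ 2 = 0 := by rw [hν, kSq]; simp
      have : k = 0 := by simpa using this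
      rw [this] at hk; simp at hk
    · rw [← p.κ_sq] at hν
      rcases sq_eq_sq_iff_eq_or_eq_neg.1 hν with h1 | h1
      · exact h1.symm
      · have := p.κ_im_nonneg ν
        rw [h1] at hk; simp at hk; linarith

/-- `D₀(R)`: the part of `D` outside the disc of radius `R` around the origin. Its parts in the
upper and the lower half-plane are `D₀⁺` and `D₀⁻`. -/
def D₀ (R : ℝ) : Set ℂ := {k | k ∈ p.D ∧ R < ‖k‖}

/-- No zeros of the determinants on `D₀(R)` and its boundary. When `α τ = μ²`, one of the two roots
is identically `1/τ` and its determinant vanishes identically; that root is exempt. -/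
def PoleFree (R : ℝ) : Prop :=
  ∀ k ∈ closure (p.D₀ R),
    (p.ω₁ k ≠ 1 / p.τ → p.Δ₁ k ≠ 0) ∧ (p.ω₂ k ≠ 1 / p.τ → p.Δ₂ k ≠ 0)

/-- The path `∂D₀⁺` consists of the part of `∂D⁺` outside the disc of radius `R`, and of the arc of
the circle of radius `R` in `D⁺`, run through clockwise. -/
def IntegrableUpper (R : ℝ) (F : ℂ → Fin 2 → ℂ) : Prop :=
  IntegrableOn (fun ν : ℝ => deriv p.κ ν • F (p.κ ν)) {ν | R < ‖p.κ ν‖} ∧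
    IntegrableOn (fun y : ℝ => (I * (R * Complex.exp (I * y))) • F (R * Complex.exp (I * y)))
      {y | y ∈ Ioc (-Real.pi) Real.pi ∧ R * Complex.exp (I * y) ∈ p.Dplus}

/-- `∫_{∂D₀⁺} F(k) dk`. -/
def integralUpper (R : ℝ) (F : ℂ → Fin 2 → ℂ) : Fin 2 → ℂ :=
  (∫ ν : ℝ in {ν | R < ‖p.κ ν‖}, deriv p.κ ν • F (p.κ ν))
    - ∫ y : ℝ in {y | y ∈ Ioc (-Real.pi) Real.pi ∧ R * Complex.exp (I * y) ∈ p.Dplus},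
        (I * (R * Complex.exp (I * y))) • F (R * Complex.exp (I * y))

/-- The path `∂D₀⁻` consists of the part of `∂D⁻` outside the disc of radius `R`, and of the arc of
the circle of radius `R` in `D⁻`, run through clockwise. -/
def IntegrableLower (R : ℝ) (F : ℂ → Fin 2 → ℂ) : Prop :=
  IntegrableOn (fun ν : ℝ => (-deriv p.κ ν) • F (-p.κ ν)) {ν | R < ‖p.κ ν‖} ∧
    IntegrableOn (fun y : ℝ => (I * (R * Complex.exp (I * y))) • F (R * Complex.exp (I * y)))
      {y | y ∈ Ioc (-Real.pi) Real.pi ∧ R * Complex.exp (I * y) ∈ p.Dminus}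

/-- `∫_{∂D₀⁻} F(k) dk`. -/
def integralLower (R : ℝ) (F : ℂ → Fin 2 → ℂ) : Fin 2 → ℂ :=
  (∫ ν : ℝ in {ν | R < ‖p.κ ν‖}, (-deriv p.κ ν) • F (-p.κ ν))
    - ∫ y : ℝ in {y | y ∈ Ioc (-Real.pi) Real.pi ∧ R * Complex.exp (I * y) ∈ p.Dminus},
        (I * (R * Complex.exp (I * y))) • F (R * Complex.exp (I * y))

end Params

/-- `∫_{-∞}^{∞} F(k) dk = A` as an improper integral (the two limits are independent). -/
def HasImproperIntegral (F : ℝ → Fin 2 → ℂ) (A : Fin 2 → ℂ) : Prop :=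
  (∀ a b : ℝ, IntervalIntegrable F volume a b) ∧
    Tendsto (fun z : ℝ × ℝ => ∫ k in z.1..z.2, F k) (atBot ×ˢ atTop) (𝓝 A)

/-! ## Transforms of the data -/

/-- Fourier transform over `[0, l]`: `∫_0^l e^{-ikx} y(x) dx`. -/
def hat (l : ℝ) (y : ℝ → ℝ) (k : ℂ) : ℂ := ∫ x in (0 : ℝ)..l, Complex.exp (-(I * k * x)) * y x

/-- Time transform: `∫_0^t e^{-ω(t-s)} y(s) ds`. -/
def tilde (y : ℝ → ℝ) (ω : ℂ) (t : ℝ) : ℂ :=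
  ∫ s in (0 : ℝ)..t, Complex.exp (-(ω * (t - s))) * y s

section Known

variable (p : Params) (d : Data)

/-- The Fourier transform of the initial state. -/
def u0Hat (k : ℂ) : Fin 2 → ℂ := ![hat p.l d.φ k, hat p.l d.ψ k]

/-- The Fourier transform of the source at time `t`. -/
def fHat (k : ℂ) (t : ℝ) : ℂ := hat p.l (fun x => d.f x t) k

def FHat (k : ℂ) (t : ℝ) : Fin 2 → ℂ := ![fHat p d k t, 0]

/-- The integrand of the Fourier integral for the initial data. -/
def initialIntegrand (x t : ℝ) (k : ℝ) : Fin 2 → ℂ :=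
  Complex.exp (I * k * x) • (NormedSpace.exp (-(t : ℂ) • p.Lam k)).mulVec (u0Hat p d k)

/-- The integrand of the Fourier integral for the source. -/
def sourceIntegrand (x t : ℝ) (k : ℝ) : Fin 2 → ℂ :=
  Complex.exp (I * k * x) •
    ∫ s in (0 : ℝ)..t, (NormedSpace.exp (-((t : ℂ) - s) • p.Lam k)).mulVec (FHat p d k s)

def Φ₁ (k : ℂ) (t : ℝ) : ℂ :=
  -p.ω₂ k * Complex.exp (-(p.ω₁ k * t)) * hat p.l d.φ k
    + I * k * Complex.exp (-(p.ω₁ k * t)) * hat p.l d.ψ k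

def Φ₂ (k : ℂ) (t : ℝ) : ℂ :=
  p.ω₁ k * Complex.exp (-(p.ω₂ k * t)) * hat p.l d.φ k
    - I * k * Complex.exp (-(p.ω₂ k * t)) * hat p.l d.ψ k

def F₁ (k : ℂ) (t : ℝ) : ℂ :=
  ∫ s in (0 : ℝ)..t, -p.ω₂ k * Complex.exp (-(p.ω₁ k * (t - s))) * fHat p d k s

def F₂ (k : ℂ) (t : ℝ) : ℂ :=
  ∫ s in (0 : ℝ)..t, p.ω₁ k * Complex.exp (-(p.ω₂ k * (t - s))) * fHat p d k s

/-- `L₁`, `L₂` at the left end, `R₁`, `R₂` at the right end. -/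
def L₁ (k : ℂ) (t : ℝ) : ℂ :=
  d.φ 0 * Complex.exp (-(p.ω₁ k * t)) + tilde (d.f 0) (p.ω₁ k) t

def L₂ (k : ℂ) (t : ℝ) : ℂ :=
  d.φ 0 * Complex.exp (-(p.ω₂ k * t)) + tilde (d.f 0) (p.ω₂ k) t

def R₁ (k : ℂ) (t : ℝ) : ℂ :=
  d.φ p.l * Complex.exp (-(p.ω₁ k * t)) + tilde (d.f p.l) (p.ω₁ k) t

def R₂ (k : ℂ) (t : ℝ) : ℂ :=
  d.φ p.l * Complex.exp (-(p.ω₂ k * t)) + tilde (d.f p.l) (p.ω₂ k) t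

def V₁ (k : ℂ) (t : ℝ) : ℂ :=
  Φ₁ p d k t + F₁ p d k t - (p.ω₂ k - p.θ * k ^ 2) *
    (tilde d.g (p.ω₁ k) t + Complex.exp (-(I * k * p.l)) * tilde d.h (p.ω₁ k) t)

def V₂ (k : ℂ) (t : ℝ) : ℂ :=
  Φ₂ p d k t + F₂ p d k t + (p.ω₁ k - p.θ * k ^ 2) *
    (tilde d.g (p.ω₂ k) t + Complex.exp (-(I * k * p.l)) * tilde d.h (p.ω₂ k) t)

def W₁ (k : ℂ) (t : ℝ) : ℂ :=
  -(I * k * p.θ) * (L₁ p d k t - Complex.exp (-(I * k * p.l)) * R₁ p d k t)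

def W₂ (k : ℂ) (t : ℝ) : ℂ :=
  I * k * p.θ * (L₂ p d k t - Complex.exp (-(I * k * p.l)) * R₂ p d k t)

/-! The functions `ẽ₀^{(m)}(0, t)` (`eLeft`) and `ẽ₀^{(m)}(l, t)` (`eRight`), obtained from the
global relations by Cramer's rule with the unknown terms dropped. If `α τ = μ²`, then for the root
that is identically `1/τ` the division by `0` gives `0`; the coefficients `σ` that multiply these
functions vanish for that root. -/

def eLeft₁ (k : ℂ) (t : ℝ) : ℂ :=
  1 / p.Δ₁ k *
    (-(Complex.exp (I * k * p.l) * p.σ₁ p.γl k) * (V₁ p d k t + W₁ p d k t)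
      + Complex.exp (-(I * k * p.l)) * p.σ₁ p.γl (-k) * (V₁ p d (-k) t + W₁ p d (-k) t))

def eRight₁ (k : ℂ) (t : ℝ) : ℂ :=
  1 / p.Δ₁ k *
    (p.σ₁ p.γ0 (-k) * (V₁ p d k t + W₁ p d k t)
      - p.σ₁ p.γ0 k * (V₁ p d (-k) t + W₁ p d (-k) t))

def eLeft₂ (k : ℂ) (t : ℝ) : ℂ :=
  1 / p.Δ₂ k *
    (Complex.exp (I * k * p.l) * p.σ₂ p.γl k * (V₂ p d k t + W₂ p d k t)
      - Complex.exp (-(I * k * p.l)) * p.σ₂ p.γl (-k) * (V₂ p d (-k) t + W₂ p d (-k) t))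

def eRight₂ (k : ℂ) (t : ℝ) : ℂ :=
  1 / p.Δ₂ k *
    (-p.σ₂ p.γ0 (-k) * (V₂ p d k t + W₂ p d k t)
      + p.σ₂ p.γ0 k * (V₂ p d (-k) t + W₂ p d (-k) t))

/-- The vector `a'(k, t)`. -/
def aPrime (k : ℂ) (t : ℝ) : Fin 2 → ℂ :=
  ![-p.σ₁ p.γ0 k * eLeft₁ p d k t + (p.ω₂ k - p.θ * k ^ 2) * tilde d.g (p.ω₁ k) t,
    p.σ₂ p.γ0 k * eLeft₂ p d k t - (p.ω₁ k - p.θ * k ^ 2) * tilde d.g (p.ω₂ k) t]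
  + (I * k * p.θ) • ![L₁ p d k t, -L₂ p d k t]

/-- The vector `b'(k, t)`. -/
def bPrime (k : ℂ) (t : ℝ) : Fin 2 → ℂ :=
  ![p.σ₁ p.γl (-k) * eRight₁ p d k t - (p.ω₂ k - p.θ * k ^ 2) * tilde d.h (p.ω₁ k) t,
    -p.σ₂ p.γl (-k) * eRight₂ p d k t + (p.ω₁ k - p.θ * k ^ 2) * tilde d.h (p.ω₂ k) t]
  + (I * k * p.θ) • ![R₁ p d k t, -R₂ p d k t]

/-- The integrand over `∂D₀⁺`. -/
def upperIntegrand (x t : ℝ) (k : ℂ) : Fin 2 → ℂ :=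
  Complex.exp (I * k * x) • (p.S k).mulVec (aPrime p d k t)

/-- The integrand over `∂D₀⁻`. -/
def lowerIntegrand (x t : ℝ) (k : ℂ) : Fin 2 → ℂ :=
  Complex.exp (I * k * (x - p.l)) • (p.S k).mulVec (bPrime p d k t)

end Known

end GK

end

/-! The Fourier transform over `[0, l]` turns the system into an ordinary differential equation in
time, whose inhomogeneity consists of the source and of the boundary values of `q` and of the flux
`β e - θ q_x`. Duhamel's formula (`uHat_eq`) therefore writes the transformed solution as initial
term + source term + left boundary integral - `e^{-ikl}` times the right one, all four entire in
`k`. Multiplied by `e^{ikx}` and integrated over the real line, the left side gives back the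
solution at interior points (`tendsto_fourier_inversion`). Two tasks remain: to move the boundary
integrals to the contours, and to replace the unknown boundary values in them by data.

Moving. The left boundary integral grows at most linearly between the real axis and `∂D⁺` and decays
like `1/|k|` close to the axis, while `e^{ikx}` decays upwards. So the integral over the real line
equals the one over `∂D₀⁺` (`IsCorner.tendsto_integral_of_bound`). The right end is treated by `k ↦
-k`.

Replacing. The energy equation turns `q_x` at an end into `f - e_t`; integration by parts in time
and the boundary condition then leave, for each root `a` of the dispersion equation, the time
transforms of `e(0, ·)` and `e(l, ·)` as the only unknowns apart from values at time `t`. The roots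
are even in `k`, so the relations at `k` and `-k` form a 2 × 2 system with determinant `Δ`
(`known_eq`). Cramer's rule gives the coefficients in `a'` and `b'`, except that the terms with the
solution at time `t` are dropped. The error is the term `reflection` together with a multiple of `k
e(0, t)` or `k e(l, t)`. It is holomorphic where `Δ ≠ 0` and of polynomial growth, because `|σ(k)| ≤
2 |σ(-k)|` for large `k` (`exists_norm_sig_le`) keeps `Δ` away from cancellation. Multiplied by the
decaying exponential it integrates to zero over the contour (`IsCorner.integralUpper_reflection`).

Geometry. The dispersion equation is linear in `k²`, so `k² = zSq ω` for a given root `ω`, and `K`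
maps the closed left half-plane without `0` onto the corresponding closed part of the upper
half-plane. There `ω₂ ∘ K` is the identity and `ω₁ ∘ K = dual` has positive real part, so no branch
points occur. The values of `K` lie in a sector about the imaginary axis (`exists_le_im_K`), `|K
ω|²` is comparable to `|ω|`, and `|K|` increases along rays. Cauchy's theorem is therefore proved in
the `ω`-plane by pushing the arc radially to infinity (`IsCorner.integralUpper_eq_zero`).

If `α τ = μ²`, the root `dual` is constantly `1/τ` and its `σ` vanishes (`sig_dual_eq_zero`), so it
needs no condition on `Δ`. -/

noncomputable section

namespace GK

/-! ### Integrals depending on a parameter, and a radial form of Cauchy's theorem. -/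

section Generic

variable {E : Type*} [NormedAddCommGroup E] [NormedSpace ℂ E]

/-- A function that is continuous on `Icc a b` in the second variable may be extended constantly. -/
theorem continuous_comp_projIcc {X Y : Type*} [TopologicalSpace X] [TopologicalSpace Y] {a b : ℝ}
    (hab : a ≤ b) {F : X → ℝ → Y}
    (hF : ContinuousOn (fun z : X × ℝ => F z.1 z.2) (univ ×ˢ Icc a b)) :
    Continuous (fun z : X × ℝ => F z.1 (projIcc a b hab z.2)) := by
  have h : Continuous (fun z : X × ℝ => ((z.1, (projIcc a b hab z.2 : ℝ)) : X × ℝ)) := by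
    fun_prop
  exact hF.comp_continuous h fun z => ⟨mem_univ _, (projIcc a b hab z.2).2⟩

theorem intervalIntegral_projIcc {a b : ℝ} (hab : a ≤ b) (f : ℝ → E) :
    ∫ s in a..b, f (projIcc a b hab s) = ∫ s in a..b, f s := by
  refine intervalIntegral.integral_congr fun s hs => ?_
  rw [uIcc_of_le hab] at hs
  simp only [projIcc_of_mem hab hs]

theorem continuous_intervalIntegral_param {X : Type*} [TopologicalSpace X] {a b : ℝ}
    (hab : a ≤ b) {F : X → ℝ → E}
    (hF : ContinuousOn (fun z : X × ℝ => F z.1 z.2) (univ ×ˢ Icc a b)) :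
    Continuous fun k => ∫ s in a..b, F k s := by
  have h := intervalIntegral.continuous_parametric_intervalIntegral_of_continuous (μ := volume)
    (a₀ := a) (f := fun k s => F k (projIcc a b hab s)) (continuous_comp_projIcc hab hF)
    (s := fun _ => b) continuous_const
  refine h.congr fun k => ?_
  exact intervalIntegral_projIcc hab (F k)

/-- An integral over a compact interval depends holomorphically on a parameter. -/
theorem differentiable_intervalIntegral_param {a b : ℝ} (hab : a ≤ b) {F : ℂ → ℝ → E}
    (hF : ContinuousOn (fun z : ℂ × ℝ => F z.1 z.2) (univ ×ˢ Icc a b))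
    (hd : ∀ s ∈ Icc a b, Differentiable ℂ fun k => F k s) :
    Differentiable ℂ fun k => ∫ s in a..b, F k s := by
  intro k₀
  obtain ⟨C, hC⟩ := ((isCompact_closedBall k₀ 2).prod (isCompact_Icc (a := a) (b := b))
    ).exists_bound_of_continuousOn (hF.mono (prod_mono (subset_univ _) le_rfl))
  have hcs (k : ℂ) : ContinuousOn (F k) (Icc a b) :=
    hF.comp (f := fun s => (k, s)) (by fun_prop) fun s hs => ⟨mem_univ _, hs⟩
  have hmeas (k : ℂ) : AEStronglyMeasurable (F k) (volume.restrict (uIoc a b)) := by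
    rw [uIoc_of_le hab]
    exact ((hcs k).mono Ioc_subset_Icc_self).aestronglyMeasurable measurableSet_Ioc
  -- Cauchy's estimate on the unit circle about `k`, which stays in the ball of radius 2 where `C`
  -- bounds `F`.
  have hbound : ∀ s ∈ Icc a b, ∀ k ∈ Metric.ball k₀ 1, ‖deriv (fun k => F k s) k‖ ≤ C := by
    intro s hs k hk
    have h := Complex.norm_deriv_le_of_forall_mem_sphere_norm_le (c := k) (R := 1) (C := C)
      (f := fun k => F k s) one_pos (hd s hs).diffContOnCl fun z hz => hC (z, s) ⟨?_, hs⟩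
    · simpa using h
    · rw [Metric.mem_closedBall]
      rw [Metric.mem_ball] at hk
      rw [Metric.mem_sphere] at hz
      linarith [dist_triangle z k k₀]
  have hmeas' : AEStronglyMeasurable (fun s => deriv (fun k => F k s) k₀)
      (volume.restrict (uIoc a b)) := by
    rw [uIoc_of_le hab]
    -- The derivative is measurable in `s` as a pointwise limit of difference quotients along
    -- `1/(n+1)`.
    have hlim : ∀ᵐ s ∂(volume.restrict (Ioc a b)), Tendsto
        (fun n : ℕ => ((n + 1 : ℂ)) • (F (k₀ + 1 / ((n : ℂ) + 1)) s - F k₀ s)) atTop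
        (𝓝 (deriv (fun k => F k s) k₀)) := by
      refine (ae_restrict_iff' measurableSet_Ioc).2 (ae_of_all _ fun s hs => ?_)
      have h1 := (hd s (Ioc_subset_Icc_self hs) k₀).hasDerivAt.tendsto_slope_zero
      have h2 : Tendsto (fun n : ℕ => 1 / ((n : ℂ) + 1)) atTop (𝓝[≠] 0) := by
        refine tendsto_nhdsWithin_iff.2 ⟨tendsto_one_div_add_atTop_nhds_zero_nat, ?_⟩
        refine Eventually.of_forall fun n => ?_
        have : (n : ℂ) + 1 ≠ 0 := by exact_mod_cast Nat.succ_ne_zero n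
        simpa using this
      have h3 := h1.comp h2
      refine h3.congr fun n => ?_
      simp
    refine aestronglyMeasurable_of_tendsto_ae atTop (fun n => ?_) hlim
    have h1 := hmeas (k₀ + 1 / ((n : ℂ) + 1))
    have h2 := hmeas k₀
    rw [uIoc_of_le hab] at h1 h2
    exact (h1.sub h2).const_smul _
  have h := intervalIntegral.hasDerivAt_integral_of_dominated_loc_of_deriv_le (μ := volume)
    (a := a) (b := b) (F := F) (F' := fun k s => deriv (fun k => F k s) k) (x₀ := k₀)
    (bound := fun _ => C) (Metric.ball_mem_nhds k₀ one_pos) (Eventually.of_forall hmeas)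
    ((hcs k₀).intervalIntegrable_of_Icc hab) hmeas'
    (ae_of_all _ fun s hs k hk => by
      rw [uIoc_of_le hab] at hs
      exact hbound s (Ioc_subset_Icc_self hs) k hk) (by simp)
    (ae_of_all _ fun s hs k hk => by
      rw [uIoc_of_le hab] at hs
      exact (hd s (Ioc_subset_Icc_self hs) k).hasDerivAt)
  exact h.2.differentiableAt

set_option maxHeartbeats 800000 in
/-- Homotopy invariance along rays: for a holomorphic `h`, the integrals of `h` over the paths
`e^σ w` for `σ = 0` and `σ = S` differ by the integrals along the rays through the end points. -/
theorem integral_radial_homotopy [CompleteSpace E] {V : Set ℂ} (hV : IsOpen V)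
    {h : ℂ → E}
    (hh : DifferentiableOn ℂ h V) {y₀ y₁ S : ℝ} (hy : y₀ ≤ y₁) (hS : 0 ≤ S) {w w' : ℝ → ℂ}
    (hw : ContinuousOn w (Icc y₀ y₁)) (hw' : ContinuousOn w' (Icc y₀ y₁))
    (hd : ∀ y ∈ Ioo y₀ y₁, HasDerivAt w (w' y) y)
    (hm : ∀ σ ∈ Icc 0 S, ∀ y ∈ Icc y₀ y₁, (Real.exp σ : ℂ) * w y ∈ V) :
    (∫ y in y₀..y₁, (Real.exp S * w' y : ℂ) • h (Real.exp S * w y))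
      - ∫ y in y₀..y₁, (w' y : ℂ) • h (w y)
    = ∫ σ in (0 : ℝ)..S, ((Real.exp σ * w y₁ : ℂ) • h (Real.exp σ * w y₁)
        - (Real.exp σ * w y₀ : ℂ) • h (Real.exp σ * w y₀)) := by
  have hh' : ContinuousOn (deriv h) V := (hh.deriv hV).continuousOn
  have hV' : ∀ z ∈ V, HasDerivAt h (deriv h z) z := fun z hz =>
    (hh.differentiableAt (hV.mem_nhds hz)).hasDerivAt
  have hexp (σ : ℝ) : HasDerivAt (fun σ : ℝ => (Real.exp σ : ℂ)) (Real.exp σ) σ :=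
    (Real.hasDerivAt_exp σ).ofReal_comp
  set g : ℝ → ℝ → E := fun σ y => (Real.exp σ * w' y : ℂ) • h (Real.exp σ * w y) with hg
  set k : ℝ → ℝ → E := fun σ y => (Real.exp σ * w y : ℂ) • h (Real.exp σ * w y) with hk
  -- `d` is both `∂g/∂σ` and `∂k/∂y`, which says that `h(z) dz` is closed. Integrating `d` over the
  -- rectangle in the two orders gives the two sides.
  set d : ℝ → ℝ → E := fun σ y => (Real.exp σ * w' y : ℂ) • ((Real.exp σ * w y : ℂ) •
    deriv h (Real.exp σ * w y) + h (Real.exp σ * w y)) with hdd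
  have hmaps : MapsTo (fun z : ℝ × ℝ => (Real.exp z.1 : ℂ) * w z.2) (Icc 0 S ×ˢ Icc y₀ y₁) V :=
    fun z hz => hm z.1 hz.1 z.2 hz.2
  have hcw : ContinuousOn (fun z : ℝ × ℝ => (Real.exp z.1 : ℂ) * w z.2)
      (Icc 0 S ×ˢ Icc y₀ y₁) := by
    refine ContinuousOn.mul (by fun_prop) (hw.comp continuousOn_snd fun z hz => hz.2)
  have hcw' : ContinuousOn (fun z : ℝ × ℝ => (Real.exp z.1 : ℂ) * w' z.2)
      (Icc 0 S ×ˢ Icc y₀ y₁) := by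
    refine ContinuousOn.mul (by fun_prop) (hw'.comp continuousOn_snd fun z hz => hz.2)
  have hch := hh.continuousOn.comp hcw hmaps
  have hch' := hh'.comp hcw hmaps
  have hcd : ContinuousOn (Function.uncurry d) (Icc 0 S ×ˢ Icc y₀ y₁) :=
    hcw'.smul ((hcw.smul hch').add hch)
  have hck : ContinuousOn (Function.uncurry k) (Icc 0 S ×ˢ Icc y₀ y₁) := hcw.smul hch
  have hcg : ContinuousOn (Function.uncurry g) (Icc 0 S ×ˢ Icc y₀ y₁) := hcw'.smul hch
  have s1 {F : ℝ → ℝ → E} (hF : ContinuousOn (Function.uncurry F) (Icc 0 S ×ˢ Icc y₀ y₁)) {y : ℝ}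
      (hy : y ∈ Icc y₀ y₁) : ContinuousOn (fun σ => F σ y) (Icc 0 S) :=
    hF.comp (f := fun σ => (σ, y)) (by fun_prop) fun s hs => ⟨hs, hy⟩
  have s2 {F : ℝ → ℝ → E} (hF : ContinuousOn (Function.uncurry F) (Icc 0 S ×ˢ Icc y₀ y₁)) {σ : ℝ}
      (hσ : σ ∈ Icc 0 S) : ContinuousOn (fun y => F σ y) (Icc y₀ y₁) :=
    hF.comp (f := fun y => (σ, y)) (by fun_prop) fun s hs => ⟨hσ, hs⟩
  have e1 : ∀ y ∈ Icc y₀ y₁, ∫ σ in (0 : ℝ)..S, d σ y = g S y - g 0 y := by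
    intro y hy'
    refine intervalIntegral.integral_eq_sub_of_hasDerivAt_of_le hS (s1 hcg hy') (fun σ hσ => ?_)
      ((s1 hcd hy').intervalIntegrable_of_Icc hS)
    have hin := hm σ (Ioo_subset_Icc_self hσ) y hy'
    have h1 := ((hexp σ).mul_const (w' y)).smul
      (HasDerivAt.scomp σ (hV' _ hin) ((hexp σ).mul_const (w y)))
    refine h1.congr_deriv ?_
    simp only [hdd, Function.comp, smul_add, smul_smul]
  have e2 : ∀ σ ∈ Icc 0 S, ∫ y in y₀..y₁, d σ y = k σ y₁ - k σ y₀ := by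
    intro σ hσ
    refine intervalIntegral.integral_eq_sub_of_hasDerivAt_of_le hy (s2 hck hσ) (fun y hy' => ?_)
      ((s2 hcd hσ).intervalIntegrable_of_Icc hy)
    have hin := hm σ hσ y (Ioo_subset_Icc_self hy')
    have h0 : HasDerivAt (fun y => (Real.exp σ : ℂ) * w y) (Real.exp σ * w' y) y :=
      (hd y hy').const_mul _
    have h1 := h0.smul (HasDerivAt.scomp y (hV' _ hin) h0)
    refine h1.congr_deriv ?_
    simp only [hdd, Function.comp, smul_add, smul_smul]
    rw [mul_comm]
  have hint : IntegrableOn (Function.uncurry d) (uIoc 0 S ×ˢ uIoc y₀ y₁) := by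
    rw [uIoc_of_le hS, uIoc_of_le hy]
    exact (hcd.integrableOn_compact (isCompact_Icc.prod isCompact_Icc)).mono_set
      (prod_mono Ioc_subset_Icc_self Ioc_subset_Icc_self)
  have hswap := MeasureTheory.intervalIntegral_intervalIntegral_swap hint
  have hl : ∫ σ in (0 : ℝ)..S, ∫ y in y₀..y₁, d σ y = ∫ σ in (0 : ℝ)..S, (k σ y₁ - k σ y₀) :=
    intervalIntegral.integral_congr fun σ hσ => e2 σ (by rwa [uIcc_of_le hS] at hσ)
  have hr : ∫ y in y₀..y₁, ∫ σ in (0 : ℝ)..S, d σ y = ∫ y in y₀..y₁, (g S y - g 0 y) :=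
    intervalIntegral.integral_congr fun y hy' => e1 y (by rwa [uIcc_of_le hy] at hy')
  rw [hl, hr, intervalIntegral.integral_sub
    ((s2 hcg (right_mem_Icc.2 hS)).intervalIntegrable_of_Icc hy)
    ((s2 hcg (left_mem_Icc.2 hS)).intervalIntegrable_of_Icc hy)] at hswap
  rw [hswap]
  simp [hg]

end Generic

end GK

namespace GK

/-! ### Fourier inversion as an improper integral. -/

section Fourier

/-- The Gauss function centred at `x`, as a test case of the inversion formula. -/
theorem integral_fourier_gaussian (x k : ℝ) :
    ∫ ξ : ℝ, Complex.exp (I * k * (x - ξ)) * Real.exp (-(ξ - x) ^ 2)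
      = (Real.pi : ℂ) ^ (1 / 2 : ℂ) * Complex.exp (-(k : ℂ) ^ 2 / 4) := by
  have h := fourierIntegral_gaussian (b := 1) (by simp) (-k : ℂ)
  rw [← integral_sub_right_eq_self _ x] at h
  simp only [div_one] at h
  rw [neg_sq, mul_one] at h
  rw [← h]
  refine integral_congr_ae (ae_of_all _ fun ξ => ?_)
  simp only [Complex.ofReal_exp]
  push_cast
  congr 2
  · ring
  · ring

theorem integral_exp_neg_sq_div_four :
    ∫ k : ℝ, (Real.pi : ℂ) ^ (1 / 2 : ℂ) * Complex.exp (-(k : ℂ) ^ 2 / 4) = 2 * Real.pi := by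
  rw [integral_const_mul]
  have h := fourierIntegral_gaussian (b := 1 / 4) (by norm_num) 0
  have e : ∫ k : ℝ, Complex.exp (-(k : ℂ) ^ 2 / 4)
      = ∫ k : ℝ, Complex.exp (I * 0 * k) * Complex.exp (-(1 / 4) * (k : ℂ) ^ 2) := by
    refine integral_congr_ae (ae_of_all _ fun k => ?_)
    simp only [mul_zero, zero_mul, Complex.exp_zero, one_mul]
    congr 1; ring
  rw [e, h]
  have e2 : ((Real.pi : ℂ) / (1 / 4)) = ((4 : ℝ) : ℂ) * (Real.pi : ℝ) := by push_cast; ring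
  rw [e2, Complex.mul_cpow_ofReal_nonneg (by norm_num) Real.pi_pos.le]
  have e3 : ((4 : ℝ) : ℂ) ^ (1 / 2 : ℂ) = 2 := by
    have e5 : (1 / 2 : ℂ) = ((1 / 2 : ℝ) : ℂ) := by push_cast; rfl
    rw [e5, ← Complex.ofReal_cpow (by norm_num), ← Real.sqrt_eq_rpow]
    have : (4 : ℝ) = 2 ^ 2 := by norm_num
    rw [this, Real.sqrt_sq (by norm_num)]
    norm_num
  have e4 : (Real.pi : ℂ) ^ (1 / 2 : ℂ) * (Real.pi : ℂ) ^ (1 / 2 : ℂ) = Real.pi := by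
    rw [← Complex.cpow_add _ _ (by exact_mod_cast Real.pi_ne_zero)]; norm_num
  rw [e3]
  simp only [ne_eq, OfNat.ofNat_ne_zero, not_false_eq_true, zero_pow, neg_zero, zero_div,
    Complex.exp_zero, mul_one]
  linear_combination 2 * e4

theorem integrable_exp_neg_sq_div_four :
    Integrable fun k : ℝ => (Real.pi : ℂ) ^ (1 / 2 : ℂ) * Complex.exp (-(k : ℂ) ^ 2 / 4) := by
  refine Integrable.const_mul ?_ _
  have h := integrable_cexp_neg_mul_sq (b := 1 / 4) (by norm_num)
  refine h.congr (ae_of_all _ fun k => ?_)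
  simp only
  congr 1; ring

/-- If `(x - ξ) w(ξ)` and `w` are integrable, the Fourier integral of `(x - ξ) w(ξ)` at `x`
converges to `0`. -/
theorem tendsto_fourier_of_vanishing {w : ℝ → ℂ} {x : ℝ} (hw : Integrable w)
    (hr : Integrable fun ξ : ℝ => (x - ξ : ℂ) * w ξ) :
    (∀ a b : ℝ, IntervalIntegrable
      (fun k : ℝ => ∫ ξ : ℝ, Complex.exp (I * k * (x - ξ)) * ((x - ξ : ℂ) * w ξ)) volume a b) ∧
    Tendsto (fun z : ℝ × ℝ => ∫ k in z.1..z.2,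
      ∫ ξ : ℝ, Complex.exp (I * k * (x - ξ)) * ((x - ξ : ℂ) * w ξ)) (atBot ×ˢ atTop) (𝓝 0) := by
  have hnorm (k ξ : ℝ) : ‖Complex.exp (I * k * (x - ξ))‖ = 1 := by
    have : I * k * (x - ξ) = ((k * (x - ξ) : ℝ) : ℂ) * I := by push_cast; ring
    rw [this, Complex.norm_exp_ofReal_mul_I]
  have hcont (k : ℝ) : Continuous fun ξ : ℝ => Complex.exp (I * k * (x - ξ)) := by fun_prop
  -- Up to the factor `-i` the integrand in `k` is the derivative of `W`. So its integral is `-i (W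
  -- b - W a)`, and the Riemann–Lebesgue lemma sends both values to 0, independently of each other.
  set W : ℝ → ℂ := fun k => ∫ ξ : ℝ, Complex.exp (I * k * (x - ξ)) * w ξ with hW
  have hd (k₀ : ℝ) : HasDerivAt W
      (∫ ξ : ℝ, I * (Complex.exp (I * k₀ * (x - ξ)) * ((x - ξ : ℂ) * w ξ))) k₀ := by
    refine (hasDerivAt_integral_of_dominated_loc_of_deriv_le (μ := volume) (s := univ)
      (F := fun (k : ℝ) (ξ : ℝ) => Complex.exp (I * k * (x - ξ)) * w ξ)
      (F' := fun (k : ℝ) (ξ : ℝ) => I * (Complex.exp (I * k * (x - ξ)) * ((x - ξ : ℂ) * w ξ)))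
      (bound := fun ξ : ℝ => ‖(x - ξ : ℂ) * w ξ‖) univ_mem ?_ ?_ ?_ ?_ hr.norm ?_).2
    · exact Eventually.of_forall fun k =>
        (hcont k).aestronglyMeasurable.mul hw.aestronglyMeasurable
    · exact hw.bdd_mul (c := 1) (hcont k₀).aestronglyMeasurable
        (ae_of_all _ fun ξ => (hnorm k₀ ξ).le)
    · exact ((hcont k₀).aestronglyMeasurable.mul hr.aestronglyMeasurable).const_mul I
    · refine ae_of_all _ fun ξ k _ => ?_
      rw [norm_mul, norm_mul, hnorm]; simp
    · refine ae_of_all _ fun ξ k _ => ?_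
      have h1 : HasDerivAt (fun k : ℝ => I * (k : ℂ) * (x - ξ)) (I * 1 * (x - ξ)) k :=
        ((Complex.ofRealCLM.hasDerivAt (x := k)).const_mul I).mul_const _
      refine (h1.cexp.mul_const (w ξ)).congr_deriv ?_
      ring
  have hc : Continuous fun k : ℝ =>
      ∫ ξ : ℝ, Complex.exp (I * k * (x - ξ)) * ((x - ξ : ℂ) * w ξ) := by
    refine continuous_of_dominated (bound := fun ξ : ℝ => ‖(x - ξ : ℂ) * w ξ‖) ?_ ?_ hr.norm ?_
    · exact fun k => (hcont k).aestronglyMeasurable.mul hr.aestronglyMeasurable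
    · exact fun k => ae_of_all _ fun ξ => by rw [norm_mul, hnorm, one_mul]
    · exact ae_of_all _ fun ξ => by fun_prop
  have hftc (a b : ℝ) : ∫ k in a..b,
      ∫ ξ : ℝ, Complex.exp (I * k * (x - ξ)) * ((x - ξ : ℂ) * w ξ) = -I * (W b - W a) := by
    have h1 := intervalIntegral.integral_eq_sub_of_hasDerivAt (a := a) (b := b)
      (fun k _ => (hd k)) ?_
    · rw [← h1]
      simp_rw [integral_const_mul]
      rw [intervalIntegral.integral_const_mul, ← mul_assoc]
      simp
    · simp_rw [integral_const_mul]
      exact (hc.const_smul I).intervalIntegrable _ _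
  have hlim : Tendsto W (cocompact ℝ) (𝓝 0) := by
    have h1 := Real.tendsto_integral_exp_smul_cocompact w
    have h2 : Tendsto (fun k : ℝ => k / (2 * Real.pi)) (cocompact ℝ) (cocompact ℝ) := by
      have := (Homeomorph.mulRight₀ ((2 * Real.pi)⁻¹ : ℝ) (by positivity)).isClosedEmbedding
      exact this.tendsto_cocompact
    have h3 := (h1.comp h2).norm
    rw [norm_zero] at h3
    refine tendsto_zero_iff_norm_tendsto_zero.2 (h3.congr fun k => ?_)
    have e : W k = Complex.exp (I * k * x) * ∫ v : ℝ, Real.fourierChar (-(v * (k / (2 * Real.pi)))) • w v := by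
      rw [hW, ← integral_const_mul]
      refine integral_congr_ae (ae_of_all _ fun ξ => ?_)
      simp only [Circle.smul_def, Real.fourierChar_apply, smul_eq_mul]
      rw [← mul_assoc, ← Complex.exp_add]
      congr 2
      have : (Real.pi : ℂ) ≠ 0 := by exact_mod_cast Real.pi_ne_zero
      push_cast
      field_simp
      ring
    rw [e, norm_mul]
    have := hnorm k (x - x)
    have e1 : ‖Complex.exp (I * k * x)‖ = 1 := by
      have := hnorm k 0
      rw [← hnorm k 0]
      have : I * k * (x - (0 : ℝ)) = I * k * x := by simp
      have h4 : I * k * x = ((k * x : ℝ) : ℂ) * I := by push_cast; ring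
      rw [this]
    rw [e1, one_mul]
    rfl
  refine ⟨fun a b => hc.intervalIntegrable a b, ?_⟩
  simp_rw [hftc]
  have h1 : Tendsto (fun z : ℝ × ℝ => W z.2) (atBot ×ˢ atTop) (𝓝 0) :=
    (hlim.mono_left atTop_le_cocompact).comp tendsto_snd
  have h2 : Tendsto (fun z : ℝ × ℝ => W z.1) (atBot ×ˢ atTop) (𝓝 0) :=
    (hlim.mono_left atBot_le_cocompact).comp tendsto_fst
  simpa using (h1.sub h2).const_mul (-I)

theorem integrable_gaussian_shift (x : ℝ) : Integrable fun ξ : ℝ => Real.exp (-(ξ - x) ^ 2) := by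
  have h := (integrable_exp_neg_mul_sq (b := 1) one_pos).comp_sub_right x
  simpa using h

/-- The difference quotient in the proof of the inversion formula. -/
theorem integrable_inversion_quotient {l x : ℝ} (hx : x ∈ Ioo 0 l) {y : ℝ → ℝ}
    (hy : DifferentiableOn ℝ y (Icc 0 l))
    (hy' : ContinuousOn (derivWithin y (Icc 0 l)) (Icc 0 l)) :
    Integrable (fun ξ => (indicator (Icc 0 l) y ξ - y x * Real.exp (-(ξ - x) ^ 2)) / (x - ξ)) := by
  obtain ⟨M, hM⟩ := isCompact_Icc.exists_bound_of_continuousOn hy'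
  have hxI : x ∈ Icc 0 l := Ioo_subset_Icc_self hx
  have hl : 0 < l := hx.1.trans hx.2
  -- On `[0, l]` the quotient is bounded by the mean value inequality. Outside only the Gaussian is
  -- left, and the denominator is at least the distance `δ` from `x` to the end points.
  set δ := min x (l - x) with hδ
  have hδ0 : 0 < δ := lt_min hx.1 (by linarith [hx.2])
  have hind : Integrable (indicator (Icc 0 l) y) :=
    (hy.continuousOn.integrableOn_compact isCompact_Icc).integrable_indicator measurableSet_Icc
  have hG := integrable_gaussian_shift x
  have hb1 : Integrable (indicator (Icc 0 l) fun _ => M + |y x| * l) :=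
    (integrableOn_const (by simp) (by simp)).integrable_indicator measurableSet_Icc
  refine (hb1.add (hG.const_mul (|y x| / δ))).mono' ?_ (ae_of_all _ fun ξ => ?_)
  · simp_rw [div_eq_mul_inv]
    exact (hind.sub (hG.const_mul (y x))).aestronglyMeasurable.mul
      (measurable_const.sub measurable_id).inv.aestronglyMeasurable
  · rw [norm_div, Real.norm_eq_abs, Real.norm_eq_abs, Pi.add_apply]
    have hG0 := Real.exp_pos (-(ξ - x) ^ 2)
    by_cases hξ : ξ ∈ Icc 0 l
    · rw [indicator_of_mem hξ, indicator_of_mem hξ]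
      have h1 := (convex_Icc 0 l).norm_image_sub_le_of_norm_derivWithin_le hy hM hxI hξ
      rw [Real.norm_eq_abs, Real.norm_eq_abs] at h1
      have h2 : |1 - Real.exp (-(ξ - x) ^ 2)| ≤ l * |ξ - x| := by
        have h3 := Real.add_one_le_exp (-(ξ - x) ^ 2)
        have h4 : Real.exp (-(ξ - x) ^ 2) ≤ 1 := Real.exp_le_one_iff.2 (by nlinarith)
        rw [abs_of_nonneg (by linarith)]
        have h5 : |ξ - x| ≤ l := by
          rw [abs_le]; constructor <;> linarith [hξ.1, hξ.2, hxI.1, hxI.2]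
        have h6 : (ξ - x) ^ 2 = |ξ - x| * |ξ - x| := by rw [← sq, sq_abs]
        nlinarith [abs_nonneg (ξ - x)]
      have h3 : |y ξ - y x * Real.exp (-(ξ - x) ^ 2)| ≤ (M + |y x| * l) * |x - ξ| := by
        have e : y ξ - y x * Real.exp (-(ξ - x) ^ 2)
          = (y ξ - y x) + y x * (1 - Real.exp (-(ξ - x) ^ 2)) := by ring
        rw [e, abs_sub_comm x ξ]
        refine (abs_add_le _ _).trans ?_
        rw [abs_mul]
        nlinarith [abs_nonneg (y x)]
      have h4 : |y ξ - y x * Real.exp (-(ξ - x) ^ 2)| / |x - ξ| ≤ M + |y x| * l := by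
        refine div_le_of_le_mul₀ (abs_nonneg _) ?_ h3
        have := (norm_nonneg _).trans (hM x hxI)
        positivity
      have : 0 ≤ |y x| / δ * Real.exp (-(ξ - x) ^ 2) := by positivity
      linarith
    · rw [indicator_of_notMem hξ, indicator_of_notMem hξ, zero_sub, abs_neg, abs_mul, zero_add,
        abs_of_pos hG0]
      have h1 : δ ≤ |x - ξ| := by
        rw [mem_Icc, not_and_or, not_le, not_le] at hξ
        rcases hξ with h | h
        · exact (min_le_left _ _).trans ((by linarith : x ≤ x - ξ).trans (le_abs_self _))
        · exact (min_le_right _ _).trans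
            ((by linarith : l - x ≤ -(x - ξ)).trans (neg_le_abs _))
      rw [div_mul_eq_mul_div]
      gcongr

/-- Fourier inversion for a `C¹` function on `[0, l]` at an interior point, as an improper
integral. -/
theorem tendsto_fourier_inversion {l x : ℝ} (hx : x ∈ Ioo 0 l) {y : ℝ → ℝ}
    (hy : DifferentiableOn ℝ y (Icc 0 l))
    (hy' : ContinuousOn (derivWithin y (Icc 0 l)) (Icc 0 l)) :
    Tendsto (fun z : ℝ × ℝ => ∫ k in z.1..z.2, Complex.exp (I * (k : ℝ) * x) * hat l y (k : ℝ))
      (atBot ×ˢ atTop) (𝓝 (2 * Real.pi * y x)) := by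
  have hl : 0 < l := hx.1.trans hx.2
  -- A multiple of a Gaussian, for which inversion is explicit, is subtracted so that `r` vanishes
  -- at `x`. Then `r ξ / (x - ξ)` is integrable and `tendsto_fourier_of_vanishing` applies; the
  -- value 0 of this quotient at `ξ = x` is consistent with `r x = 0`.
  set r : ℝ → ℝ := fun ξ => indicator (Icc 0 l) y ξ - y x * Real.exp (-(ξ - x) ^ 2) with hr
  have hind : Integrable (indicator (Icc 0 l) y) :=
    (hy.continuousOn.integrableOn_compact isCompact_Icc).integrable_indicator measurableSet_Icc
  have hG := integrable_gaussian_shift x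
  have hrint : Integrable r := hind.sub (hG.const_mul (y x))
  have hrx (ξ : ℝ) : (x - ξ : ℂ) * ((r ξ / (x - ξ) : ℝ) : ℂ) = r ξ := by
    rcases eq_or_ne ξ x with h | h
    · have : r x = 0 := by simp [hr, indicator_of_mem (Ioo_subset_Icc_self hx)]
      simp [h, this]
    · have : (x : ℂ) - ξ ≠ 0 := by
        rw [sub_ne_zero]; exact_mod_cast h.symm
      push_cast
      field_simp
  have hw := (integrable_inversion_quotient hx hy hy').ofReal (𝕜 := ℂ)
  have hv := tendsto_fourier_of_vanishing (x := x)
    (w := fun ξ => ((r ξ / (x - ξ) : ℝ) : ℂ)) hw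
    (by simp_rw [hrx]; exact hrint.ofReal)
  simp_rw [hrx] at hv
  have hnorm (k ξ : ℝ) : ‖Complex.exp (I * k * (x - ξ))‖ = 1 := by
    have : I * k * (x - ξ) = ((k * (x - ξ) : ℝ) : ℂ) * I := by push_cast; ring
    rw [this, Complex.norm_exp_ofReal_mul_I]
  have hbdd {v : ℝ → ℝ} (hv : Integrable v) (k : ℝ) :
      Integrable fun ξ : ℝ => Complex.exp (I * k * (x - ξ)) * (v ξ : ℂ) :=
    hv.ofReal.bdd_mul (c := 1)
      (by fun_prop : Continuous fun ξ : ℝ => Complex.exp (I * k * (x - ξ))).aestronglyMeasurable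
      (ae_of_all _ fun ξ => (hnorm k ξ).le)
  have hsplit (k : ℝ) : Complex.exp (I * k * x) * hat l y k
      = (∫ ξ : ℝ, Complex.exp (I * k * (x - ξ)) * (r ξ : ℂ))
        + y x * ((Real.pi : ℂ) ^ (1 / 2 : ℂ) * Complex.exp (-(k : ℂ) ^ 2 / 4)) := by
    have h1 : Complex.exp (I * k * x) * hat l y k
        = ∫ ξ : ℝ, Complex.exp (I * k * (x - ξ)) * ((indicator (Icc 0 l) y ξ : ℝ) : ℂ) := by
      rw [hat, ← intervalIntegral.integral_const_mul, intervalIntegral.integral_of_le hl.le,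
        ← integral_Icc_eq_integral_Ioc, ← integral_indicator measurableSet_Icc]
      refine integral_congr_ae (ae_of_all _ fun ξ => ?_)
      by_cases hξ : ξ ∈ Icc 0 l
      · simp only [indicator_of_mem hξ]
        rw [← mul_assoc, ← Complex.exp_add]
        congr 2; ring
      · simp only [indicator_of_notMem hξ]; simp
    rw [h1, ← integral_fourier_gaussian x k, ← integral_const_mul,
      ← integral_add (hbdd hrint k) ((hbdd hG k).const_mul _)]
    refine integral_congr_ae (ae_of_all _ fun ξ => ?_)
    simp only [hr]
    push_cast
    ring
  have hgint := integrable_exp_neg_sq_div_four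
  simp_rw [hsplit]
  have hlim := hv.2.add ((intervalIntegral_tendsto_integral hgint
    (tendsto_fst (f := (atBot : Filter ℝ)) (g := (atTop : Filter ℝ))) tendsto_snd).const_mul
    (y x : ℂ))
  rw [integral_exp_neg_sq_div_four, zero_add, mul_comm] at hlim
  refine hlim.congr fun z => ?_
  rw [intervalIntegral.integral_add (hv.1 _ _) (hgint.intervalIntegrable.const_mul _),
    intervalIntegral.integral_const_mul (y x : ℂ)]

end Fourier

end GK

namespace GK

namespace Params

variable (p : Params)

/-! ### Uniformization of `D⁺` by the left half-plane -/

/-- The quotient `(1 - τ ω) / (α - μ² ω)`. -/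
def ratio (ω : ℂ) : ℂ := (1 - p.τ * ω) / (p.α - p.μ ^ 2 * ω)

/-- The value of `k²` for which `ω` is a root of the dispersion equation. -/
def zSq (ω : ℂ) : ℂ := ω * (1 - p.τ * ω) / (p.α - p.μ ^ 2 * ω)

/-- The point `k` of the closed upper half-plane for which `ω` is a root. -/
def K (ω : ℂ) : ℂ := I * (-p.zSq ω) ^ (1 / 2 : ℂ)

/-- The other root of the dispersion equation for `k = K ω`. -/
def dual (ω : ℂ) : ℂ := p.α / p.τ * p.ratio ω

theorem zSq_eq (ω : ℂ) : p.zSq ω = ω * p.ratio ω := by rw [zSq, ratio, mul_div_assoc]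

theorem kSq_eq (ν : ℝ) : p.kSq ν = p.zSq (I * ν) := rfl

theorem κ_eq (ν : ℝ) : p.κ ν = p.K (I * ν) := rfl

theorem K_sq (ω : ℂ) : p.K ω ^ 2 = p.zSq ω := by
  have h : ((-p.zSq ω) ^ (1 / 2 : ℂ)) ^ 2 = -p.zSq ω := by
    rw [← Complex.cpow_nat_mul]; norm_num
  rw [K, mul_pow, h, Complex.I_sq]; ring

theorem norm_K_sq (ω : ℂ) : ‖p.K ω‖ ^ 2 = ‖ω‖ * ‖p.ratio ω‖ := by
  rw [← norm_pow, K_sq, zSq_eq, norm_mul]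

variable {p}

theorem re_den (ω : ℂ) : ((p.α : ℂ) - p.μ ^ 2 * ω).re = p.α - p.μ ^ 2 * ω.re := by
  rw [← Complex.ofReal_pow, Complex.sub_re, Complex.re_ofReal_mul, Complex.ofReal_re]

theorem im_den (ω : ℂ) : ((p.α : ℂ) - p.μ ^ 2 * ω).im = -(p.μ ^ 2 * ω.im) := by
  rw [← Complex.ofReal_pow, Complex.sub_im, Complex.im_ofReal_mul, Complex.ofReal_im]; ring

theorem re_num (ω : ℂ) : ((1 : ℂ) - p.τ * ω).re = 1 - p.τ * ω.re := by
  rw [Complex.sub_re, Complex.re_ofReal_mul, Complex.one_re]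

theorem im_num (ω : ℂ) : ((1 : ℂ) - p.τ * ω).im = -(p.τ * ω.im) := by
  rw [Complex.sub_im, Complex.im_ofReal_mul, Complex.one_im]; ring

theorem den_ne (hp : p.Admissible) {ω : ℂ} (hω : ω.re ≤ 0) : (p.α - p.μ ^ 2 * ω : ℂ) ≠ 0 := by
  intro h
  have h1 := congrArg Complex.re h
  rw [re_den, Complex.zero_re] at h1
  nlinarith [hp.α_pos, sq_nonneg p.μ]

theorem num_ne (hp : p.Admissible) {ω : ℂ} (hω : ω.re ≤ 0) : (1 - p.τ * ω : ℂ) ≠ 0 := by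
  intro h
  have h1 := congrArg Complex.re h
  rw [re_num, Complex.zero_re] at h1
  nlinarith [hp.τ_pos]

theorem ratio_ne (hp : p.Admissible) {ω : ℂ} (hω : ω.re ≤ 0) : p.ratio ω ≠ 0 :=
  div_ne_zero (num_ne hp hω) (den_ne hp hω)

theorem norm_le_of_re_im {z w : ℂ} {C : ℝ} (hC : 0 ≤ C) (h1 : |z.re| ≤ C * |w.re|)
    (h2 : |z.im| ≤ C * |w.im|) : ‖z‖ ≤ C * ‖w‖ := by
  rw [Complex.norm_eq_sqrt_sq_add_sq, Complex.norm_eq_sqrt_sq_add_sq, ← Real.sqrt_sq hC,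
    ← Real.sqrt_mul (sq_nonneg C)]
  apply Real.sqrt_le_sqrt
  have e1 := mul_self_le_mul_self (abs_nonneg _) h1
  have e2 := mul_self_le_mul_self (abs_nonneg _) h2
  rw [abs_mul_abs_self] at e1 e2
  have e3 := abs_mul_abs_self w.re
  have e4 := abs_mul_abs_self w.im
  nlinarith

/-- For `Re ω ≤ 0` there is no cancellation in `1 - τ ω` or in `α - μ² ω`, so real and imaginary
parts can be compared separately. Together with `norm_den_le` this keeps `|ratio|` between positive
constants and makes `|K ω|²` comparable to `|ω|`. -/
theorem norm_num_le (hp : p.Admissible) {ω : ℂ} (hω : ω.re ≤ 0) :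
    ‖(1 - p.τ * ω : ℂ)‖ ≤ (1 / p.α + p.τ / p.μ ^ 2) * ‖(p.α - p.μ ^ 2 * ω : ℂ)‖ := by
  have hα := hp.α_pos
  have hτ := hp.τ_pos
  have hμ := hp.μ_pos
  apply norm_le_of_re_im (by positivity)
  · rw [re_num, re_den, abs_of_pos (by nlinarith), abs_of_pos (by nlinarith [sq_nonneg p.μ])]
    have e : (1 / p.α + p.τ / p.μ ^ 2) * (p.α - p.μ ^ 2 * ω.re)
      = 1 - p.τ * ω.re + (p.μ ^ 2 / p.α) * (-ω.re) + p.τ * p.α / p.μ ^ 2 := by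
      field_simp; ring
    rw [e]
    have h1 : 0 ≤ (p.μ ^ 2 / p.α) * (-ω.re) := mul_nonneg (by positivity) (by linarith)
    have h2 : 0 ≤ p.τ * p.α / p.μ ^ 2 := by positivity
    linarith
  · rw [im_num, im_den, abs_neg, abs_neg, abs_mul, abs_mul, abs_of_pos hτ,
      abs_of_pos (show 0 < p.μ ^ 2 by positivity)]
    have e : (1 / p.α + p.τ / p.μ ^ 2) * (p.μ ^ 2 * |ω.im|)
      = p.τ * |ω.im| + (p.μ ^ 2 / p.α) * |ω.im| := by
      field_simp; ring
    rw [e]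
    have : 0 ≤ (p.μ ^ 2 / p.α) * |ω.im| := by positivity
    linarith

theorem norm_den_le (hp : p.Admissible) {ω : ℂ} (hω : ω.re ≤ 0) :
    ‖(p.α - p.μ ^ 2 * ω : ℂ)‖ ≤ (p.α + p.μ ^ 2 / p.τ) * ‖(1 - p.τ * ω : ℂ)‖ := by
  have hα := hp.α_pos
  have hτ := hp.τ_pos
  have hμ := hp.μ_pos
  apply norm_le_of_re_im (by positivity)
  · rw [re_num, re_den, abs_of_pos (by nlinarith [sq_nonneg p.μ]), abs_of_pos (by nlinarith)]
    have e : (p.α + p.μ ^ 2 / p.τ) * (1 - p.τ * ω.re)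
      = p.α - p.μ ^ 2 * ω.re + (p.α * p.τ) * (-ω.re) + p.μ ^ 2 / p.τ := by
      field_simp; ring
    rw [e]
    have h1 : 0 ≤ (p.α * p.τ) * (-ω.re) := mul_nonneg (by positivity) (by linarith)
    have h2 : 0 ≤ p.μ ^ 2 / p.τ := by positivity
    linarith
  · rw [im_num, im_den, abs_neg, abs_neg, abs_mul, abs_mul, abs_of_pos hτ,
      abs_of_pos (show 0 < p.μ ^ 2 by positivity)]
    have e : (p.α + p.μ ^ 2 / p.τ) * (p.τ * |ω.im|)
      = p.μ ^ 2 * |ω.im| + (p.α * p.τ) * |ω.im| := by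
      field_simp; ring
    rw [e]
    have : 0 ≤ (p.α * p.τ) * |ω.im| := by positivity
    linarith

theorem norm_ratio_le (hp : p.Admissible) {ω : ℂ} (hω : ω.re ≤ 0) :
    ‖p.ratio ω‖ ≤ 1 / p.α + p.τ / p.μ ^ 2 := by
  rw [ratio, norm_div, div_le_iff₀ (norm_pos_iff.2 (den_ne hp hω))]
  exact norm_num_le hp hω

theorem le_norm_ratio (hp : p.Admissible) {ω : ℂ} (hω : ω.re ≤ 0) :
    1 / (p.α + p.μ ^ 2 / p.τ) ≤ ‖p.ratio ω‖ := by
  have hα := hp.α_pos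
  have hτ := hp.τ_pos
  have : 0 < p.α + p.μ ^ 2 / p.τ := by positivity
  rw [ratio, norm_div, div_le_div_iff₀ this (norm_pos_iff.2 (den_ne hp hω)), one_mul,
    mul_comm ‖(1 - p.τ * ω : ℂ)‖]
  exact norm_den_le hp hω

theorem ratio_mul_normSq (hp : p.Admissible) {ω : ℂ} (hω : ω.re ≤ 0) :
    p.ratio ω * (Complex.normSq (p.α - p.μ ^ 2 * ω) : ℝ)
      = (1 - p.τ * ω) * (starRingEnd ℂ) (p.α - p.μ ^ 2 * ω) := by
  rw [← Complex.mul_conj, ratio, ← mul_assoc, div_mul_cancel₀ _ (den_ne hp hω)]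

theorem re_ratio_mul (hp : p.Admissible) {ω : ℂ} (hω : ω.re ≤ 0) :
    (p.ratio ω).re * Complex.normSq (p.α - p.μ ^ 2 * ω)
      = p.α - (p.μ ^ 2 + p.α * p.τ) * ω.re + p.τ * p.μ ^ 2 * (ω.re ^ 2 + ω.im ^ 2) := by
  have h := congrArg Complex.re (ratio_mul_normSq hp hω)
  rw [Complex.re_mul_ofReal, Complex.mul_re, Complex.conj_re, Complex.conj_im, re_num, im_num,
    re_den, im_den] at h
  rw [h]; ring

theorem im_ratio_mul (hp : p.Admissible) {ω : ℂ} (hω : ω.re ≤ 0) :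
    (p.ratio ω).im * Complex.normSq (p.α - p.μ ^ 2 * ω) = (p.μ ^ 2 - p.α * p.τ) * ω.im := by
  have h := congrArg Complex.im (ratio_mul_normSq hp hω)
  rw [Complex.im_mul_ofReal, Complex.mul_im, Complex.conj_re, Complex.conj_im, re_num, im_num,
    re_den, im_den] at h
  rw [h]; ring

/-- After multiplication by `|α - μ² ω|²` all terms are nonnegative and `α` is positive. As `dual`
is a positive multiple of `ratio`, the second root stays in the right half-plane. -/
theorem re_ratio_pos (hp : p.Admissible) {ω : ℂ} (hω : ω.re ≤ 0) : 0 < (p.ratio ω).re := by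
  have hα := hp.α_pos
  have hτ := hp.τ_pos
  have h := re_ratio_mul hp hω
  have h1 : 0 < Complex.normSq (p.α - p.μ ^ 2 * ω) := Complex.normSq_pos.2 (den_ne hp hω)
  have h2 : 0 ≤ (p.μ ^ 2 + p.α * p.τ) * (-ω.re) := mul_nonneg (by positivity) (by linarith)
  have h3 : 0 ≤ p.τ * p.μ ^ 2 * (ω.re ^ 2 + ω.im ^ 2) := by positivity
  by_contra! h4
  nlinarith

/-- The values of `ratio` lie in a sector around the positive real axis. -/
theorem exists_im_ratio_le (hp : p.Admissible) :
    ∃ c : ℝ, 0 ≤ c ∧ ∀ ω : ℂ, ω.re ≤ 0 → |(p.ratio ω).im| ≤ c * (p.ratio ω).re := by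
  have hα := hp.α_pos
  have hτ := hp.τ_pos
  have hμ := hp.μ_pos
  -- The second factor is chosen so that its product with `α + τ μ² η²` is at least `1 + η² ≥ |η|`,
  -- where `η = Im ω`.
  refine ⟨|p.μ ^ 2 - p.α * p.τ| * (1 / p.α + 1 / (p.τ * p.μ ^ 2)), by positivity, fun ω hω => ?_⟩
  have h1 : 0 < Complex.normSq (p.α - p.μ ^ 2 * ω) := Complex.normSq_pos.2 (den_ne hp hω)
  refine le_of_mul_le_mul_right ?_ h1
  rw [mul_assoc, re_ratio_mul hp hω]
  nth_rewrite 1 [← abs_of_pos h1]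
  rw [← abs_mul, im_ratio_mul hp hω, abs_mul, mul_assoc]
  refine mul_le_mul_of_nonneg_left ?_ (abs_nonneg _)
  have h2 : 0 ≤ (p.μ ^ 2 + p.α * p.τ) * (-ω.re) := mul_nonneg (by positivity) (by linarith)
  have h3 : 0 ≤ p.τ * p.μ ^ 2 * ω.re ^ 2 := by positivity
  have h4 : (1 / p.α + 1 / (p.τ * p.μ ^ 2)) * (p.α + p.τ * p.μ ^ 2 * ω.im ^ 2)
      ≤ (1 / p.α + 1 / (p.τ * p.μ ^ 2)) * (p.α - (p.μ ^ 2 + p.α * p.τ) * ω.re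
        + p.τ * p.μ ^ 2 * (ω.re ^ 2 + ω.im ^ 2)) := by
    refine mul_le_mul_of_nonneg_left ?_ (by positivity)
    linarith
  refine le_trans ?_ h4
  have e : (1 / p.α + 1 / (p.τ * p.μ ^ 2)) * (p.α + p.τ * p.μ ^ 2 * ω.im ^ 2)
      = 1 + ω.im ^ 2 + p.τ * p.μ ^ 2 / p.α * ω.im ^ 2 + p.α / (p.τ * p.μ ^ 2) := by
    field_simp; ring
  rw [e]
  have h5 : 0 ≤ p.τ * p.μ ^ 2 / p.α * ω.im ^ 2 := by positivity
  have h6 : 0 ≤ p.α / (p.τ * p.μ ^ 2) := by positivity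
  nlinarith [sq_abs ω.im, sq_nonneg (|ω.im| - 1)]

/-- If `ω r = s ≥ 0` with `r = ratio ω`, then `ω = s r̄ / |r|²` has nonnegative real part, because
`Re r > 0`; with `Re ω ≤ 0` this leaves only `ω = 0`. Hence the square root in `K` is taken off its
cut. -/
theorem neg_zSq_mem_slitPlane (hp : p.Admissible) {ω : ℂ} (hω : ω.re ≤ 0) (h0 : ω ≠ 0) :
    -p.zSq ω ∈ Complex.slitPlane := by
  by_contra h
  rw [Complex.mem_slitPlane_iff, not_or, not_lt, not_not, zSq_eq] at h
  obtain ⟨h1, h2⟩ := h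
  simp only [Complex.neg_re, Complex.neg_im, Complex.mul_re, Complex.mul_im] at h1 h2
  have hr := re_ratio_pos hp hω
  have h3 : (-ω.re) * Complex.normSq (p.ratio ω) ≤ 0 := by
    have e : (-ω.re) * Complex.normSq (p.ratio ω)
        = -((p.ratio ω).re * (ω.re * (p.ratio ω).re - ω.im * (p.ratio ω).im))
          + (p.ratio ω).im * -(ω.re * (p.ratio ω).im + ω.im * (p.ratio ω).re) := by
      rw [Complex.normSq_apply]; ring
    rw [e, h2, mul_zero, add_zero]
    nlinarith
  have h4 : 0 < Complex.normSq (p.ratio ω) := Complex.normSq_pos.2 (ratio_ne hp hω)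
  have h5 : ω.re = 0 := by nlinarith
  have h6 : ω.im = 0 := by
    rw [h5] at h2
    have : ω.im * (p.ratio ω).re = 0 := by linarith
    rcases mul_eq_zero.1 this with h | h
    · exact h
    · exact absurd h hr.ne'
  exact h0 (Complex.ext h5 h6)

theorem cpow_half_re_nonneg (z : ℂ) : 0 ≤ (z ^ (1 / 2 : ℂ)).re := by
  rw [one_div, Complex.cpow_inv_two_re]; exact Real.sqrt_nonneg _

theorem im_K (ω : ℂ) : (p.K ω).im = ((-p.zSq ω) ^ (1 / 2 : ℂ)).re := by simp [K]

theorem im_K_nonneg (ω : ℂ) : 0 ≤ (p.K ω).im := by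
  rw [im_K]; exact cpow_half_re_nonneg _

theorem two_mul_im_K_sq (ω : ℂ) : 2 * (p.K ω).im ^ 2 = ‖p.K ω‖ ^ 2 - (p.zSq ω).re := by
  have h := congrArg Complex.re (p.K_sq ω)
  rw [sq, Complex.mul_re] at h
  rw [← Complex.normSq_eq_norm_sq, Complex.normSq_apply]
  linarith

theorem two_mul_re_K_sq (ω : ℂ) : 2 * (p.K ω).re ^ 2 = ‖p.K ω‖ ^ 2 + (p.zSq ω).re := by
  have h := congrArg Complex.re (p.K_sq ω)
  rw [sq, Complex.mul_re] at h
  rw [← Complex.normSq_eq_norm_sq, Complex.normSq_apply]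
  linarith

/-- `K` maps the left half-plane into a sector around the positive imaginary axis. -/
theorem exists_le_im_K (hp : p.Admissible) :
    ∃ c : ℝ, 0 < c ∧ ∀ ω : ℂ, ω.re ≤ 0 → c * ‖p.K ω‖ ≤ (p.K ω).im := by
  obtain ⟨c₁, hc₁, h⟩ := exists_im_ratio_le hp
  -- `|Im r| ≤ c₂ |r|` with `c₂ < 1`
  set c₂ : ℝ := Real.sqrt (c₁ ^ 2 / (1 + c₁ ^ 2)) with hc₂
  have hc₂' : c₂ < 1 := by
    rw [hc₂, Real.sqrt_lt' one_pos, div_lt_iff₀ (by positivity)]; linarith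
  have him (ω : ℂ) (hω : ω.re ≤ 0) : |(p.ratio ω).im| ≤ c₂ * ‖p.ratio ω‖ := by
    have h1 := h ω hω
    have h2 : |(p.ratio ω).im| ^ 2 ≤ c₁ ^ 2 * (p.ratio ω).re ^ 2 := by
      rw [← mul_pow]; exact pow_le_pow_left₀ (abs_nonneg _) h1 2
    refine abs_le_of_sq_le_sq' ?_ (by positivity) |>.2
    rw [mul_pow, hc₂, Real.sq_sqrt (by positivity), ← Complex.normSq_eq_norm_sq,
      Complex.normSq_apply, div_mul_eq_mul_div, le_div_iff₀ (by positivity)]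
    rw [sq_abs] at h2 ⊢
    nlinarith
  refine ⟨Real.sqrt ((1 - c₂) / 2), Real.sqrt_pos.2 (by linarith), fun ω hω => ?_⟩
  refine abs_le_of_sq_le_sq' ?_ (im_K_nonneg ω) |>.2
  rw [mul_pow, Real.sq_sqrt (by linarith)]
  have h1 := two_mul_im_K_sq (p := p) ω
  -- In `Re (ω r) = Re ω Re r - Im ω Im r` the first product is nonpositive and the second is
  -- controlled by `him`. With `c₂ < 1` this bounds `Im K` from below.
  have h2 : (p.zSq ω).re ≤ c₂ * ‖p.K ω‖ ^ 2 := by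
    rw [norm_K_sq, zSq_eq, Complex.mul_re]
    have h3 := him ω hω
    have h4 := re_ratio_pos hp hω
    have h5 := Complex.abs_im_le_norm ω
    have h6 : -(ω.im * (p.ratio ω).im) ≤ ‖ω‖ * (c₂ * ‖p.ratio ω‖) := by
      refine (neg_le_abs _).trans ?_
      rw [abs_mul]
      gcongr
    nlinarith
  nlinarith

theorem K_ne_zero (hp : p.Admissible) {ω : ℂ} (hω : ω.re ≤ 0) (h0 : ω ≠ 0) : p.K ω ≠ 0 := by
  rw [← norm_ne_zero_iff, ← sq_eq_zero_iff.ne, norm_K_sq]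
  exact mul_ne_zero (norm_ne_zero_iff.2 h0) (norm_ne_zero_iff.2 (ratio_ne hp hω))

theorem im_K_pos (hp : p.Admissible) {ω : ℂ} (hω : ω.re ≤ 0) (h0 : ω ≠ 0) : 0 < (p.K ω).im := by
  obtain ⟨c, hc, h⟩ := exists_le_im_K hp
  exact (mul_pos hc (norm_pos_iff.2 (K_ne_zero hp hω h0))).trans_le (h ω hω)

theorem norm_K_sq_le (hp : p.Admissible) {ω : ℂ} (hω : ω.re ≤ 0) :
    ‖p.K ω‖ ^ 2 ≤ (1 / p.α + p.τ / p.μ ^ 2) * ‖ω‖ := by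
  rw [norm_K_sq, mul_comm]
  exact mul_le_mul_of_nonneg_right (norm_ratio_le hp hω) (norm_nonneg _)

theorem le_norm_K_sq (hp : p.Admissible) {ω : ℂ} (hω : ω.re ≤ 0) :
    1 / (p.α + p.μ ^ 2 / p.τ) * ‖ω‖ ≤ ‖p.K ω‖ ^ 2 := by
  rw [norm_K_sq, mul_comm]
  exact mul_le_mul_of_nonneg_left (le_norm_ratio hp hω) (norm_nonneg _)

/-- `|K|` increases along the rays in the left half-plane. -/
theorem norm_K_lt_norm_K_mul (hp : p.Admissible) {ω : ℂ} (hω : ω.re ≤ 0) (h0 : ω ≠ 0) {c : ℝ}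
    (hc : 1 < c) : ‖p.K ω‖ < ‖p.K (c * ω)‖ := by
  have hα := hp.α_pos
  have hτ := hp.τ_pos
  have hcω : ((c : ℂ) * ω).re ≤ 0 := by
    rw [Complex.re_ofReal_mul]; nlinarith
  refine lt_of_pow_lt_pow_left₀ 2 (norm_nonneg _) ?_
  rw [norm_K_sq, norm_K_sq, ratio, ratio, norm_div, norm_div, norm_mul, Complex.norm_real,
    Real.norm_eq_abs, abs_of_pos (by linarith : 0 < c), mul_comm c, mul_assoc]
  refine mul_lt_mul_of_pos_left ?_ (norm_pos_iff.2 h0)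
  have hd1 := norm_pos_iff.2 (den_ne hp hω)
  have hd2 := norm_pos_iff.2 (den_ne hp hcω)
  -- In `|K|² = |ω| |1 - τ ω| / |α - μ² ω|`, scaling `ω` by `c` multiplies the first factor by `c`,
  -- does not decrease the second, and multiplies the denominator by less than `c`, since `α` is not
  -- scaled.
  have h1 : ‖(1 - p.τ * ω : ℂ)‖ ≤ ‖(1 - p.τ * (c * ω) : ℂ)‖ := by
    have := norm_le_of_re_im (z := (1 - p.τ * ω : ℂ)) (w := (1 - p.τ * (c * ω) : ℂ)) (C := 1)
      zero_le_one ?_ ?_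
    · simpa using this
    · rw [re_num, re_num, Complex.re_ofReal_mul, abs_of_pos (by nlinarith), one_mul,
        abs_of_pos (by nlinarith [mul_nonneg hτ.le (show (0 : ℝ) ≤ -(c * ω.re) by nlinarith)])]
      nlinarith [mul_nonneg hτ.le (show (0 : ℝ) ≤ (c - 1) * (-ω.re) by nlinarith)]
    · rw [im_num, im_num, Complex.im_ofReal_mul, abs_neg, abs_neg, abs_mul, abs_mul, abs_mul,
        one_mul, abs_of_pos (by linarith : 0 < c)]
      nlinarith [mul_nonneg (abs_nonneg p.τ) (abs_nonneg ω.im)]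
  have h2 : ‖(p.α - p.μ ^ 2 * (c * ω) : ℂ)‖ < c * ‖(p.α - p.μ ^ 2 * ω : ℂ)‖ := by
    refine lt_of_pow_lt_pow_left₀ 2 (by positivity) ?_
    rw [mul_pow, ← Complex.normSq_eq_norm_sq, ← Complex.normSq_eq_norm_sq, Complex.normSq_apply,
      Complex.normSq_apply, re_den, re_den, im_den, im_den, Complex.re_ofReal_mul,
      Complex.im_ofReal_mul]
    have h3 : 0 ≤ p.μ ^ 2 * (-ω.re) := mul_nonneg (sq_nonneg _) (by linarith)
    have h4 : p.α - p.μ ^ 2 * (c * ω.re) < c * (p.α - p.μ ^ 2 * ω.re) := by nlinarith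
    have h5 : 0 ≤ p.α - p.μ ^ 2 * (c * ω.re) := by nlinarith
    nlinarith
  rw [← mul_div_assoc, div_lt_div_iff₀ hd1 hd2]
  have hn := norm_pos_iff.2 (num_ne hp hω)
  calc _ < ‖(1 - p.τ * ω : ℂ)‖ * (c * ‖(p.α - p.μ ^ 2 * ω : ℂ)‖) := by gcongr
    _ ≤ ‖(1 - p.τ * (c * ω) : ℂ)‖ * (c * ‖(p.α - p.μ ^ 2 * ω : ℂ)‖) := by gcongr
    _ = _ := by ring

end Params

end GK

namespace GK

namespace Params

variable {p : Params}

/-! ### The roots of the dispersion equation -/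

theorem root_sq (k : ℂ) :
    p.root k ^ 2 = (1 + p.μ ^ 2 * k ^ 2) ^ 2 - 4 * p.α * p.τ * k ^ 2 := by
  rw [root, ← Complex.cpow_nat_mul]; norm_num

theorem ω_add (hp : p.Admissible) (k : ℂ) : p.ω₁ k + p.ω₂ k = 1 / p.τ + p.θ * k ^ 2 := by
  have hτ : (p.τ : ℂ) ≠ 0 := by exact_mod_cast hp.τ_pos.ne'
  rw [ω₁, ω₂, θ]; push_cast; field_simp; ring

theorem ω_mul (hp : p.Admissible) (k : ℂ) : p.ω₁ k * p.ω₂ k = p.β * k ^ 2 := by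
  have hτ : (p.τ : ℂ) ≠ 0 := by exact_mod_cast hp.τ_pos.ne'
  have h := root_sq (p := p) k
  rw [ω₁, ω₂, β]; push_cast; field_simp
  linear_combination -h

theorem ω₁_neg (k : ℂ) : p.ω₁ (-k) = p.ω₁ k := by simp [ω₁, root]

theorem ω₂_neg (k : ℂ) : p.ω₂ (-k) = p.ω₂ k := by simp [ω₂, root]

theorem root_re_nonneg (k : ℂ) : 0 ≤ (p.root k).re := cpow_half_re_nonneg _

theorem re_ω₂_le (hp : p.Admissible) (k : ℂ) : (p.ω₂ k).re ≤ (p.ω₁ k).re := by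
  have h : p.ω₁ k = p.ω₂ k + ((1 / p.τ : ℝ) : ℂ) * p.root k := by
    have hτ : (p.τ : ℂ) ≠ 0 := by exact_mod_cast hp.τ_pos.ne'
    rw [ω₁, ω₂]; push_cast; field_simp; ring
  rw [h, Complex.add_re, Complex.re_ofReal_mul]
  have := mul_nonneg (one_div_pos.2 hp.τ_pos).le (root_re_nonneg (p := p) k)
  linarith

/-- The principal square root has nonnegative real part, so `ω₂` is always the root further to the
left. -/
theorem mem_D_iff (hp : p.Admissible) {k : ℂ} : k ∈ p.D ↔ (p.ω₂ k).re < 0 :=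
  ⟨fun h => h.elim (fun h => (re_ω₂_le hp k).trans_lt h) id, Or.inr⟩

/-- `ω₂` itself may jump where the radicand crosses the cut, but the real part of the principal root
of `z` is `√((|z| + Re z)/2)`, which is continuous everywhere. -/
theorem continuous_re_ω₂ : Continuous fun k => (p.ω₂ k).re := by
  have h : (fun k => (p.ω₂ k).re) = fun k : ℂ => ((1 + p.μ ^ 2 * k ^ 2 : ℂ).re
      - Real.sqrt ((‖((1 + p.μ ^ 2 * k ^ 2) ^ 2 - 4 * p.α * p.τ * k ^ 2 : ℂ)‖
        + ((1 + p.μ ^ 2 * k ^ 2) ^ 2 - 4 * p.α * p.τ * k ^ 2 : ℂ).re) / 2)) / (2 * p.τ) := by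
    funext k
    have e : (2 * p.τ : ℂ) = ((2 * p.τ : ℝ) : ℂ) := by push_cast; rfl
    rw [ω₂, e, Complex.div_ofReal_re, Complex.sub_re, root, one_div, Complex.cpow_inv_two_re]
  rw [h]
  fun_prop

theorem root_pair (hp : p.Admissible) {k a b : ℂ} (h1 : a + b = 1 / p.τ + p.θ * k ^ 2)
    (h2 : a * b = p.β * k ^ 2) : (a = p.ω₁ k ∧ b = p.ω₂ k) ∨ (a = p.ω₂ k ∧ b = p.ω₁ k) := by
  have e1 := ω_add hp k
  have e2 := ω_mul hp k
  have h3 : (a - p.ω₁ k) * (a - p.ω₂ k) = 0 := by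
    have : b = p.ω₁ k + p.ω₂ k - a := by rw [e1, ← h1]; ring
    rw [this] at h2
    linear_combination e2 - h2
  rcases mul_eq_zero.1 h3 with h | h
  · left
    refine ⟨sub_eq_zero.1 h, ?_⟩
    linear_combination h1 - e1 - h
  · right
    refine ⟨sub_eq_zero.1 h, ?_⟩
    linear_combination h1 - e1 - h

theorem add_dual (hp : p.Admissible) {ω : ℂ} (hd : (p.α - p.μ ^ 2 * ω : ℂ) ≠ 0) :
    ω + p.dual ω = 1 / p.τ + p.θ * p.zSq ω := by
  have hτ : (p.τ : ℂ) ≠ 0 := by exact_mod_cast hp.τ_pos.ne'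
  have hd' : (p.α - ω * p.μ ^ 2 : ℂ) ≠ 0 := by rwa [mul_comm ω]
  rw [dual, ratio, zSq, θ]; push_cast; field_simp; ring

theorem mul_dual (ω : ℂ) :
    ω * p.dual ω = p.β * p.zSq ω := by
  rw [dual, zSq_eq, β]; push_cast; ring

theorem re_dual_pos (hp : p.Admissible) {ω : ℂ} (hω : ω.re ≤ 0) : 0 < (p.dual ω).re := by
  have e : (p.α / p.τ : ℂ) = ((p.α / p.τ : ℝ) : ℂ) := by push_cast; rfl
  rw [dual, e, Complex.re_ofReal_mul]
  exact mul_pos (div_pos hp.α_pos hp.τ_pos) (re_ratio_pos hp hω)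

/-- By Vieta, `ω` and `dual ω` are the two roots at `k`; the signs of their real parts decide which
is which. -/
theorem ω_of_sq_eq (hp : p.Admissible) {k ω : ℂ} (hω : ω.re ≤ 0) (hk : k ^ 2 = p.zSq ω) :
    p.ω₂ k = ω ∧ p.ω₁ k = p.dual ω := by
  have h1 := add_dual hp (den_ne hp hω)
  have h2 := mul_dual (p := p) ω
  rw [← hk] at h1 h2
  rcases root_pair hp h1 h2 with h | h
  · exfalso
    have h3 := re_ω₂_le hp k
    rw [← h.1, ← h.2] at h3
    have := re_dual_pos hp hω
    linarith
  · exact ⟨h.1.symm, h.2.symm⟩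

theorem ω₂_K (hp : p.Admissible) {ω : ℂ} (hω : ω.re ≤ 0) : p.ω₂ (p.K ω) = ω :=
  (ω_of_sq_eq hp hω (p.K_sq ω)).1

theorem ω₁_K (hp : p.Admissible) {ω : ℂ} (hω : ω.re ≤ 0) : p.ω₁ (p.K ω) = p.dual ω :=
  (ω_of_sq_eq hp hω (p.K_sq ω)).2

theorem sq_eq_zSq_ω₂ (hp : p.Admissible) {k : ℂ} (hk : (p.ω₂ k).re ≤ 0) :
    k ^ 2 = p.zSq (p.ω₂ k) := by
  have hτ : (p.τ : ℂ) ≠ 0 := by exact_mod_cast hp.τ_pos.ne'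
  have e1 := ω_add hp k
  have e2 := ω_mul hp k
  rw [zSq, eq_div_iff (den_ne hp hk)]
  have e3 : p.ω₁ k = 1 / p.τ + p.θ * k ^ 2 - p.ω₂ k := by rw [← e1]; ring
  rw [e3, θ, β] at e2
  push_cast at e2
  field_simp at e2
  linear_combination -e2

theorem ω₂_ne_zero (hp : p.Admissible) {k : ℂ} (hk0 : k ≠ 0) : p.ω₂ k ≠ 0 := by
  intro h
  have e2 := ω_mul hp k
  rw [h, mul_zero, eq_comm, mul_eq_zero] at e2
  have hβ : (p.β : ℂ) ≠ 0 := by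
    rw [β]; exact_mod_cast (div_pos hp.α_pos hp.τ_pos).ne'
  exact e2.elim hβ fun h => hk0 (by simpa using h)

/-- Otherwise `k² = zSq (ω₂ k)` would be a positive number, against `neg_zSq_mem_slitPlane`. So the
real axis separates `D⁺` from `D⁻`, and it meets their closures at most in 0. -/
theorem re_ω₂_ofReal_pos (hp : p.Admissible) {k : ℝ} (hk : k ≠ 0) : 0 < (p.ω₂ k).re := by
  by_contra! h
  have h1 := neg_zSq_mem_slitPlane hp h (ω₂_ne_zero hp (by exact_mod_cast hk))
  rw [← sq_eq_zSq_ω₂ hp h, Complex.mem_slitPlane_iff] at h1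
  rw [← Complex.ofReal_pow, ← Complex.ofReal_neg, Complex.ofReal_re, Complex.ofReal_im] at h1
  rcases h1 with h1 | h1
  · nlinarith [sq_nonneg k]
  · exact h1 rfl

theorem K_ω₂ (hp : p.Admissible) {k : ℂ} (hk : (p.ω₂ k).re ≤ 0) (him : 0 < k.im) :
    p.K (p.ω₂ k) = k := by
  have h := p.K_sq (p.ω₂ k)
  rw [← sq_eq_zSq_ω₂ hp hk] at h
  rcases sq_eq_sq_iff_eq_or_eq_neg.1 h with h | h
  · exact h
  · have h1 := im_K_nonneg (p := p) (p.ω₂ k)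
    rw [h, Complex.neg_im] at h1
    linarith

theorem im_ne_zero_of_re_ω₂ (hp : p.Admissible) {k : ℂ} (hk0 : k ≠ 0) (hk : (p.ω₂ k).re ≤ 0) :
    k.im ≠ 0 := by
  intro h
  have e : k = (k.re : ℂ) := Complex.ext rfl (by simpa using h)
  rw [e] at hk hk0
  exact absurd (re_ω₂_ofReal_pos hp (by exact_mod_cast hk0)) (not_lt.2 hk)

theorem mem_closure_D₀ (hp : p.Admissible) {R : ℝ} {k : ℂ} (hk : k ∈ closure (p.D₀ R)) :
    (p.ω₂ k).re ≤ 0 ∧ R ≤ ‖k‖ := by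
  have hc : IsClosed {k : ℂ | (p.ω₂ k).re ≤ 0 ∧ R ≤ ‖k‖} :=
    (isClosed_le continuous_re_ω₂ continuous_const).inter
      (isClosed_le continuous_const continuous_norm)
  refine closure_minimal (fun k hk => ?_) hc hk
  exact ⟨((mem_D_iff hp).1 hk.1).le, hk.2.le⟩

/-! ### Smoothness of `K` -/

/-- The set on which `K` is visibly holomorphic. -/
def regular (p : Params) : Set ℂ :=
  {ω | (p.α - p.μ ^ 2 * ω : ℂ) ≠ 0 ∧ -p.zSq ω ∈ Complex.slitPlane}

theorem mem_regular (hp : p.Admissible) {ω : ℂ} (hω : ω.re ≤ 0) (h0 : ω ≠ 0) : ω ∈ p.regular :=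
  ⟨den_ne hp hω, neg_zSq_mem_slitPlane hp hω h0⟩

theorem differentiableAt_zSq {ω : ℂ} (hω : (p.α - p.μ ^ 2 * ω : ℂ) ≠ 0) :
    DifferentiableAt ℂ p.zSq ω := by
  have : DifferentiableAt ℂ (fun ω : ℂ => ω * (1 - p.τ * ω) / (p.α - p.μ ^ 2 * ω)) ω := by
    fun_prop (disch := exact hω)
  exact this

theorem isOpen_regular : IsOpen p.regular := by
  have h1 : IsOpen {ω : ℂ | (p.α - p.μ ^ 2 * ω : ℂ) ≠ 0} :=
    isOpen_ne_fun (by fun_prop) continuous_const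
  have h2 : ContinuousOn (fun ω => -p.zSq ω) {ω : ℂ | (p.α - p.μ ^ 2 * ω : ℂ) ≠ 0} :=
    fun ω hω => (differentiableAt_zSq hω).continuousAt.continuousWithinAt.neg
  exact h2.isOpen_inter_preimage h1 Complex.isOpen_slitPlane

theorem differentiableAt_K {ω : ℂ} (hω : ω ∈ p.regular) : DifferentiableAt ℂ p.K ω := by
  have h := (differentiableAt_zSq hω.1).neg
  exact (h.cpow_const hω.2).const_mul I

theorem K_ne_zero_of_regular {ω : ℂ} (hω : ω ∈ p.regular) : p.K ω ≠ 0 := by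
  intro h
  have h1 := p.K_sq ω
  rw [h] at h1
  have h2 := hω.2
  rw [← h1] at h2
  simp at h2

theorem differentiableOn_K : DifferentiableOn ℂ p.K p.regular := fun _ hω =>
  (differentiableAt_K hω).differentiableWithinAt

theorem differentiableOn_deriv_K : DifferentiableOn ℂ (deriv p.K) p.regular :=
  differentiableOn_K.deriv isOpen_regular

theorem deriv_K_mul {ω : ℂ} (hω : ω ∈ p.regular) :
    2 * p.K ω * deriv p.K ω = deriv p.zSq ω := by
  have h1 := (differentiableAt_K hω).hasDerivAt.pow 2
  have h2 : p.K ^ 2 = p.zSq := funext fun ω => p.K_sq ω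
  rw [h2] at h1
  rw [h1.deriv]
  ring

theorem deriv_zSq {ω : ℂ} (hω : (p.α - p.μ ^ 2 * ω : ℂ) ≠ 0) :
    deriv p.zSq ω = ((1 - 2 * p.τ * ω) * (p.α - p.μ ^ 2 * ω) + p.μ ^ 2 * ω * (1 - p.τ * ω))
      / (p.α - p.μ ^ 2 * ω) ^ 2 := by
  have h1 : HasDerivAt (fun ω : ℂ => ω * (1 - p.τ * ω)) (1 * (1 - p.τ * ω) + ω * -(p.τ * 1)) ω :=
    (hasDerivAt_id ω).mul (((hasDerivAt_id ω).const_mul _).const_sub _)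
  have h2 : HasDerivAt (fun ω : ℂ => (p.α - p.μ ^ 2 * ω : ℂ)) (-(p.μ ^ 2 * 1)) ω :=
    ((hasDerivAt_id ω).const_mul _).const_sub _
  have h3 := (h1.div h2 hω).deriv
  have e : p.zSq = ((fun ω : ℂ => ω * (1 - p.τ * ω)) / fun ω : ℂ => (p.α - p.μ ^ 2 * ω : ℂ)) := rfl
  rw [e, h3]
  ring

theorem re_mul_le_norm_den (hp : p.Admissible) {ω : ℂ} (hω : ω.re ≤ 0) :
    p.μ ^ 2 * ‖ω‖ ≤ ‖(p.α - p.μ ^ 2 * ω : ℂ)‖ := by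
  have h := norm_le_of_re_im (z := p.μ ^ 2 * ω) (w := (p.α - p.μ ^ 2 * ω : ℂ)) zero_le_one ?_ ?_
  · rw [norm_mul, one_mul] at h
    simpa using h
  · rw [re_den, one_mul, ← Complex.ofReal_pow, Complex.re_ofReal_mul]
    have h1 : p.μ ^ 2 * ω.re ≤ 0 := by nlinarith [sq_nonneg p.μ]
    rw [abs_of_nonpos h1, abs_of_pos (by linarith [hp.α_pos])]
    linarith [hp.α_pos]
  · rw [im_den, one_mul, abs_neg, ← Complex.ofReal_pow, Complex.im_ofReal_mul]

/-- In `2 K K' = zSq'` the right side is bounded, because `ratio` and `ω / (α - μ² ω)` are, and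
`|K|` is bounded below for `|ω| ≥ 1`. Thus decay in `ω` alone decides integrability along the curve.
-/
theorem exists_norm_deriv_K_le (hp : p.Admissible) :
    ∃ C : ℝ, 0 ≤ C ∧ ∀ ω : ℂ, ω.re ≤ 0 → 1 ≤ ‖ω‖ → ‖deriv p.K ω‖ ≤ C := by
  have hα := hp.α_pos
  have hτ := hp.τ_pos
  have hμ := hp.μ_pos
  set m : ℝ := 1 / (p.α + p.μ ^ 2 / p.τ) with hm
  set M : ℝ := 1 / p.α + p.τ / p.μ ^ 2 with hM
  have hm0 : 0 < m := by positivity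
  refine ⟨(M + p.τ / p.μ ^ 2 + M) / (2 * Real.sqrt m), by positivity, fun ω hω h1 => ?_⟩
  have h0 : ω ≠ 0 := by rintro rfl; simp at h1; linarith
  have hd := den_ne hp hω
  have hreg := mem_regular hp hω h0
  have h2 : Real.sqrt m ≤ ‖p.K ω‖ := by
    refine Real.sqrt_le_iff.2 ⟨norm_nonneg _, ?_⟩
    have := le_norm_K_sq hp hω
    nlinarith
  have h3 : ‖p.K ω‖ * (2 * ‖deriv p.K ω‖) = ‖deriv p.zSq ω‖ := by
    rw [← deriv_K_mul hreg, norm_mul, norm_mul]; simp; ring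
  have h5 : ‖(ω / (p.α - p.μ ^ 2 * ω) : ℂ)‖ ≤ 1 / p.μ ^ 2 := by
    rw [norm_div, div_le_div_iff₀ (norm_pos_iff.2 hd) (by positivity), one_mul, mul_comm]
    exact re_mul_le_norm_den hp hω
  have h4 : ‖deriv p.zSq ω‖ ≤ M + p.τ / p.μ ^ 2 + M := by
    have e : deriv p.zSq ω = p.ratio ω - p.τ * (ω / (p.α - p.μ ^ 2 * ω))
        + p.μ ^ 2 * (ω / (p.α - p.μ ^ 2 * ω)) * p.ratio ω := by
      rw [deriv_zSq hd, ratio]; field_simp; ring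
    rw [e]
    refine (norm_add_le _ _).trans (add_le_add ((norm_sub_le _ _).trans (add_le_add
      (norm_ratio_le hp hω) ?_)) ?_)
    · rw [norm_mul, Complex.norm_real, Real.norm_eq_abs, abs_of_pos hτ]
      calc p.τ * _ ≤ p.τ * (1 / p.μ ^ 2) := by gcongr
        _ = _ := by ring
    · rw [norm_mul, norm_mul, norm_pow, Complex.norm_real, Real.norm_eq_abs, abs_of_pos hμ]
      calc p.μ ^ 2 * _ * _ ≤ p.μ ^ 2 * (1 / p.μ ^ 2) * M := by
            gcongr; exact norm_ratio_le hp hω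
        _ = M := by field_simp
  rw [le_div_iff₀ (by positivity)]
  nlinarith [norm_nonneg (deriv p.K ω)]

/-- If `|K ω| > R`, the points `ω - ε` lie in the open half-plane and are mapped into `D₀`. If `|K
ω| = R`, one first moves outwards along the ray, where `|K|` grows. In this way `PoleFree` becomes a
statement about `region`. -/
theorem K_mem_closure_D₀ (hp : p.Admissible) {R : ℝ} {ω : ℂ} (hω : ω.re ≤ 0) (h0 : ω ≠ 0)
    (hR : R ≤ ‖p.K ω‖) : p.K ω ∈ closure (p.D₀ R) := by
  have hcont (ω : ℂ) (hω : ω.re ≤ 0) (h0 : ω ≠ 0) : ContinuousAt p.K ω :=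
    (differentiableAt_K (mem_regular hp hω h0)).continuousAt
  have step1 (ω : ℂ) (hω : ω.re ≤ 0) (h0 : ω ≠ 0) (hR : R < ‖p.K ω‖) :
      p.K ω ∈ closure (p.D₀ R) := by
    have hlim : Tendsto (fun ε : ℝ => ω - ε) (𝓝[>] 0) (𝓝 ω) := by
      have : Tendsto (fun ε : ℝ => ω - ε) (𝓝 0) (𝓝 (ω - (0 : ℝ))) := by
        exact Continuous.tendsto (by fun_prop) 0
      rw [Complex.ofReal_zero, sub_zero] at this
      exact this.mono_left nhdsWithin_le_nhds
    have h2 := (hcont ω hω h0).tendsto.comp hlim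
    refine mem_closure_of_tendsto h2 ?_
    have h3 := h2.norm.eventually (lt_mem_nhds hR)
    filter_upwards [h3, self_mem_nhdsWithin] with ε hε hpos
    have hre : (ω - (ε : ℂ)).re < 0 := by
      rw [Complex.sub_re, Complex.ofReal_re]; linarith [mem_Ioi.1 hpos]
    refine ⟨(mem_D_iff hp).2 ?_, hε⟩
    simp only [Function.comp]
    rwa [ω₂_K hp hre.le]
  have hlim : Tendsto (fun c : ℝ => (c : ℂ) * ω) (𝓝[>] 1) (𝓝 ω) := by
    have : Tendsto (fun c : ℝ => (c : ℂ) * ω) (𝓝 1) (𝓝 ((1 : ℝ) * ω)) := by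
      exact Continuous.tendsto (by fun_prop) 1
    rw [Complex.ofReal_one, one_mul] at this
    exact this.mono_left nhdsWithin_le_nhds
  have h2 := (hcont ω hω h0).tendsto.comp hlim
  rw [← closure_closure]
  refine mem_closure_of_tendsto h2 ?_
  filter_upwards [self_mem_nhdsWithin] with c hc
  have hc : 1 < c := hc
  refine step1 _ ?_ (mul_ne_zero (by exact_mod_cast (by linarith : c ≠ 0)) h0) ?_
  · rw [Complex.re_ofReal_mul]; nlinarith
  · exact hR.trans_lt (norm_K_lt_norm_K_mul hp hω h0 hc)

end Params

end GK

namespace GK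

namespace Params

variable {p : Params}

/-! ### The curve `κ` and the arc -/

theorem re_I_mul (ν : ℝ) : (I * ν : ℂ).re = 0 := by simp

theorem I_mul_ne {ν : ℝ} (h : ν ≠ 0) : (I * ν : ℂ) ≠ 0 :=
  mul_ne_zero Complex.I_ne_zero (by exact_mod_cast h)

theorem norm_I_mul (ν : ℝ) : ‖(I * ν : ℂ)‖ = |ν| := by simp

theorem I_mul_mem_regular (hp : p.Admissible) {ν : ℝ} (h : ν ≠ 0) : (I * ν : ℂ) ∈ p.regular :=
  mem_regular hp (re_I_mul ν).le (I_mul_ne h)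

theorem hasDerivAt_κ (hp : p.Admissible) {ν : ℝ} (h : ν ≠ 0) :
    HasDerivAt p.κ (deriv p.K (I * ν) * I) ν := by
  have h1 := (differentiableAt_K (I_mul_mem_regular hp h)).hasDerivAt
  have h2 : HasDerivAt (fun ν : ℝ => (I * ν : ℂ)) (I * 1) ν :=
    (Complex.ofRealCLM.hasDerivAt (x := ν)).const_mul I
  have h3 := h1.comp ν h2
  rw [mul_one] at h3
  exact h3

theorem deriv_κ (hp : p.Admissible) {ν : ℝ} (h : ν ≠ 0) :
    deriv p.κ ν = deriv p.K (I * ν) * I := (hasDerivAt_κ hp h).deriv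

theorem continuousAt_κ (hp : p.Admissible) {ν : ℝ} (h : ν ≠ 0) : ContinuousAt p.κ ν :=
  (hasDerivAt_κ hp h).continuousAt

theorem continuousAt_deriv_κ (hp : p.Admissible) {ν : ℝ} (h : ν ≠ 0) :
    ContinuousAt (deriv p.κ) ν := by
  have h1 : ContinuousAt (fun ν : ℝ => deriv p.K (I * ν) * I) ν := by
    refine ContinuousAt.mul ?_ continuousAt_const
    have := (differentiableOn_deriv_K.differentiableAt
      (isOpen_regular.mem_nhds (I_mul_mem_regular hp h))).continuousAt
    exact ContinuousAt.comp (f := fun ν : ℝ => (I * ν : ℂ)) this (by fun_prop)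
  refine h1.congr ?_
  filter_upwards [isOpen_ne.mem_nhds h] with ν' h'
  exact (deriv_κ hp h').symm

theorem norm_κ_eq (ν : ℝ) : ‖p.κ ν‖ = Real.sqrt ‖p.kSq ν‖ := by
  rw [← p.κ_sq, norm_pow, Real.sqrt_sq (norm_nonneg _)]

theorem continuous_norm_κ (hp : p.Admissible) : Continuous fun ν => ‖p.κ ν‖ := by
  simp_rw [norm_κ_eq]
  refine Real.continuous_sqrt.comp (Continuous.norm ?_)
  refine continuous_iff_continuousAt.2 fun ν => ?_
  have := (differentiableAt_zSq (p := p) (den_ne hp (re_I_mul ν).le)).continuousAt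
  exact ContinuousAt.comp (f := fun ν : ℝ => (I * ν : ℂ)) this (by fun_prop)

theorem κ_zero : p.κ 0 = 0 := by
  have : p.kSq 0 = 0 := by simp [kSq]
  rw [κ, this, neg_zero, Complex.zero_cpow (by norm_num), mul_zero]

theorem zSq_conj (ω : ℂ) : p.zSq ((starRingEnd ℂ) ω) = (starRingEnd ℂ) (p.zSq ω) := by
  simp [zSq]

theorem κ_neg (hp : p.Admissible) {ν : ℝ} (h : ν ≠ 0) :
    p.κ (-ν) = -(starRingEnd ℂ) (p.κ ν) := by
  have e : (I * ((-ν : ℝ) : ℂ)) = (starRingEnd ℂ) (I * ν) := by simp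
  have hs := (I_mul_mem_regular hp h).2
  have e1 : (1 / 2 : ℂ) = (starRingEnd ℂ) (1 / 2 : ℂ) := by
    rw [map_div₀, map_one, map_ofNat]
  rw [κ_eq, κ_eq, e, K, K, zSq_conj, ← map_neg, e1, Complex.cpow_conj _ _
    (Complex.slitPlane_arg_ne_pi hs), ← e1]
  simp

theorem re_κ_pos (hp : p.Admissible) {ν : ℝ} (h : 0 < ν) : 0 < (p.κ ν).re := by
  have him := im_K_pos hp (re_I_mul ν).le (I_mul_ne h.ne')
  rw [← κ_eq] at him
  have h1 := congrArg Complex.im (p.κ_sq ν)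
  have hα := hp.α_pos
  have hτ := hp.τ_pos
  have hd := den_ne hp (re_I_mul ν).le
  have h2 : 0 < (p.kSq ν).im := by
    have e : (p.kSq ν) * (Complex.normSq (p.α - p.μ ^ 2 * (I * ν)) : ℝ)
        = I * ν * (1 - p.τ * (I * ν)) * (starRingEnd ℂ) (p.α - p.μ ^ 2 * (I * ν)) := by
      rw [← Complex.mul_conj, kSq, ← mul_assoc, div_mul_cancel₀ _ hd]
    have e2 := congrArg Complex.im e
    have e3 : I * ν * (1 - p.τ * (I * ν)) * (starRingEnd ℂ) (p.α - p.μ ^ 2 * (I * ν))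
        = (((p.α * p.τ - p.μ ^ 2) * ν ^ 2 : ℝ) : ℂ)
          + ((ν * (p.α + p.τ * p.μ ^ 2 * ν ^ 2) : ℝ) : ℂ) * I := by
      simp only [map_sub, map_mul, map_pow, Complex.conj_ofReal, Complex.conj_I]
      push_cast
      linear_combination (-p.τ * ν ^ 2 * p.α + p.μ ^ 2 * ν ^ 2 - p.τ * p.μ ^ 2 * ν ^ 3 * I)
        * Complex.I_sq
    rw [Complex.im_mul_ofReal, e3, Complex.add_im, Complex.ofReal_im, Complex.im_ofReal_mul,
      Complex.I_im, mul_one, zero_add] at e2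
    have h3 : 0 < Complex.normSq (p.α - p.μ ^ 2 * (I * ν)) := Complex.normSq_pos.2 hd
    have h4 : 0 < ν * (p.α + p.τ * p.μ ^ 2 * ν ^ 2) := by positivity
    by_contra! h5
    nlinarith
  rw [← h1, sq, Complex.mul_im] at h2
  by_contra! h3
  nlinarith

/-- Equivalently `(Im κ)² ≤ (Re κ)² + 1/μ²`. This hyperbola delimits the region in which estimates
are needed when the real axis is moved to the curve. -/
theorem neg_le_re_kSq (hp : p.Admissible) (ν : ℝ) : -(1 / p.μ ^ 2) ≤ (p.kSq ν).re := by
  have hα := hp.α_pos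
  have hτ := hp.τ_pos
  have hμ := hp.μ_pos
  have hd := den_ne hp (re_I_mul ν).le
  have e : (p.kSq ν) * (Complex.normSq (p.α - p.μ ^ 2 * (I * ν)) : ℝ)
      = I * ν * (1 - p.τ * (I * ν)) * (starRingEnd ℂ) (p.α - p.μ ^ 2 * (I * ν)) := by
    rw [← Complex.mul_conj, kSq, ← mul_assoc, div_mul_cancel₀ _ hd]
  have e2 := congrArg Complex.re e
  have e3 : I * ν * (1 - p.τ * (I * ν)) * (starRingEnd ℂ) (p.α - p.μ ^ 2 * (I * ν))
      = (((p.α * p.τ - p.μ ^ 2) * ν ^ 2 : ℝ) : ℂ)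
        + ((ν * (p.α + p.τ * p.μ ^ 2 * ν ^ 2) : ℝ) : ℂ) * I := by
    simp only [map_sub, map_mul, map_pow, Complex.conj_ofReal, Complex.conj_I]
    push_cast
    linear_combination (-p.τ * ν ^ 2 * p.α + p.μ ^ 2 * ν ^ 2 - p.τ * p.μ ^ 2 * ν ^ 3 * I)
      * Complex.I_sq
  rw [Complex.re_mul_ofReal, e3, Complex.add_re, Complex.ofReal_re, Complex.re_ofReal_mul,
    Complex.I_re, mul_zero, add_zero] at e2
  have h3 : 0 < Complex.normSq (p.α - p.μ ^ 2 * (I * ν)) := Complex.normSq_pos.2 hd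
  have h4 : Complex.normSq (p.α - p.μ ^ 2 * (I * ν)) = p.α ^ 2 + (p.μ ^ 2) ^ 2 * ν ^ 2 := by
    rw [Complex.normSq_apply, re_den, im_den]
    simp; ring
  refine le_of_mul_le_mul_right ?_ h3
  rw [e2, h4]
  have e5 : -(1 / p.μ ^ 2) * (p.α ^ 2 + (p.μ ^ 2) ^ 2 * ν ^ 2)
      = -(p.α ^ 2 / p.μ ^ 2) - p.μ ^ 2 * ν ^ 2 := by field_simp; ring
  rw [e5]
  have h6 : 0 ≤ p.α ^ 2 / p.μ ^ 2 := by positivity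
  have h7 : 0 ≤ p.α * p.τ * ν ^ 2 := by positivity
  nlinarith

theorem le_norm_κ_sq (hp : p.Admissible) (ν : ℝ) :
    1 / (p.α + p.μ ^ 2 / p.τ) * |ν| ≤ ‖p.κ ν‖ ^ 2 := by
  have := le_norm_K_sq hp (re_I_mul ν).le
  rwa [norm_I_mul] at this

theorem tendsto_re_κ (hp : p.Admissible) : Tendsto (fun ν => (p.κ ν).re) atTop atTop := by
  have hα := hp.α_pos
  have hτ := hp.τ_pos
  set m : ℝ := 1 / (p.α + p.μ ^ 2 / p.τ) with hm
  have hm0 : 0 < m := by positivity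
  have h1 : Tendsto (fun ν : ℝ => Real.sqrt ((m * ν - 1 / p.μ ^ 2) / 2)) atTop atTop := by
    refine Real.tendsto_sqrt_atTop.comp (Tendsto.atTop_div_const two_pos ?_)
    exact tendsto_atTop_add_const_right _ _ (tendsto_id.const_mul_atTop hm0)
  refine tendsto_atTop_mono' _ ?_ h1
  filter_upwards [eventually_gt_atTop 0] with ν hν
  refine Real.sqrt_le_iff.2 ⟨(re_κ_pos hp hν).le, ?_⟩
  have h2 := two_mul_re_K_sq (p := p) (I * ν)
  rw [← κ_eq, ← kSq_eq] at h2
  have h3 := le_norm_κ_sq hp ν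
  rw [abs_of_pos hν] at h3
  have h4 := neg_le_re_kSq hp ν
  linarith

/-- The data of the path `∂D₀⁺(R)`: the parameter of its corner `κ ν₀ = R e^{i y₀}`. -/
structure IsCorner (p : Params) (R ν₀ y₀ : ℝ) : Prop where
  ν_pos : 0 < ν₀
  y_pos : 0 < y₀
  y_lt : y₀ < Real.pi / 2
  tail : {ν | R < ‖p.κ ν‖} = Iio (-ν₀) ∪ Ioi ν₀
  arc : {y : ℝ | y ∈ Ioc (-Real.pi) Real.pi ∧ R * Complex.exp (I * y) ∈ p.Dplus}
    = Ioo y₀ (Real.pi - y₀)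
  right : p.κ ν₀ = R * Complex.exp (I * y₀)
  left : p.κ (-ν₀) = R * Complex.exp (I * (Real.pi - y₀ : ℝ))

theorem norm_κ_lt (hp : p.Admissible) {ν ν' : ℝ} (h : 0 ≤ ν) (h' : ν < ν') :
    ‖p.κ ν‖ < ‖p.κ ν'‖ := by
  rcases h.eq_or_lt with rfl | h
  · rw [κ_zero, norm_zero]
    exact norm_pos_iff.2 (K_ne_zero hp (re_I_mul ν').le (I_mul_ne h'.ne'))
  · have := norm_K_lt_norm_K_mul hp (re_I_mul ν).le (I_mul_ne h.ne') (c := ν' / ν)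
      ((one_lt_div h).2 h')
    have e : (((ν' / ν : ℝ) : ℂ) * (I * ν)) = I * ν' := by
      have : (ν : ℂ) ≠ 0 := by exact_mod_cast h.ne'
      push_cast; field_simp
    rwa [e] at this

theorem norm_κ_abs (hp : p.Admissible) (ν : ℝ) : ‖p.κ |ν|‖ = ‖p.κ ν‖ := by
  rcases abs_cases ν with ⟨h, -⟩ | ⟨h, h'⟩
  · rw [h]
  · rw [h, κ_neg hp h'.ne, norm_neg, RCLike.norm_conj]

theorem norm_mul_exp {R : ℝ} (hR : 0 < R) (y : ℝ) : ‖(R * Complex.exp (I * y) : ℂ)‖ = R := by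
  rw [norm_mul, mul_comm I, Complex.norm_exp_ofReal_mul_I, Complex.norm_real, Real.norm_eq_abs,
    abs_of_pos hR, mul_one]

theorem im_mul_exp (R y : ℝ) : (R * Complex.exp (I * y) : ℂ).im = R * Real.sin y := by
  rw [Complex.im_ofReal_mul, mul_comm I, Complex.exp_ofReal_mul_I_im]

theorem re_mul_exp (R y : ℝ) : (R * Complex.exp (I * y) : ℂ).re = R * Real.cos y := by
  rw [Complex.re_ofReal_mul, mul_comm I, Complex.exp_ofReal_mul_I_re]

/-- `|κ|` increases strictly with `|ν|` from 0 to infinity, so the curve meets the circle exactly at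
`ν = ±ν₀`. On the open upper semicircle the zeros of `Re ω₂` are points of the curve, hence only
these two; the sign is negative at `iR` and positive at `±R`, which identifies the arc in `D⁺`. -/
theorem exists_isCorner (hp : p.Admissible) {R : ℝ} (hR : 0 < R) :
    ∃ ν₀ y₀, p.IsCorner R ν₀ y₀ := by
  have hα := hp.α_pos
  have hτ := hp.τ_pos
  have hcont := continuous_norm_κ hp
  have htop : Tendsto (fun ν => ‖p.κ ν‖) atTop atTop :=
    tendsto_atTop_mono (fun ν => (le_abs_self _).trans (Complex.abs_re_le_norm _))
      (tendsto_re_κ hp)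
  obtain ⟨N, hN0, hN⟩ := ((eventually_ge_atTop 0).and (htop.eventually_ge_atTop R)).exists
  obtain ⟨ν₀, hν₀, hκ⟩ := intermediate_value_Icc hN0 hcont.continuousOn
    (show R ∈ Icc ‖p.κ 0‖ ‖p.κ N‖ from ⟨by rw [κ_zero, norm_zero]; exact hR.le, hN⟩)
  simp only at hκ
  have hν : 0 < ν₀ := by
    rcases hν₀.1.eq_or_lt with h | h
    · rw [← h, κ_zero, norm_zero] at hκ; linarith
    · exact h
  have htail : ∀ ν, R < ‖p.κ ν‖ ↔ ν₀ < |ν| := by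
    intro ν
    rw [← norm_κ_abs hp ν]
    constructor
    · intro h
      by_contra! h1
      rcases h1.eq_or_lt with h1 | h1
      · rw [h1, hκ] at h; exact lt_irrefl _ h
      · have := norm_κ_lt hp (abs_nonneg ν) h1
        linarith
    · intro h
      rw [← hκ]
      exact norm_κ_lt hp hν.le h
  have huniq : ∀ ν, ‖p.κ ν‖ = R → ν = ν₀ ∨ ν = -ν₀ := by
    intro ν h
    have h1 : |ν| = ν₀ := by
      rw [← norm_κ_abs hp ν] at h
      rcases lt_trichotomy |ν| ν₀ with h2 | h2 | h2
      · have := norm_κ_lt hp (abs_nonneg ν) h2; linarith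
      · exact h2
      · have := norm_κ_lt hp hν.le h2; linarith
    rcases abs_cases ν with ⟨h2, -⟩ | ⟨h2, -⟩
    · left; linarith
    · right; linarith
  have hre := re_κ_pos hp hν
  have him : 0 < (p.κ ν₀).im := im_K_pos hp (re_I_mul ν₀).le (I_mul_ne hν.ne')
  set y₀ := (p.κ ν₀).arg with hy₀
  have hright : p.κ ν₀ = R * Complex.exp (I * y₀) := by
    rw [← hκ, mul_comm I, Complex.norm_mul_exp_arg_mul_I]
  have hy1 : y₀ < Real.pi / 2 :=
    (abs_lt.1 (Complex.abs_arg_lt_pi_div_two_iff.2 (Or.inl hre))).2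
  have hy0 : 0 < y₀ := by
    have h1 : 0 ≤ y₀ := Complex.arg_nonneg_iff.2 him.le
    rcases h1.eq_or_lt with h | h
    · have := Complex.arg_eq_zero_iff.1 h.symm
      linarith [this.2]
    · exact h
  have hleft : p.κ (-ν₀) = R * Complex.exp (I * (Real.pi - y₀ : ℝ)) := by
    rw [κ_neg hp hν.ne', hright, map_mul, Complex.conj_ofReal, ← Complex.exp_conj, map_mul,
      Complex.conj_I, Complex.conj_ofReal]
    have : I * ((Real.pi - y₀ : ℝ) : ℂ) = Real.pi * I + -I * y₀ := by push_cast; ring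
    rw [this, Complex.exp_add, Complex.exp_pi_mul_I]; ring
  refine ⟨ν₀, y₀, hν, hy0, hy1, ?_, ?_, hright, hleft⟩
  · ext ν
    rw [mem_ofPred_eq, htail, lt_abs, mem_union, mem_Iio, mem_Ioi, or_comm, lt_neg]
  -- the sign of `Re ω₂` on the circle
  set c : ℝ → ℝ := fun y => (p.ω₂ (R * Complex.exp (I * y))).re with hc
  have hcc : Continuous c := continuous_re_ω₂.comp (by fun_prop)
  have hsin : ∀ y ∈ Ioo 0 Real.pi, 0 < (R * Complex.exp (I * y) : ℂ).im := fun y hy => by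
    rw [im_mul_exp]; exact mul_pos hR (Real.sin_pos_of_mem_Ioo hy)
  have hzero : ∀ y ∈ Ioo 0 Real.pi, c y = 0 → y = y₀ ∨ y = Real.pi - y₀ := by
    intro y hy h
    have h1 := K_ω₂ hp h.le (hsin y hy)
    have h2 : p.ω₂ (R * Complex.exp (I * y)) = I * ((p.ω₂ (R * Complex.exp (I * y))).im : ℝ) := by
      apply Complex.ext
      · simpa using h
      · simp
    rw [h2] at h1
    have hinj : ∀ y' ∈ Ioo 0 Real.pi,
        (R * Complex.exp (I * y) : ℂ) = R * Complex.exp (I * y') → y = y' := by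
      intro y' hy' h
      have h3 := congrArg Complex.re h
      rw [re_mul_exp, re_mul_exp] at h3
      exact Real.injOn_cos ⟨hy.1.le, hy.2.le⟩ ⟨hy'.1.le, hy'.2.le⟩ (mul_left_cancel₀ hR.ne' h3)
    rcases huniq _ (by rw [κ_eq, h1, norm_mul_exp hR]) with h3 | h3
    · rw [h3, ← κ_eq, hright] at h1
      exact Or.inl (hinj y₀ ⟨hy0, by linarith [Real.pi_pos]⟩ h1.symm)
    · rw [h3, ← κ_eq, hleft] at h1
      exact Or.inr (hinj (Real.pi - y₀) ⟨by linarith [Real.pi_pos], by linarith⟩ h1.symm)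
  -- At `k = iR` the radicand is `(1 - μ²R²)² + 4ατR²`, so its root is real and exceeds `|1 -
  -- μ²R²|`.
  have hmid : c (Real.pi / 2) < 0 := by
    have e : (R * Complex.exp (I * (Real.pi / 2 : ℝ)) : ℂ) = R * I := by
      have : I * ((Real.pi / 2 : ℝ) : ℂ) = Real.pi / 2 * I := by push_cast; ring
      rw [this, Complex.exp_pi_div_two_mul_I]
    simp only [hc]
    rw [e, ω₂, root]
    have e1 : ((1 + p.μ ^ 2 * (R * I : ℂ) ^ 2) ^ 2 - 4 * p.α * p.τ * (R * I : ℂ) ^ 2)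
        = (((1 - p.μ ^ 2 * R ^ 2) ^ 2 + 4 * p.α * p.τ * R ^ 2 : ℝ) : ℂ) := by
      rw [mul_pow, Complex.I_sq]; push_cast; ring
    have e2 : (1 + p.μ ^ 2 * (R * I : ℂ) ^ 2) = ((1 - p.μ ^ 2 * R ^ 2 : ℝ) : ℂ) := by
      rw [mul_pow, Complex.I_sq]; push_cast; ring
    have e3 : (1 / 2 : ℂ) = ((1 / 2 : ℝ) : ℂ) := by push_cast; rfl
    have e4 : (2 * p.τ : ℂ) = ((2 * p.τ : ℝ) : ℂ) := by push_cast; rfl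
    rw [e1, e2, e3, e4, ← Complex.ofReal_cpow (by positivity), ← Complex.ofReal_sub,
      ← Complex.ofReal_div, Complex.ofReal_re, ← Real.sqrt_eq_rpow]
    refine div_neg_of_neg_of_pos ?_ (by positivity)
    rw [sub_neg]
    refine (le_abs_self _).trans_lt ?_
    rw [← Real.sqrt_sq_eq_abs]
    refine Real.sqrt_lt_sqrt (sq_nonneg _) ?_
    have : 0 < 4 * p.α * p.τ * R ^ 2 := by positivity
    linarith
  have hpos0 : 0 < c 0 := by
    have := re_ω₂_ofReal_pos hp hR.ne'
    simpa [hc] using this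
  have hposπ : 0 < c Real.pi := by
    have := re_ω₂_ofReal_pos hp hR.ne'
    simp only [hc]
    rw [mul_comm I, Complex.exp_pi_mul_I, mul_neg_one, ω₂_neg]
    exact this
  have hpi := Real.pi_pos
  have hneg : ∀ y ∈ Ioo y₀ (Real.pi - y₀), c y < 0 := by
    intro y hy
    by_contra! h
    have hsub : uIcc y (Real.pi / 2) ⊆ Ioo y₀ (Real.pi - y₀) :=
      (convex_Ioo _ _).ordConnected.uIcc_subset hy ⟨hy1, by linarith⟩
    obtain ⟨y', hy', h0⟩ := intermediate_value_uIcc (hcc.continuousOn (s := uIcc y (Real.pi / 2)))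
      (show (0 : ℝ) ∈ uIcc (c y) (c (Real.pi / 2)) by
        rw [uIcc_of_ge (by linarith)]; exact ⟨hmid.le, h⟩)
    have h2 := hsub hy'
    rcases hzero y' ⟨by linarith [h2.1], by linarith [h2.2]⟩ h0 with h3 | h3
    · linarith [h2.1]
    · linarith [h2.2]
  ext y
  simp only [mem_ofPred_eq, Dplus, mem_D_iff hp]
  constructor
  · rintro ⟨hy, hneg', him'⟩
    have hy2 : y ∈ Ioo 0 Real.pi := by
      rw [im_mul_exp] at him'
      have hs : 0 < Real.sin y := by
        by_contra! h; nlinarith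
      constructor
      · by_contra! h
        have := Real.sin_nonpos_of_nonpos_of_neg_pi_le h hy.1.le
        linarith
      · rcases hy.2.eq_or_lt with h | h
        · rw [h, Real.sin_pi] at hs; exact absurd hs (lt_irrefl _)
        · exact h
    have hneg' : c y < 0 := hneg'
    constructor
    · by_contra! h
      obtain ⟨y', hy', h0⟩ := intermediate_value_Icc' hy2.1.le hcc.continuousOn
        (show (0 : ℝ) ∈ Icc (c y) (c 0) from ⟨hneg'.le, hpos0.le⟩)
      have h1 : 0 < y' := by
        rcases hy'.1.eq_or_lt with h | h
        · rw [← h] at h0; linarith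
        · exact h
      have h2 : y' ≠ y := by rintro rfl; linarith
      have h3 : y' < y := lt_of_le_of_ne hy'.2 h2
      rcases hzero y' ⟨h1, by linarith [hy2.2]⟩ h0 with h4 | h4 <;> linarith
    · by_contra! h
      obtain ⟨y', hy', h0⟩ := intermediate_value_Icc hy2.2.le hcc.continuousOn
        (show (0 : ℝ) ∈ Icc (c y) (c Real.pi) from ⟨hneg'.le, hposπ.le⟩)
      have h1 : y' < Real.pi := by
        rcases hy'.2.eq_or_lt with h | h
        · rw [h] at h0; linarith
        · exact h
      have h2 : y' ≠ y := by rintro rfl; linarith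
      have h3 : y < y' := lt_of_le_of_ne hy'.1 h2.symm
      rcases hzero y' ⟨by linarith [hy2.1], h1⟩ h0 with h4 | h4 <;> linarith
  · intro hy
    exact ⟨⟨by linarith [hy.1], by linarith [hy.2]⟩, hneg y hy,
      hsin y ⟨by linarith [hy.1], by linarith [hy.2]⟩⟩

end Params

end GK

/-! ### Cauchy's theorem for `D₀⁺`, carried out in the `ω`-plane. -/

namespace GK

theorem integrableOn_Ioi_of_le {E : Type*} [NormedAddCommGroup E] {g : ℝ → E} {a C N : ℝ}
    (hg : ContinuousOn g (Ici a)) (hC : ∀ ν, N ≤ ν → ‖g ν‖ ≤ C / ν ^ 2) :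
    IntegrableOn g (Ioi a) := by
  set b := max (max a N) 1 with hb
  have hab : a ≤ b := (le_max_left _ _).trans (le_max_left _ _)
  have hNb : N ≤ b := (le_max_right _ _).trans (le_max_left _ _)
  have hb0 : 0 < b := one_pos.trans_le (le_max_right _ _)
  have h1 : IntegrableOn g (Icc a b) := (hg.mono Icc_subset_Ici_self).integrableOn_Icc
  have h2 : IntegrableOn g (Ioi b) := by
    refine Integrable.mono' ((integrableOn_Ioi_rpow_of_lt (a := -2) (by norm_num) hb0).const_mul C)
      ((hg.mono fun ν hν => hab.trans (le_of_lt hν)).aestronglyMeasurable measurableSet_Ioi) ?_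
    refine (ae_restrict_iff' measurableSet_Ioi).2 (ae_of_all _ fun ν hν => ?_)
    have hν0 : 0 < ν := hb0.trans hν
    refine (hC ν (hNb.trans (le_of_lt hν))).trans (le_of_eq ?_)
    rw [Real.rpow_neg hν0.le, div_eq_mul_inv]
    norm_num
  refine (h1.union h2).mono_set fun ν hν => ?_
  rcases le_or_gt ν b with h | h
  · exact Or.inl ⟨le_of_lt hν, h⟩
  · exact Or.inr h

namespace Params

variable {p : Params}

theorem ω₁_eq_dual (hp : p.Admissible) {k : ℂ} (hk : (p.ω₂ k).re ≤ 0) :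
    p.ω₁ k = p.dual (p.ω₂ k) := (ω_of_sq_eq hp hk (sq_eq_zSq_ω₂ hp hk)).2

theorem re_ω₁_pos (hp : p.Admissible) {k : ℂ} (hk : (p.ω₂ k).re ≤ 0) : 0 < (p.ω₁ k).re := by
  rw [ω₁_eq_dual hp hk]; exact re_dual_pos hp hk

/-- The set off the branch cut of the square root. -/
def offCut (p : Params) : Set ℂ :=
  {k | ((1 + p.μ ^ 2 * k ^ 2) ^ 2 - 4 * p.α * p.τ * k ^ 2 : ℂ) ∈ Complex.slitPlane}

theorem isOpen_offCut : IsOpen p.offCut :=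
  Complex.isOpen_slitPlane.preimage (by fun_prop)

theorem differentiableOn_ω₂ : DifferentiableOn ℂ p.ω₂ p.offCut := by
  intro k hk
  have h1 : DifferentiableAt ℂ p.root k := by
    refine DifferentiableAt.cpow_const (f := fun k : ℂ =>
      ((1 + p.μ ^ 2 * k ^ 2) ^ 2 - 4 * p.α * p.τ * k ^ 2 : ℂ)) (by fun_prop) hk
  have : DifferentiableAt ℂ (fun k => (1 + p.μ ^ 2 * k ^ 2 - p.root k) / (2 * p.τ)) k := by
    fun_prop
  exact this.differentiableWithinAt

/-- Here `Re ω₂ ≤ 0 < Re ω₁`, so the square root has positive real part, whereas over the cut its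
real part is 0. -/
theorem mem_offCut (hp : p.Admissible) {k : ℂ} (hk : (p.ω₂ k).re ≤ 0) : k ∈ p.offCut := by
  by_contra h
  have h1 := re_ω₁_pos hp hk
  have hroot : 0 < (p.root k).re := by
    have h2 : p.ω₁ k = p.ω₂ k + ((1 / p.τ : ℝ) : ℂ) * p.root k := by
      have hτ : (p.τ : ℂ) ≠ 0 := by exact_mod_cast hp.τ_pos.ne'
      rw [ω₁, ω₂]; push_cast; field_simp; ring
    rw [h2, Complex.add_re, Complex.re_ofReal_mul] at h1
    by_contra! h3
    have := mul_nonneg (one_div_pos.2 hp.τ_pos).le (neg_nonneg.2 h3)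
    linarith
  simp only [offCut, mem_ofPred_eq, Complex.mem_slitPlane_iff, not_or, not_lt, not_not] at h
  rw [root, one_div, Complex.cpow_inv_two_re, ← Complex.abs_re_eq_norm.2 h.2,
    abs_of_nonpos h.1] at hroot
  simp at hroot

theorem IsCorner.re_ω₂_le {R ν₀ y₀ : ℝ} (hp : p.Admissible) (hc : p.IsCorner R ν₀ y₀) {y : ℝ}
    (hy : y ∈ Icc y₀ (Real.pi - y₀)) : (p.ω₂ (R * Complex.exp (I * y))).re ≤ 0 := by
  rcases hy.1.eq_or_lt with h | h
  · rw [← h, ← hc.right, κ_eq, ω₂_K hp (re_I_mul _).le, re_I_mul]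
  · rcases hy.2.eq_or_lt with h' | h'
    · rw [h', ← hc.left, κ_eq, ω₂_K hp (re_I_mul _).le, re_I_mul]
    · have h1 : y ∈ {y : ℝ | y ∈ Ioc (-Real.pi) Real.pi ∧ R * Complex.exp (I * y) ∈ p.Dplus} := by
        rw [hc.arc]; exact ⟨h, h'⟩
      exact ((mem_D_iff hp).1 h1.2.1).le

theorem IsCorner.le {R ν₀ y₀ : ℝ} (hc : p.IsCorner R ν₀ y₀) : y₀ ≤ Real.pi - y₀ := by
  linarith [hc.y_lt]

theorem IsCorner.sin_pos {R ν₀ y₀ : ℝ} (hc : p.IsCorner R ν₀ y₀) {y : ℝ}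
    (hy : y ∈ Icc y₀ (Real.pi - y₀)) : 0 < Real.sin y :=
  Real.sin_pos_of_mem_Ioo ⟨hc.y_pos.trans_le hy.1, by linarith [hy.2, hc.y_pos]⟩

/-- The integral over `∂D₀⁺` splits into the two tails and the arc. -/
theorem IsCorner.integralUpper_eq {R ν₀ y₀ : ℝ} (hc : p.IsCorner R ν₀ y₀) {F : ℂ → Fin 2 → ℂ}
    (h₁ : IntegrableOn (fun ν => deriv p.κ ν • F (p.κ ν)) (Ioi ν₀))
    (h₂ : IntegrableOn (fun ν => deriv p.κ (-ν) • F (p.κ (-ν))) (Ioi ν₀))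
    (h₃ : IntegrableOn (fun y : ℝ => (I * (R * Complex.exp (I * y))) • F (R * Complex.exp (I * y)))
      (Ioo y₀ (Real.pi - y₀))) :
    p.IntegrableUpper R F ∧ p.integralUpper R F =
      (∫ ν in Ioi ν₀, deriv p.κ ν • F (p.κ ν)) + (∫ ν in Ioi ν₀, deriv p.κ (-ν) • F (p.κ (-ν)))
      - ∫ y in y₀..(Real.pi - y₀),
          (I * (R * Complex.exp (I * y))) • F (R * Complex.exp (I * y)) := by
  have h₂' : IntegrableOn (fun ν => deriv p.κ ν • F (p.κ ν)) (Iio (-ν₀)) := by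
    have := IntegrableOn.comp_neg_Iio (c := -ν₀) (by rwa [neg_neg])
      (f := fun ν => deriv p.κ (-ν) • F (p.κ (-ν)))
    simpa using this
  refine ⟨⟨?_, ?_⟩, ?_⟩
  · rw [hc.tail]; exact h₂'.union h₁
  · rw [hc.arc]; exact h₃
  · rw [integralUpper, hc.tail, hc.arc, setIntegral_union ?_ measurableSet_Ioi h₂' h₁,
      intervalIntegral.integral_of_le hc.le, integral_Ioc_eq_integral_Ioo,
      integral_comp_neg_Ioi ν₀ (fun ν => deriv p.κ ν • F (p.κ ν)), integral_Iic_eq_integral_Iio,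
      add_comm]
    rw [Set.disjoint_left]
    intro ν h h'
    have := hc.ν_pos
    linarith [mem_Iio.1 h, mem_Ioi.1 h']

/-- Continuity of the integrand on the tails. -/
theorem continuousOn_tail (hp : p.Admissible) {F : ℂ → Fin 2 → ℂ} {ν₀ : ℝ} (h0 : 0 < ν₀) {s : ℝ}
    (hs : s = 1 ∨ s = -1) (hF : ContinuousOn (fun ν => F (p.κ (s * ν))) (Ici ν₀)) :
    ContinuousOn (fun ν => deriv p.κ (s * ν) • F (p.κ (s * ν))) (Ici ν₀) := by
  have hd : ContinuousOn (fun ν => deriv p.κ (s * ν)) (Ici ν₀) := ?_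
  · exact hd.smul hF
  intro ν hν
  have hν0 : 0 < ν := h0.trans_le hν
  have h1 : s * ν ≠ 0 := by
    rcases hs with rfl | rfl
    · simpa using hν0.ne'
    · simpa using hν0.ne'
  have h2 := continuousAt_deriv_κ hp h1
  exact (ContinuousAt.comp (f := fun ν : ℝ => s * ν) h2 (by fun_prop)).continuousWithinAt

theorem integrableOn_tail (hp : p.Admissible) {F : ℂ → Fin 2 → ℂ} {ν₀ : ℝ} (h0 : 0 < ν₀) {s : ℝ}
    (hs : s = 1 ∨ s = -1) (hF : ContinuousOn (fun ν => F (p.κ (s * ν))) (Ici ν₀)) {C N : ℝ}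
    (hC : ∀ ν, N ≤ ν → ‖F (p.κ (s * ν))‖ ≤ C / ν ^ 2) :
    IntegrableOn (fun ν => deriv p.κ (s * ν) • F (p.κ (s * ν))) (Ioi ν₀) := by
  obtain ⟨C', hC', hK⟩ := exists_norm_deriv_K_le hp
  refine integrableOn_Ioi_of_le (continuousOn_tail hp h0 hs hF) (C := C' * C) (N := max N 1) ?_
  intro ν hν
  have hν1 : 1 ≤ ν := (le_max_right _ _).trans hν
  have habs : |s * ν| = ν := by
    rcases hs with rfl | rfl
    · rw [one_mul, abs_of_pos (by linarith)]
    · rw [neg_one_mul, abs_neg, abs_of_pos (by linarith)]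
  have hne : s * ν ≠ 0 := by
    intro h; rw [h, abs_zero] at habs; linarith
  rw [norm_smul, deriv_κ hp hne, norm_mul, Complex.norm_I, mul_one, mul_div_assoc]
  refine mul_le_mul (hK _ (re_I_mul _).le ?_) (hC ν ((le_max_left _ _).trans hν))
    (norm_nonneg _) hC'
  rw [norm_I_mul, habs]; exact hν1

/-- The region over `D₀⁺(R)` in the `ω`-plane, with its boundary. -/
def region (p : Params) (R : ℝ) : Set ℂ := {ω | ω.re ≤ 0 ∧ ω ≠ 0 ∧ R ≤ ‖p.K ω‖}

/-- Since `|K|` increases along rays, outward dilations preserve the region; this is what the radial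
homotopy needs. -/
theorem exp_mul_mem_region (hp : p.Admissible) {R σ : ℝ} (hσ : 0 ≤ σ) {ω : ℂ}
    (hω : ω ∈ p.region R) : (Real.exp σ : ℂ) * ω ∈ p.region R := by
  obtain ⟨h1, h2, h3⟩ := hω
  refine ⟨?_, mul_ne_zero (by exact_mod_cast (Real.exp_pos σ).ne') h2, ?_⟩
  · rw [Complex.re_ofReal_mul]; nlinarith [Real.exp_pos σ]
  · rcases hσ.eq_or_lt with rfl | h
    · simpa using h3
    · exact h3.trans (norm_K_lt_norm_K_mul hp h1 h2 (Real.one_lt_exp_iff.2 h)).le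

theorem IsCorner.norm_κ {R ν₀ y₀ : ℝ} (hR : 0 < R) (hc : p.IsCorner R ν₀ y₀) :
    ‖p.κ ν₀‖ = R := by rw [hc.right, norm_mul_exp hR]

theorem IsCorner.I_mul_mem_region {R ν₀ y₀ ν : ℝ} (hp : p.Admissible) (hR : 0 < R)
    (hc : p.IsCorner R ν₀ y₀) (hν : ν₀ ≤ |ν|) : (I * ν : ℂ) ∈ p.region R := by
  have h0 : ν ≠ 0 := by
    rintro rfl; rw [abs_zero] at hν; linarith [hc.ν_pos]
  refine ⟨(re_I_mul ν).le, I_mul_ne h0, ?_⟩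
  rw [← κ_eq, ← norm_κ_abs hp]
  rcases hν.eq_or_lt with h | h
  · rw [← h, hc.norm_κ hR]
  · rw [← hc.norm_κ hR]; exact (norm_κ_lt hp hc.ν_pos.le h).le

theorem IsCorner.ω₂_mem_region {R ν₀ y₀ : ℝ} (hp : p.Admissible) (hR : 0 < R)
    (hc : p.IsCorner R ν₀ y₀) {y : ℝ} (hy : y ∈ Icc y₀ (Real.pi - y₀)) :
    p.ω₂ (R * Complex.exp (I * y)) ∈ p.region R ∧
      p.K (p.ω₂ (R * Complex.exp (I * y))) = R * Complex.exp (I * y) := by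
  have h1 := hc.re_ω₂_le hp hy
  have h2 : 0 < (R * Complex.exp (I * y) : ℂ).im := by
    rw [im_mul_exp]; exact mul_pos hR (hc.sin_pos hy)
  have h3 := K_ω₂ hp h1 h2
  refine ⟨⟨h1, ω₂_ne_zero hp ?_, ?_⟩, h3⟩
  · intro h; rw [h] at h2; simp at h2
  · rw [h3, norm_mul_exp hR]

/-- Cauchy's theorem for `D₀⁺(R)`, for functions that are holomorphic in `ω` and decay. -/
theorem IsCorner.integralUpper_eq_zero {R ν₀ y₀ : ℝ} (hp : p.Admissible) (hR : 0 < R)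
    (hc : p.IsCorner R ν₀ y₀) {F H : ℂ → Fin 2 → ℂ} {V : Set ℂ} (hV : IsOpen V)
    (hVR : p.region R ⊆ V) (hH : DifferentiableOn ℂ H V)
    (hF : ∀ ω ∈ p.region R, F (p.K ω) = H ω) {C ρ : ℝ}
    (hC : ∀ ω ∈ p.region R, ρ ≤ ‖ω‖ → ‖H ω‖ ≤ C / ‖ω‖ ^ 2) :
    p.IntegrableUpper R F ∧ p.integralUpper R F = 0 := by
  obtain ⟨CK, hCK, hK⟩ := exists_norm_deriv_K_le hp
  set y₁ := Real.pi - y₀ with hy₁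
  have hν₀ := hc.ν_pos
  -- the tails
  have hcontH : ContinuousOn H (p.region R) := hH.continuousOn.mono hVR
  have htail (s : ℝ) (hs : s = 1 ∨ s = -1) :
      ContinuousOn (fun ν => F (p.κ (s * ν))) (Ici ν₀) ∧
      IntegrableOn (fun ν => deriv p.κ (s * ν) • F (p.κ (s * ν))) (Ioi ν₀) := by
    have hmem : ∀ ν ∈ Ici ν₀, (I * ((s * ν : ℝ) : ℂ)) ∈ p.region R ∧ |s * ν| = ν := by
      intro ν hν
      have hν0 : 0 < ν := hν₀.trans_le hν
      have habs : |s * ν| = ν := by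
        rcases hs with rfl | rfl
        · rw [one_mul, abs_of_pos hν0]
        · rw [neg_one_mul, abs_neg, abs_of_pos hν0]
      exact ⟨hc.I_mul_mem_region hp hR (by rw [habs]; exact hν), habs⟩
    have h1 : ContinuousOn (fun ν => F (p.κ (s * ν))) (Ici ν₀) := by
      have h2 : ContinuousOn (fun ν : ℝ => H (I * ((s * ν : ℝ) : ℂ))) (Ici ν₀) :=
        hcontH.comp (by fun_prop) fun ν hν => (hmem ν hν).1
      refine h2.congr fun ν hν => ?_
      rw [κ_eq, hF _ (hmem ν hν).1]
    refine ⟨h1, integrableOn_tail hp hν₀ hs h1 (C := C) (N := max ρ ν₀) fun ν hν => ?_⟩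
    have hν' := hmem ν ((le_max_right _ _).trans hν)
    have h3 := hC _ hν'.1 (by rw [norm_I_mul, hν'.2]; exact (le_max_left _ _).trans hν)
    rw [norm_I_mul, hν'.2] at h3
    rw [κ_eq, hF _ hν'.1]
    exact h3
  obtain ⟨hc₁, hi₁⟩ := htail 1 (Or.inl rfl)
  obtain ⟨hc₂, hi₂⟩ := htail (-1) (Or.inr rfl)
  have hct₁ := continuousOn_tail hp hν₀ (Or.inl rfl) hc₁
  have hct₂ := continuousOn_tail hp hν₀ (Or.inr rfl) hc₂
  simp only [one_mul, neg_one_mul] at hi₁ hi₂ hct₁ hct₂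
  -- the arc
  set k : ℝ → ℂ := fun y => R * Complex.exp (I * y) with hk
  -- The arc is lifted to the `ω`-plane by `ω₂`, with `K (w y) = k y`. There `F(k) dk` becomes `h(ω)
  -- dω` with `h = K' H`, and the lifted arc runs from `iν₀` to `-iν₀`.
  set w : ℝ → ℂ := fun y => p.ω₂ (k y) with hw
  set w' : ℝ → ℂ := fun y => deriv p.ω₂ (k y) * (I * k y) with hw'
  have hkd (y : ℝ) : HasDerivAt k (I * k y) y := by
    have h1 : HasDerivAt (fun y : ℝ => (I * y : ℂ)) (I * 1) y :=
      (Complex.ofRealCLM.hasDerivAt (x := y)).const_mul I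
    refine (h1.cexp.const_mul (R : ℂ)).congr_deriv ?_
    simp only [hk]; ring
  have hkc : Continuous k := by fun_prop
  have hreg : ∀ y ∈ Icc y₀ y₁, w y ∈ p.region R ∧ p.K (w y) = k y := fun y hy =>
    hc.ω₂_mem_region hp hR hy
  have hcut : ∀ y ∈ Icc y₀ y₁, k y ∈ p.offCut := fun y hy => mem_offCut hp (hreg y hy).1.1
  have hwd : ∀ y ∈ Icc y₀ y₁, HasDerivAt w (w' y) y := fun y hy =>
    ((differentiableOn_ω₂.differentiableAt (isOpen_offCut.mem_nhds (hcut y hy))).hasDerivAt).comp y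
      (hkd y)
  have hwc : ContinuousOn w (Icc y₀ y₁) := fun y hy =>
    (hwd y hy).continuousAt.continuousWithinAt
  have hwc' : ContinuousOn w' (Icc y₀ y₁) := by
    refine ContinuousOn.mul ?_ (by fun_prop)
    exact (differentiableOn_ω₂.deriv isOpen_offCut).continuousOn.comp hkc.continuousOn hcut
  have hchain : ∀ y ∈ Ioo y₀ y₁, deriv p.K (w y) * w' y = I * k y := by
    intro y hy
    have hyI := Ioo_subset_Icc_self hy
    have h1 := ((differentiableAt_K (mem_regular hp (hreg y hyI).1.1
      (hreg y hyI).1.2.1)).hasDerivAt).comp y (hwd y hyI)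
    refine h1.unique ((hkd y).congr_of_eventuallyEq ?_)
    filter_upwards [Ioo_mem_nhds hy.1 hy.2] with y' hy'
    exact (hreg y' (Ioo_subset_Icc_self hy')).2
  set h : ℂ → Fin 2 → ℂ := fun ω => deriv p.K ω • H ω with hh
  have hhV : DifferentiableOn ℂ h (V ∩ p.regular) :=
    (differentiableOn_deriv_K.mono inter_subset_right).smul (hH.mono inter_subset_left)
  have hVo : IsOpen (V ∩ p.regular) := hV.inter isOpen_regular
  have hsub : p.region R ⊆ V ∩ p.regular := fun ω hω => ⟨hVR hω, mem_regular hp hω.1 hω.2.1⟩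
  have harc : ∀ y ∈ Ioo y₀ y₁, (I * k y) • F (k y) = w' y • h (w y) := by
    intro y hy
    have hyI := Ioo_subset_Icc_self hy
    rw [← hchain y hy, ← (hreg y hyI).2, hF _ (hreg y hyI).1]
    simp only [hh, smul_smul]
    rw [mul_comm]
  have hcarc : ContinuousOn (fun y => w' y • h (w y)) (Icc y₀ y₁) :=
    hwc'.smul (hhV.continuousOn.comp hwc fun y hy => hsub (hreg y hy).1)
  have h₃ : IntegrableOn (fun y => (I * k y) • F (k y)) (Ioo y₀ y₁) :=
    ((hcarc.integrableOn_Icc).mono_set Ioo_subset_Icc_self).congr_fun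
      (fun y hy => (harc y hy).symm) measurableSet_Ioo
  obtain ⟨hint, heq⟩ := hc.integralUpper_eq hi₁ hi₂ h₃
  refine ⟨hint, ?_⟩
  rw [heq]
  have harcint : ∫ y in y₀..y₁, (I * k y) • F (k y) = ∫ y in y₀..y₁, w' y • h (w y) := by
    rw [intervalIntegral.integral_of_le hc.le, intervalIntegral.integral_of_le hc.le,
      integral_Ioc_eq_integral_Ioo, integral_Ioc_eq_integral_Ioo]
    exact setIntegral_congr_fun measurableSet_Ioo harc
  have hw0 : w y₀ = I * ν₀ := by
    simp only [hw, hk]; rw [← hc.right, κ_eq, ω₂_K hp (re_I_mul _).le]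
  have hw1 : w y₁ = I * (-ν₀ : ℝ) := by
    simp only [hw, hk, hy₁]; rw [← hc.left, κ_eq, ω₂_K hp (re_I_mul _).le]
  -- the rays are the tails
  have hray (s : ℝ) (hs : s = 1 ∨ s = -1) (S : ℝ) (hS : 0 ≤ S) (σ : ℝ) (hσ : σ ∈ Icc 0 S) :
      (Real.exp σ * (I * (s * ν₀ : ℝ)) : ℂ) • h (Real.exp σ * (I * (s * ν₀ : ℝ)))
      = (s * (Real.exp σ * ν₀)) • (deriv p.κ (s * (Real.exp σ * ν₀)) •
          F (p.κ (s * (Real.exp σ * ν₀)))) := by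
    have e : (Real.exp σ * (I * (s * ν₀ : ℝ)) : ℂ) = I * ((s * (Real.exp σ * ν₀) : ℝ) : ℂ) := by
      push_cast; ring
    have hpos : 0 < Real.exp σ * ν₀ := by positivity
    have hne : s * (Real.exp σ * ν₀) ≠ 0 := by
      rcases hs with rfl | rfl <;> simp [hν₀.ne']
    have habs : ν₀ ≤ |s * (Real.exp σ * ν₀)| := by
      have h1 : ν₀ ≤ Real.exp σ * ν₀ := by
        have := Real.one_le_exp hσ.1
        nlinarith
      rcases hs with rfl | rfl
      · rw [one_mul, abs_of_pos hpos]; exact h1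
      · rw [neg_one_mul, abs_neg, abs_of_pos hpos]; exact h1
    rw [e, deriv_κ hp hne, κ_eq, hF _ (hc.I_mul_mem_region hp hR habs)]
    simp only [hh]
    rw [← Complex.coe_smul, smul_smul, smul_smul]
    congr 1; ring
  have hsubst {g : ℝ → Fin 2 → ℂ} (hg : ContinuousOn g (Ici ν₀)) {S : ℝ} (hS : 0 ≤ S) :
      ∫ σ in (0 : ℝ)..S, (Real.exp σ * ν₀) • g (Real.exp σ * ν₀)
        = ∫ ν in ν₀..(Real.exp S * ν₀), g ν := by
    have := intervalIntegral.integral_deriv_smul_comp' (a := 0) (b := S)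
      (f := fun σ => Real.exp σ * ν₀) (f' := fun σ => Real.exp σ * ν₀) (g := g)
      (fun σ _ => (Real.hasDerivAt_exp σ).mul_const ν₀) (by fun_prop) ?_
    · simpa using this
    · refine hg.mono ?_
      rintro _ ⟨σ, hσ, rfl⟩
      rw [uIcc_of_le hS] at hσ
      have := Real.one_le_exp hσ.1
      exact mem_Ici.2 (by nlinarith)
  have hle : y₀ ≤ y₁ := hc.le
  have hexpc : Continuous fun σ => Real.exp σ * ν₀ := by fun_prop
  have hhom {S : ℝ} (hS : 0 ≤ S) :
      (∫ y in y₀..y₁, (Real.exp S * w' y : ℂ) • h (Real.exp S * w y))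
        - ∫ y in y₀..y₁, w' y • h (w y)
      = -(∫ ν in ν₀..(Real.exp S * ν₀), deriv p.κ (-ν) • F (p.κ (-ν)))
        - ∫ ν in ν₀..(Real.exp S * ν₀), deriv p.κ ν • F (p.κ ν) := by
    rw [integral_radial_homotopy hVo hhV hle hS hwc hwc'
      (fun y hy => hwd y (Ioo_subset_Icc_self hy))
      (fun σ hσ y hy => hsub (exp_mul_mem_region hp hσ.1 (hreg y hy).1)), ← hsubst hct₁ hS,
      ← hsubst hct₂ hS, ← intervalIntegral.integral_neg, ← intervalIntegral.integral_sub]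
    · refine intervalIntegral.integral_congr fun σ hσ => ?_
      rw [uIcc_of_le hS] at hσ
      have e1 := hray 1 (Or.inl rfl) S hS σ hσ
      have e2 := hray (-1) (Or.inr rfl) S hS σ hσ
      simp only [one_mul, neg_one_mul] at e1 e2
      simp only [hw0, hw1]
      rw [e1, e2, neg_smul]
    all_goals
      refine ContinuousOn.intervalIntegrable_of_Icc hS ?_
      have hmaps : MapsTo (fun σ => Real.exp σ * ν₀) (Icc 0 S) (Ici ν₀) := fun σ hσ => by
        have := Real.one_le_exp hσ.1
        exact mem_Ici.2 (by nlinarith)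
    · exact (hexpc.continuousOn.smul (hct₂.comp hexpc.continuousOn hmaps)).neg
    · exact hexpc.continuousOn.smul (hct₁.comp hexpc.continuousOn hmaps)
  -- the limit
  have hscale : Tendsto (fun S => Real.exp S * ν₀) atTop atTop :=
    Real.tendsto_exp_atTop.atTop_mul_const hν₀
  have hl₁ := intervalIntegral_tendsto_integral_Ioi ν₀ hi₁ hscale
  have hl₂ := intervalIntegral_tendsto_integral_Ioi ν₀ hi₂ hscale
  -- The dilated arc has length of order `e^S`, while `K'` is bounded and `H` is of order `e^{-2S}`.
  -- The integral is therefore of order `e^{-S}`.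
  have hl₃ : Tendsto (fun S => ∫ y in y₀..y₁, (Real.exp S * w' y : ℂ) • h (Real.exp S * w y))
      atTop (𝓝 0) := by
    obtain ⟨M, hM⟩ := isCompact_Icc.exists_bound_of_continuousOn hwc'
    have hM0 : 0 ≤ M := (norm_nonneg _).trans (hM y₀ (left_mem_Icc.2 hc.le))
    obtain ⟨y, hy, hmin⟩ := isCompact_Icc.exists_isMinOn (nonempty_Icc.2 hc.le) hwc.norm
    set m := ‖w y‖ with hm
    have hm0 : 0 < m := norm_pos_iff.2 (hreg y hy).1.2.1
    have hlim : Tendsto (fun S => (M * (CK * |C|) / m ^ 2) * (y₁ - y₀) / Real.exp S)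
        atTop (𝓝 0) := Real.tendsto_exp_atTop.const_div_atTop _
    refine squeeze_zero_norm' ?_ hlim
    have hev : ∀ᶠ S in atTop, max ρ 1 ≤ Real.exp S * m :=
      (Real.tendsto_exp_atTop.atTop_mul_const hm0).eventually_ge_atTop _
    filter_upwards [hev, eventually_ge_atTop 0] with S hS hS0
    have hb : ∀ y ∈ uIoc y₀ y₁, ‖(Real.exp S * w' y : ℂ) • h (Real.exp S * w y)‖
        ≤ (M * (CK * |C|) / m ^ 2) / Real.exp S := by
      intro y' hy'
      rw [uIoc_of_le hc.le] at hy'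
      have hyI := Ioc_subset_Icc_self hy'
      have hr := exp_mul_mem_region hp hS0 (hreg y' hyI).1
      have hmin' : m ≤ ‖w y'‖ := hmin hyI
      have hexp := Real.exp_pos S
      have hnorm : ‖(Real.exp S * w y' : ℂ)‖ = Real.exp S * ‖w y'‖ := by
        rw [norm_mul, Complex.norm_real, Real.norm_eq_abs, abs_of_pos hexp]
      have hge : max ρ 1 ≤ ‖(Real.exp S * w y' : ℂ)‖ := by
        rw [hnorm]; exact hS.trans (by gcongr)
      have h1 : ‖h (Real.exp S * w y')‖ ≤ CK * (|C| / (Real.exp S * m) ^ 2) := by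
        simp only [hh]
        rw [norm_smul]
        refine mul_le_mul (hK _ hr.1 ((le_max_right _ _).trans hge)) ?_ (norm_nonneg _) hCK
        refine (hC _ hr ((le_max_left _ _).trans hge)).trans ?_
        rw [hnorm]
        gcongr
        exact le_abs_self C
      rw [norm_smul, norm_mul, Complex.norm_real, Real.norm_eq_abs, abs_of_pos hexp]
      calc Real.exp S * ‖w' y'‖ * ‖h (Real.exp S * w y')‖
          ≤ Real.exp S * M * (CK * (|C| / (Real.exp S * m) ^ 2)) := by
            gcongr; exact hM y' hyI
        _ = _ := by field_simp
    have := intervalIntegral.norm_integral_le_of_norm_le_const hb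
    rw [abs_of_nonneg (sub_nonneg.2 hc.le)] at this
    refine this.trans (le_of_eq ?_)
    ring
  have hL := hl₃.sub_const (∫ y in y₀..y₁, w' y • h (w y))
  have hR' := hl₂.neg.sub hl₁
  have huniq := tendsto_nhds_unique (hL.congr' ?_) hR'
  · rw [harcint]
    rw [zero_sub] at huniq
    have h5 : ∫ y in y₀..y₁, w' y • h (w y)
        = (∫ ν in Ioi ν₀, deriv p.κ (-ν) • F (p.κ (-ν)))
          + ∫ ν in Ioi ν₀, deriv p.κ ν • F (p.κ ν) := by
      rw [← neg_inj, huniq]; abel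
    rw [h5]; abel
  · filter_upwards [eventually_ge_atTop 0] with S hS
    exact hhom hS

end Params

end GK

/-! ### Deformation of the real axis into `∂D₀⁺`. -/

namespace GK

/-- A primitive varies little along vertical segments, if its derivative decays there. -/
theorem norm_primitive_vertical_le {P G : ℂ → Fin 2 → ℂ} (hP : ∀ k, HasDerivAt P (G k) k)
    {X C ξ η : ℝ} (hX : 0 < X) (hC : 0 ≤ C) (hη : 0 ≤ η)
    (hv : ∀ s ∈ Icc 0 η, ‖G (ξ + s * I)‖ ≤ C / |ξ| * Real.exp (-(X * s)) + C / ξ ^ 2) :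
    ‖P (ξ + η * I) - P ξ‖ ≤ C / (|ξ| * X) + C * η / ξ ^ 2 := by
  have hd (s : ℝ) : HasDerivAt (fun s : ℝ => P (ξ + s * I) - P ξ) (I • G (ξ + s * I)) s := by
    have h1 : HasDerivAt (fun s : ℝ => (ξ + s * I : ℂ)) (1 * I) s :=
      ((Complex.ofRealCLM.hasDerivAt (x := s)).mul_const I).const_add _
    have h2 := (HasDerivAt.scomp s (hP _) h1).sub_const (P ξ)
    rwa [one_mul] at h2
  -- The comparison function is the primitive of the bound on the derivative; its first summand
  -- never exceeds `C / (|ξ| X)`.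
  have hB (s : ℝ) : HasDerivAt (fun s : ℝ => C / |ξ| * ((1 - Real.exp (-(X * s))) / X)
      + C * s / ξ ^ 2) (C / |ξ| * Real.exp (-(X * s)) + C / ξ ^ 2) s := by
    have h1 : HasDerivAt (fun s : ℝ => Real.exp (-(X * s))) (Real.exp (-(X * s)) * -(X * 1)) s :=
      (((hasDerivAt_id s).const_mul X).neg).exp
    refine ((((h1.const_sub 1).div_const X).const_mul (C / |ξ|)).add
      (((hasDerivAt_id s).const_mul C).div_const (ξ ^ 2))).congr_deriv ?_
    field_simp
  have h := image_norm_le_of_norm_deriv_right_le_deriv_boundary (a := 0) (b := η)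
    (f := fun s : ℝ => P (ξ + s * I) - P ξ) (f' := fun s : ℝ => I • G (ξ + s * I))
    (fun s _ => (hd s).continuousAt.continuousWithinAt) (fun s _ => (hd s).hasDerivWithinAt)
    (by simp) hB (fun s hs => by
      rw [norm_smul, Complex.norm_I, one_mul]
      exact hv s ⟨hs.1, hs.2.le⟩) (right_mem_Icc.2 hη)
  refine h.trans ?_
  have h1 : C / |ξ| * ((1 - Real.exp (-(X * η))) / X) ≤ C / |ξ| * (1 / X) := by
    gcongr
    linarith [Real.exp_pos (-(X * η))]
  have h2 : C / |ξ| * (1 / X) = C / (|ξ| * X) := by rw [div_mul_div_comm, mul_one]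
  linarith

namespace Params

variable {p : Params}

theorem im_κ_nonneg (ν : ℝ) : 0 ≤ (p.κ ν).im := p.κ_im_nonneg ν

theorem im_κ_sq_le (hp : p.Admissible) (ν : ℝ) :
    (p.κ ν).im ^ 2 ≤ (p.κ ν).re ^ 2 + 1 / p.μ ^ 2 := by
  have h1 := two_mul_im_K_sq (p := p) (I * ν)
  have h2 := two_mul_re_K_sq (p := p) (I * ν)
  have h3 := neg_le_re_kSq hp ν
  rw [kSq_eq] at h3
  rw [κ_eq]
  linarith

theorem le_two_mul_abs (hp : p.Admissible) {ξ η : ℝ} (hξ : 1 / p.μ ≤ |ξ|)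
    (h : η ^ 2 ≤ ξ ^ 2 + 1 / p.μ ^ 2) : η ≤ 2 * |ξ| := by
  have hμ := hp.μ_pos
  refine le_of_sq_le_sq ?_ (by positivity) 
  have h1 : 1 / p.μ ^ 2 ≤ ξ ^ 2 := by
    have := pow_le_pow_left₀ (by positivity) hξ 2
    rwa [div_pow, one_pow, sq_abs] at this
  rw [mul_pow, sq_abs]
  nlinarith [sq_nonneg ξ]

/-- Convergence along the branches of the curve `κ` implies convergence along the real axis. -/
theorem tendsto_real_of_tendsto_κ (hp : p.Admissible) {P G : ℂ → Fin 2 → ℂ}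
    (hP : ∀ k, HasDerivAt P (G k) k) {X C B₀ : ℝ} (hX : 0 < X) (hC : 0 ≤ C)
    (hv : ∀ ξ η : ℝ, B₀ ≤ |ξ| → 0 ≤ η → η ^ 2 ≤ ξ ^ 2 + 1 / p.μ ^ 2 →
      ‖G (ξ + η * I)‖ ≤ C / |ξ| * Real.exp (-(X * η)) + C / ξ ^ 2)
    {s : ℝ} (hs : s = 1 ∨ s = -1) {Q : Fin 2 → ℂ}
    (hQ : Tendsto (fun ν : ℝ => P ((s * (p.κ ν).re : ℝ) + (p.κ ν).im * I)) atTop (𝓝 Q)) :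
    Tendsto (fun B : ℝ => P (s * B : ℝ)) atTop (𝓝 Q) := by
  have hlim : Tendsto (fun B : ℝ => C * (1 / X + 2) / B) atTop (𝓝 0) :=
    tendsto_id.const_div_atTop _
  rw [Metric.tendsto_nhds]
  intro ε hε
  obtain ⟨N₁, hN₁⟩ := eventually_atTop.1 ((Metric.tendsto_nhds.1 hQ) (ε / 2) (half_pos hε))
  set N := max N₁ 1 with hN
  have hN0 : 0 < N := one_pos.trans_le (le_max_right _ _)
  filter_upwards [eventually_ge_atTop (p.κ N).re, eventually_ge_atTop B₀,
    eventually_ge_atTop (1 / p.μ), eventually_gt_atTop 0,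
    (Metric.tendsto_nhds.1 hlim) (ε / 2) (half_pos hε)] with B h1 h2 h3 h4 h5
  -- By the intermediate value theorem some point of the curve far out has real part exactly `B`. It
  -- lies above the real point at a height of at most `2B`, so `P` changes by `O(1/B)` between the
  -- two.
  obtain ⟨N₂, hN₂, hB₂⟩ := (((tendsto_re_κ hp).eventually_ge_atTop B).and
    (eventually_ge_atTop N)).exists
  obtain ⟨ν, hν, hνB⟩ := intermediate_value_Icc hB₂ (f := fun ν => (p.κ ν).re)
    (fun ν hν => (Complex.continuous_re.continuousAt.comp (continuousAt_κ hp
      (hN0.trans_le hν.1).ne')).continuousWithinAt) ⟨h1, hN₂⟩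
  simp only at hνB
  have h6 := hN₁ ν ((le_max_left _ _).trans hν.1)
  rw [hνB] at h6
  have habs : |s * B| = B := by
    rcases hs with rfl | rfl
    · rw [one_mul, abs_of_pos h4]
    · rw [neg_one_mul, abs_neg, abs_of_pos h4]
  have hsq : (s * B) ^ 2 = B ^ 2 := by
    rcases hs with rfl | rfl <;> ring
  have hη := im_κ_nonneg (p := p) ν
  have hη2 := im_κ_sq_le hp ν
  rw [hνB, ← hsq] at hη2
  have h7 := norm_primitive_vertical_le hP (ξ := s * B) (η := (p.κ ν).im) hX hC hη
    fun u hu => hv (s * B) u (by rw [habs]; exact h2) hu.1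
      ((pow_le_pow_left₀ hu.1 hu.2 2).trans hη2)
  have h8 := le_two_mul_abs hp (ξ := s * B) (by rw [habs]; exact h3) hη2
  rw [habs] at h7 h8
  rw [hsq] at h7
  have h9 : C / (B * X) + C * (p.κ ν).im / B ^ 2 ≤ C * (1 / X + 2) / B := by
    have : C * (p.κ ν).im / B ^ 2 ≤ C * (2 * B) / B ^ 2 := by gcongr
    refine (add_le_add_right this _).trans (le_of_eq ?_)
    field_simp
  rw [Real.dist_eq, sub_zero] at h5
  have h10 := (le_abs_self _).trans_lt h5
  rw [dist_eq_norm] at h6 ⊢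
  calc ‖P (s * B : ℝ) - Q‖
      = ‖(P ((s * B : ℝ) + (p.κ ν).im * I) - Q)
          - (P ((s * B : ℝ) + (p.κ ν).im * I) - P (s * B : ℝ))‖ := by congr 1; abel
    _ ≤ _ := norm_sub_le _ _
    _ < ε := by linarith

/-- For an entire function with suitable decay the integral over the real axis may be deformed
into `∂D₀⁺`. -/
theorem IsCorner.tendsto_integral {R ν₀ y₀ : ℝ} (hp : p.Admissible) (hc : p.IsCorner R ν₀ y₀)
    {G : ℂ → Fin 2 → ℂ} (hG : Differentiable ℂ G) {X C N B₀ : ℝ} (hX : 0 < X) (hC : 0 ≤ C)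
    (hκ : ∀ ν : ℝ, N ≤ |ν| → ‖G (p.κ ν)‖ ≤ C / ν ^ 2)
    (hv : ∀ ξ η : ℝ, B₀ ≤ |ξ| → 0 ≤ η → η ^ 2 ≤ ξ ^ 2 + 1 / p.μ ^ 2 →
      ‖G (ξ + η * I)‖ ≤ C / |ξ| * Real.exp (-(X * η)) + C / ξ ^ 2) :
    p.IntegrableUpper R G ∧ Tendsto (fun z : ℝ × ℝ => ∫ k in z.1..z.2, G (k : ℝ))
      (atBot ×ˢ atTop) (𝓝 (p.integralUpper R G)) := by
  -- With an entire primitive `P` every integral is a difference of values of `P`, and the arc joins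
  -- the two tails without a gap. What remains is that `P` has the same limits along the branches of
  -- the curve as along the real half-axes.
  obtain ⟨P, hP'⟩ := hG.isExactOn_univ
  have hP : ∀ k, HasDerivAt P (G k) k := fun k => hP' k (mem_univ k)
  have hν₀ := hc.ν_pos
  have htail (s : ℝ) (hs : s = 1 ∨ s = -1) :
      ContinuousOn (fun ν => G (p.κ (s * ν))) (Ici ν₀) ∧
      IntegrableOn (fun ν => deriv p.κ (s * ν) • G (p.κ (s * ν))) (Ioi ν₀) := by
    have hne : ∀ ν ∈ Ici ν₀, s * ν ≠ 0 ∧ |s * ν| = |ν| := by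
      intro ν hν
      have hν0 : 0 < ν := hν₀.trans_le hν
      rcases hs with rfl | rfl <;> simp [hν0.ne']
    have h1 : ContinuousOn (fun ν => G (p.κ (s * ν))) (Ici ν₀) := fun ν hν =>
      (hG.continuous.continuousAt.comp (ContinuousAt.comp (f := fun ν : ℝ => s * ν)
        (continuousAt_κ hp (hne ν hν).1) (by fun_prop))).continuousWithinAt
    refine ⟨h1, integrableOn_tail hp hν₀ hs h1 (C := C) (N := max N ν₀) fun ν hν => ?_⟩
    have h2 := hne ν ((le_max_right _ _).trans hν)
    have h3 := hκ (s * ν) (by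
      rw [h2.2]; exact ((le_max_left _ _).trans hν).trans (le_abs_self _))
    have e : (s * ν) ^ 2 = ν ^ 2 := by rw [← sq_abs, h2.2, sq_abs]
    rwa [e] at h3
  obtain ⟨hc₁, hi₁⟩ := htail 1 (Or.inl rfl)
  obtain ⟨hc₂, hi₂⟩ := htail (-1) (Or.inr rfl)
  have hct₁ := continuousOn_tail hp hν₀ (Or.inl rfl) hc₁
  have hct₂ := continuousOn_tail hp hν₀ (Or.inr rfl) hc₂
  simp only [one_mul, neg_one_mul] at hi₁ hi₂ hct₁ hct₂
  have harcd (y : ℝ) : HasDerivAt (fun y : ℝ => P (R * Complex.exp (I * y)))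
      ((I * (R * Complex.exp (I * y))) • G (R * Complex.exp (I * y))) y := by
    have h1 : HasDerivAt (fun y : ℝ => (I * y : ℂ)) (I * 1) y :=
      (Complex.ofRealCLM.hasDerivAt (x := y)).const_mul I
    have h2 := HasDerivAt.scomp y (hP _) (h1.cexp.const_mul (R : ℂ))
    refine h2.congr_deriv ?_
    congr 1; ring
  have hcarc : Continuous (fun y : ℝ => (I * (R * Complex.exp (I * y))) •
      G (R * Complex.exp (I * y))) := by
    have h1 : Continuous fun y : ℝ => (R * Complex.exp (I * y) : ℂ) := by fun_prop
    exact (continuous_const.mul h1).smul (hG.continuous.comp h1)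
  have h₃ : IntegrableOn (fun y : ℝ => (I * (R * Complex.exp (I * y))) •
      G (R * Complex.exp (I * y))) (Ioo y₀ (Real.pi - y₀)) :=
    (hcarc.continuousOn.integrableOn_Icc).mono_set Ioo_subset_Icc_self
  obtain ⟨hint, heq⟩ := hc.integralUpper_eq hi₁ hi₂ h₃
  refine ⟨hint, ?_⟩
  rw [intervalIntegral.integral_eq_sub_of_hasDerivAt (fun y _ => harcd y)
    (hcarc.intervalIntegrable _ _), ← hc.right, ← hc.left] at heq
  -- the tails
  have hF₁ {S : ℝ} (hS : ν₀ ≤ S) : ∫ ν in ν₀..S, deriv p.κ ν • G (p.κ ν)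
      = P (p.κ S) - P (p.κ ν₀) := by
    refine intervalIntegral.integral_eq_sub_of_hasDerivAt (f := fun ν => P (p.κ ν))
      (fun ν hν => ?_) ?_
    · rw [uIcc_of_le hS] at hν
      have hne : ν ≠ 0 := (hν₀.trans_le hν.1).ne'
      rw [deriv_κ hp hne]
      exact HasDerivAt.scomp ν (hP _) (hasDerivAt_κ hp hne)
    · exact (hct₁.mono fun ν hν => hν.1).intervalIntegrable_of_Icc hS
  have hF₂ {S : ℝ} (hS : ν₀ ≤ S) : ∫ ν in ν₀..S, deriv p.κ (-ν) • G (p.κ (-ν))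
      = P (p.κ (-ν₀)) - P (p.κ (-S)) := by
    have h := intervalIntegral.integral_eq_sub_of_hasDerivAt (a := ν₀) (b := S)
      (f := fun ν => -P (p.κ (-ν))) (f' := fun ν => deriv p.κ (-ν) • G (p.κ (-ν)))
      (fun ν hν => ?_) ?_
    · rw [h]; abel
    · rw [uIcc_of_le hS] at hν
      have hne : -ν ≠ 0 := neg_ne_zero.2 (hν₀.trans_le hν.1).ne'
      rw [deriv_κ hp hne]
      have h1 := HasDerivAt.scomp ν (hasDerivAt_κ hp hne) (hasDerivAt_neg ν)
      have h2 := (HasDerivAt.scomp ν (hP _) h1).neg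
      refine h2.congr_deriv ?_
      simp
    · exact (hct₂.mono fun ν hν => hν.1).intervalIntegrable_of_Icc hS
  have hl₁ := intervalIntegral_tendsto_integral_Ioi ν₀ hi₁ tendsto_id
  have hl₂ := intervalIntegral_tendsto_integral_Ioi ν₀ hi₂ tendsto_id
  set A₁ := ∫ ν in Ioi ν₀, deriv p.κ ν • G (p.κ ν) with hA₁
  set A₂ := ∫ ν in Ioi ν₀, deriv p.κ (-ν) • G (p.κ (-ν)) with hA₂
  have hQ₁ : Tendsto (fun ν => P (p.κ ν)) atTop (𝓝 (A₁ + P (p.κ ν₀))) := by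
    refine (hl₁.add_const _).congr' ?_
    filter_upwards [eventually_ge_atTop ν₀] with S hS
    simp only [id]; rw [hF₁ hS]; abel
  have hQ₂ : Tendsto (fun ν => P (p.κ (-ν))) atTop (𝓝 (P (p.κ (-ν₀)) - A₂)) := by
    refine (hl₂.const_sub _).congr' ?_
    filter_upwards [eventually_ge_atTop ν₀] with S hS
    simp only [id]; rw [hF₂ hS]; abel
  have hR₁ := tendsto_real_of_tendsto_κ hp hP hX hC hv (Or.inl rfl) (hQ₁.congr fun ν => by
    rw [one_mul, Complex.re_add_im])
  have hR₂ := tendsto_real_of_tendsto_κ hp hP hX hC hv (Or.inr rfl) (hQ₂.congr' (by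
    filter_upwards [eventually_gt_atTop 0] with ν hν
    rw [κ_neg hp hν.ne']
    congr 1
    apply Complex.ext <;> simp))
  simp only [one_mul, neg_one_mul] at hR₁ hR₂
  have hR₂' : Tendsto (fun B : ℝ => P (B : ℝ)) atBot (𝓝 (P (p.κ (-ν₀)) - A₂)) := by
    have := hR₂.comp tendsto_neg_atBot_atTop
    refine this.congr fun B => ?_
    simp
  have hreal (a b : ℝ) : ∫ k in a..b, G (k : ℝ) = P b - P a := by
    refine intervalIntegral.integral_eq_sub_of_hasDerivAt (f := fun k : ℝ => P k)
      (fun k _ => ?_) ((hG.continuous.comp Complex.continuous_ofReal).intervalIntegrable _ _)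
    have := HasDerivAt.scomp k (hP _) (Complex.ofRealCLM.hasDerivAt (x := k))
    rw [Complex.ofRealCLM_apply, Complex.ofReal_one, one_smul] at this
    exact this
  simp_rw [hreal]
  have hfin := (hR₁.comp tendsto_snd).sub (hR₂'.comp (tendsto_fst (f := (atBot : Filter ℝ))
    (g := (atTop : Filter ℝ))))
  have e : A₁ + P (p.κ ν₀) - (P (p.κ (-ν₀)) - A₂) = p.integralUpper R G := by
    rw [heq]; abel
  rw [e] at hfin
  exact hfin

end Params

end GK

namespace GK

/-! ### The matrix exponential and Duhamel's formula -/

section MatrixExp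

open scoped Matrix.Norms.Operator

theorem continuous_matrix_exp :
    Continuous (NormedSpace.exp : Matrix (Fin 2) (Fin 2) ℂ → Matrix (Fin 2) (Fin 2) ℂ) :=
  NormedSpace.exp_continuous

/-- The entrywise form keeps the choice of a matrix norm inside this section. -/
theorem differentiable_exp_entry {A : ℂ → Matrix (Fin 2) (Fin 2) ℂ}
    (hA : ∀ i j, Differentiable ℂ fun k => A k i j) (i j : Fin 2) :
    Differentiable ℂ fun k => NormedSpace.exp (A k) i j := by
  intro k
  have h0 : Differentiable ℂ A := by
    have : A = fun k => ∑ i, ∑ j, A k i j • Matrix.single i j (1 : ℂ) := by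
      funext k
      rw [Matrix.matrix_eq_sum_single (A k)]
      simp [Matrix.smul_single]
    rw [this]
    exact Differentiable.fun_sum fun i _ => Differentiable.fun_sum fun j _ =>
      (hA i j).smul_const _
  have h1 := ((NormedSpace.exp_analytic (𝕂 := ℂ) (A k)).differentiableAt).comp k (h0 k)
  exact ((Matrix.entryLinearMap ℂ ℂ i j).toContinuousLinearMap.differentiableAt).comp k h1

theorem hasDerivAt_exp_entry (A : Matrix (Fin 2) (Fin 2) ℂ) (t s : ℝ) (i j : Fin 2) :
    HasDerivAt (fun s : ℝ => NormedSpace.exp (-((t : ℂ) - s) • A) i j)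
      ((NormedSpace.exp (-((t : ℂ) - s) • A) * A) i j) s := by
  have h1 := hasDerivAt_exp_smul_const (𝕂 := ℂ) A (-((t : ℂ) - s))
  have h2 : HasDerivAt (fun s : ℝ => -((t : ℂ) - s)) 1 s := by
    have := ((Complex.ofRealCLM.hasDerivAt (x := s)).const_sub (t : ℂ)).fun_neg
    simpa using this
  have h3 := HasDerivAt.scomp s h1 h2
  rw [one_smul] at h3
  have h4 := ((Matrix.entryLinearMap ℂ ℂ i j).toContinuousLinearMap.restrictScalars ℝ
    ).hasFDerivAt.comp_hasDerivAt s h3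
  exact h4

end MatrixExp

theorem continuous_exp_mulVec {X : Type*} [TopologicalSpace X] {A : X → Matrix (Fin 2) (Fin 2) ℂ}
    {v : X → Fin 2 → ℂ} (hA : Continuous A) (hv : Continuous v) :
    Continuous fun x => (NormedSpace.exp (A x)).mulVec (v x) :=
  (continuous_matrix_exp.comp hA).matrix_mulVec hv

/-- Duhamel's formula. -/
theorem duhamel (A : Matrix (Fin 2) (Fin 2) ℂ) {t : ℝ} (ht : 0 ≤ t) {u f : ℝ → Fin 2 → ℂ}
    (hu : ContinuousOn u (Icc 0 t)) (hf : ContinuousOn f (Icc 0 t))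
    (hd : ∀ s ∈ Ioo 0 t, HasDerivAt u (-(A.mulVec (u s)) + f s) s) :
    u t = (NormedSpace.exp (-(t : ℂ) • A)).mulVec (u 0)
      + ∫ s in (0 : ℝ)..t, (NormedSpace.exp (-((t : ℂ) - s) • A)).mulVec (f s) := by
  have hcA : Continuous fun s : ℝ => NormedSpace.exp (-((t : ℂ) - s) • A) :=
    continuous_matrix_exp.comp (by fun_prop)
  have hc {v : ℝ → Fin 2 → ℂ} (hv : ContinuousOn v (Icc 0 t)) :
      ContinuousOn (fun s : ℝ => (NormedSpace.exp (-((t : ℂ) - s) • A)).mulVec (v s))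
        (Icc 0 t) := by
    have h : Continuous fun x : Matrix (Fin 2) (Fin 2) ℂ × (Fin 2 → ℂ) => x.1.mulVec x.2 :=
      continuous_fst.matrix_mulVec continuous_snd
    exact h.comp_continuousOn (hcA.continuousOn.prodMk hv)
  -- Variation of constants: in the derivative of `e^{-(t-s)A} u(s)` the terms with `A` cancel, and
  -- `e^{-(t-s)A} f(s)` is left.
  have h := intervalIntegral.integral_eq_sub_of_hasDerivAt_of_le ht
    (f := fun s : ℝ => (NormedSpace.exp (-((t : ℂ) - s) • A)).mulVec (u s))
    (f' := fun s : ℝ => (NormedSpace.exp (-((t : ℂ) - s) • A)).mulVec (f s)) (hc hu) ?_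
    ((hc hf).intervalIntegrable_of_Icc ht)
  · rw [h, sub_self, neg_zero, zero_smul, NormedSpace.exp_zero, Matrix.one_mulVec,
      Complex.ofReal_zero, sub_zero]
    abel
  · intro s hs
    refine hasDerivAt_pi.2 fun i => ?_
    have h1 := hasDerivAt_pi.1 (hd s hs)
    have h2 : HasDerivAt (fun s : ℝ => ∑ j, NormedSpace.exp (-((t : ℂ) - s) • A) i j * u s j)
        (∑ j, ((NormedSpace.exp (-((t : ℂ) - s) • A) * A) i j * u s j
          + NormedSpace.exp (-((t : ℂ) - s) • A) i j * (-(A.mulVec (u s)) + f s) j)) s :=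
      HasDerivAt.fun_sum fun j _ => (hasDerivAt_exp_entry A t s i j).mul (h1 j)
    refine h2.congr_deriv ?_
    have e : (∑ j, (NormedSpace.exp (-((t : ℂ) - s) • A) * A) i j * u s j)
        = ((NormedSpace.exp (-((t : ℂ) - s) • A)).mulVec (A.mulVec (u s))) i := by
      rw [Matrix.mulVec_mulVec]; rfl
    have e2 : (∑ j, NormedSpace.exp (-((t : ℂ) - s) • A) i j * (-(A.mulVec (u s)) + f s) j)
        = ((NormedSpace.exp (-((t : ℂ) - s) • A)).mulVec (-(A.mulVec (u s)) + f s)) i := rfl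
    rw [Finset.sum_add_distrib, e, e2, ← Pi.add_apply, ← Matrix.mulVec_add,
      add_neg_cancel_left]

namespace Params

variable {p : Params}

theorem continuous_Lam : Continuous p.Lam := by
  refine continuous_matrix fun i j => ?_
  fin_cases i <;> fin_cases j <;> simp [Lam] <;> fun_prop

theorem differentiable_Lam_entry (i j : Fin 2) : Differentiable ℂ fun k => p.Lam k i j := by
  fin_cases i <;> fin_cases j <;> simp [Lam] <;> fun_prop

/-- Two numbers are the roots of the dispersion equation at `k`, and distinct. -/
structure IsPair (p : Params) (k a b : ℂ) : Prop where
  add : a + b = 1 / p.τ + p.θ * k ^ 2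
  mul : a * b = p.β * k ^ 2
  ne : a ≠ b
  k_ne : k ≠ 0

theorem IsPair.symm {k a b : ℂ} (h : p.IsPair k a b) : p.IsPair k b a :=
  ⟨by rw [add_comm]; exact h.add, by rw [mul_comm]; exact h.mul, h.ne.symm, h.k_ne⟩

theorem IsPair.neg {k a b : ℂ} (h : p.IsPair k a b) : p.IsPair (-k) a b :=
  ⟨by rw [neg_sq]; exact h.add, by rw [neg_sq]; exact h.mul, h.ne, neg_ne_zero.2 h.k_ne⟩

/-- The coordinate of the vector `v` for the eigenvalue `a`, `b` being the other one. -/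
def coord (k b : ℂ) (v : Fin 2 → ℂ) : ℂ := -b * v 0 + I * k * v 1

/-- With `s` replaced by `r s`, the right side solves the linear equation of the exponential in the
real variable `r` and equals `v` at `r = 0`; uniqueness is `duhamel` with zero source. The formula
is symmetric in `a` and `b`, so branches of the square root play no role. -/
theorem IsPair.exp_mulVec {k a b : ℂ} (h : p.IsPair k a b) (s : ℂ) (v : Fin 2 → ℂ) :
    (NormedSpace.exp (-s • p.Lam k)).mulVec v
      = (1 / (a - b)) • (Complex.exp (-(a * s)) • coord k b v • ![1, a / (I * k)]
          - Complex.exp (-(b * s)) • coord k a v • ![1, b / (I * k)]) := by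
  have hab : a - b ≠ 0 := sub_ne_zero.2 h.ne
  have hk := h.k_ne
  have hI := Complex.I_ne_zero
  -- along the segment from `0` to `s`
  set N : ℝ → Fin 2 → ℂ := fun r => (1 / (a - b)) • (Complex.exp (-(a * (r * s))) • coord k b v •
    ![1, a / (I * k)] - Complex.exp (-(b * (r * s))) • coord k a v • ![1, b / (I * k)]) with hN
  have hexp (c : ℂ) (r : ℝ) : HasDerivAt (fun r : ℝ => Complex.exp (-(c * (r * s))))
      (Complex.exp (-(c * (r * s))) * -(c * s)) r := by
    have h1 : HasDerivAt (fun r : ℝ => -(c * ((r : ℂ) * s))) (-(c * (1 * s))) r :=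
      (((Complex.ofRealCLM.hasDerivAt (x := r)).mul_const s).const_mul c).neg
    rw [one_mul] at h1
    exact h1.cexp
  have hd (r : ℝ) : HasDerivAt N (-((s • p.Lam k).mulVec (N r)) + 0) r := by
    have h1 : HasDerivAt N ((1 / (a - b)) • ((Complex.exp (-(a * (r * s))) * -(a * s)) •
        coord k b v • ![1, a / (I * k)] - (Complex.exp (-(b * (r * s))) * -(b * s)) •
        coord k a v • ![1, b / (I * k)])) r :=
      (((hexp a r).smul_const _).fun_sub ((hexp b r).smul_const _)).fun_const_smul _
    refine h1.congr_deriv ?_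
    have e (c d : ℂ) (hc : c + d = 1 / p.τ + p.θ * k ^ 2) (hm : c * d = p.β * k ^ 2) :
        (p.Lam k).mulVec ![1, c / (I * k)] = c • ![1, c / (I * k)] := by
      ext i
      fin_cases i
      · simp [Lam, Matrix.mulVec, dotProduct]; field_simp
      · have e1 : (p.θ * k ^ 2 + 1 / p.τ : ℂ) = c + d := by rw [hc]; ring
        simp only [Lam, Matrix.mulVec, dotProduct, e1]
        simp
        field_simp
        linear_combination hm + (p.β * k ^ 2) * Complex.I_sq
    simp only [hN, Matrix.smul_mulVec, Matrix.mulVec_smul, Matrix.mulVec_sub,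
      e a b h.add h.mul, e b a h.symm.add h.symm.mul]
    module
  have hcont : ContinuousOn N (Icc 0 1) := fun r _ => (hd r).continuousAt.continuousWithinAt
  have hdu := duhamel (s • p.Lam k) zero_le_one hcont (f := fun _ => 0) continuousOn_const
    (fun r _ => hd r)
  have hN1 : N 1 = (1 / (a - b)) • (Complex.exp (-(a * s)) • coord k b v • ![1, a / (I * k)]
          - Complex.exp (-(b * s)) • coord k a v • ![1, b / (I * k)]) := by simp [hN]
  have hN0 : N 0 = v := by
    ext i
    fin_cases i
    · simp [hN, coord]; field_simp; ring
    · simp [hN, coord]; field_simp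
      ring
  rw [← hN1, hdu, hN0]
  simp

end Params

end GK

namespace GK

/-! ### The boundary terms -/

theorem pow_mul_exp_neg_le (n : ℕ) {c x : ℝ} (hc : 0 < c) (hx : 0 ≤ x) :
    x ^ n * Real.exp (-(c * x)) ≤ n.factorial / c ^ n := by
  have h := Real.pow_div_factorial_le_exp (c * x) (by positivity) n
  rw [div_le_iff₀ (by positivity)] at h
  rw [Real.exp_neg, ← div_eq_mul_inv, div_le_div_iff₀ (Real.exp_pos _) (by positivity)]
  rw [mul_pow] at h
  linarith

theorem norm_exp_neg_mul (a : ℂ) (s : ℝ) :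
    ‖Complex.exp (-(a * s))‖ = Real.exp (-(a.re * s)) := by
  rw [Complex.norm_exp, Complex.neg_re, Complex.re_mul_ofReal]

theorem norm_exp_I_mul (k : ℂ) (X : ℝ) :
    ‖Complex.exp (I * k * X)‖ = Real.exp (-(X * k.im)) := by
  rw [Complex.norm_exp]
  congr 1
  rw [Complex.re_mul_ofReal]
  simp
  ring

namespace Params

variable (p : Params)

/-- The boundary vector `(q, r - ikθ q)`. -/
def boundaryVec (q r : ℝ → ℝ) (k : ℂ) (s : ℝ) : Fin 2 → ℂ :=
  ![(q s : ℂ), r s - I * k * p.θ * q s]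

/-- The contribution of the boundary values to the Fourier transform. -/
def boundaryInt (q r : ℝ → ℝ) (t : ℝ) (k : ℂ) : Fin 2 → ℂ :=
  ∫ s in (0 : ℝ)..t, (NormedSpace.exp (-((t : ℂ) - s) • p.Lam k)).mulVec (p.boundaryVec q r k s)

variable {p}

theorem continuousOn_boundaryVec {q r : ℝ → ℝ} {t : ℝ} (hq : ContinuousOn q (Icc 0 t))
    (hr : ContinuousOn r (Icc 0 t)) :
    ContinuousOn (fun z : ℂ × ℝ => p.boundaryVec q r z.1 z.2) (univ ×ˢ Icc 0 t) := by
  have h1 : ContinuousOn (fun z : ℂ × ℝ => (q z.2 : ℂ)) (univ ×ˢ Icc 0 t) :=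
    Complex.continuous_ofReal.comp_continuousOn (hq.comp continuousOn_snd fun z hz => hz.2)
  have h2 : ContinuousOn (fun z : ℂ × ℝ => (r z.2 : ℂ)) (univ ×ˢ Icc 0 t) :=
    Complex.continuous_ofReal.comp_continuousOn (hr.comp continuousOn_snd fun z hz => hz.2)
  refine continuousOn_pi.2 fun i => ?_
  fin_cases i
  · exact h1
  · have h3 : ContinuousOn (fun z : ℂ × ℝ => I * z.1 * p.θ) (univ ×ˢ Icc 0 t) := by fun_prop
    exact h2.sub (h3.mul h1)

theorem continuousOn_exp_mulVec {t : ℝ} {v : ℂ → ℝ → Fin 2 → ℂ}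
    (hv : ContinuousOn (fun z : ℂ × ℝ => v z.1 z.2) (univ ×ˢ Icc 0 t)) :
    ContinuousOn (fun z : ℂ × ℝ => (NormedSpace.exp (-((t : ℂ) - z.2) • p.Lam z.1)).mulVec
      (v z.1 z.2)) (univ ×ˢ Icc 0 t) := by
  have h : Continuous fun x : Matrix (Fin 2) (Fin 2) ℂ × (Fin 2 → ℂ) => x.1.mulVec x.2 :=
    continuous_fst.matrix_mulVec continuous_snd
  have h1 : Continuous fun z : ℂ × ℝ => NormedSpace.exp (-((t : ℂ) - z.2) • p.Lam z.1) := by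
    have h2 : Continuous fun z : ℂ × ℝ => -((t : ℂ) - z.2) := by fun_prop
    exact continuous_matrix_exp.comp (h2.smul (continuous_Lam.comp continuous_fst))
  exact h.comp_continuousOn (h1.continuousOn.prodMk hv)

/-- This is the gain from keeping the matrix exponential: the separate eigenvalue terms are branched
and singular where the roots meet, but the whole is entire and its contour can be moved freely. -/
theorem differentiable_boundaryInt {q r : ℝ → ℝ} {t : ℝ} (ht : 0 ≤ t)
    (hq : ContinuousOn q (Icc 0 t)) (hr : ContinuousOn r (Icc 0 t)) :
    Differentiable ℂ (p.boundaryInt q r t) := by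
  refine differentiable_intervalIntegral_param ht
    (continuousOn_exp_mulVec (continuousOn_boundaryVec hq hr)) fun s _ => ?_
  refine differentiable_pi.2 fun i => ?_
  have h1 (i j : Fin 2) : Differentiable ℂ fun k =>
      NormedSpace.exp (-((t : ℂ) - s) • p.Lam k) i j :=
    differentiable_exp_entry (A := fun k => -((t : ℂ) - s) • p.Lam k)
      (fun i j => (differentiable_Lam_entry i j).const_mul _) i j
  have h2 (j : Fin 2) : Differentiable ℂ fun k => p.boundaryVec q r k s j := by
    fin_cases j
    · exact differentiable_const _
    · have : Differentiable ℂ fun k : ℂ => (r s - I * k * p.θ * q s : ℂ) := by fun_prop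
      exact this
  exact (Differentiable.fun_sum (u := Finset.univ) fun j _ => (h1 i j).fun_mul (h2 j) :)

theorem β_pos (hp : p.Admissible) : 0 < p.β := div_pos hp.α_pos hp.τ_pos

theorem θ_pos (hp : p.Admissible) : 0 < p.θ := div_pos (pow_pos hp.μ_pos 2) hp.τ_pos

/-- For large `k` one root is bounded and the other is `θ k² + O(1)`. -/
theorem exists_pair (hp : p.Admissible) :
    ∃ k₀ B : ℝ, 1 ≤ k₀ ∧ 0 ≤ B ∧ ∀ k : ℂ, k₀ ≤ ‖k‖ → ∃ a b : ℂ, p.IsPair k a b ∧ ‖b‖ ≤ B ∧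
      ‖a - p.θ * k ^ 2‖ ≤ B ∧ p.θ / 2 * ‖k‖ ^ 2 ≤ ‖a - b‖ ∧ ‖a‖ ≤ (p.θ + B) * ‖k‖ ^ 2 := by
  have hβ := β_pos hp
  have hθ := θ_pos hp
  have hτ := hp.τ_pos
  -- For large `k` the root of larger modulus satisfies `|a| ≥ θ|k|²/4`, so `ab = β k²` gives `|b| ≤
  -- 4β/θ`; then `a - θk² = 1/τ - b` costs another `1/τ`.
  set B : ℝ := 4 * p.β / p.θ + 1 / p.τ with hB
  have hB0 : 0 < B := by positivity
  have hsum (k a b : ℂ) (h : a + b = 1 / p.τ + p.θ * k ^ 2) (hm : a * b = p.β * k ^ 2)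
      (hk1 : 1 ≤ ‖k‖) (hk2 : 2 / p.τ ≤ p.θ * ‖k‖ ^ 2) (hk3 : 4 * B ≤ p.θ * ‖k‖ ^ 2)
      (hab : ‖b‖ ≤ ‖a‖) :
      p.IsPair k a b ∧ ‖b‖ ≤ B ∧ ‖a - p.θ * k ^ 2‖ ≤ B ∧ p.θ / 2 * ‖k‖ ^ 2 ≤ ‖a - b‖ ∧
        ‖a‖ ≤ (p.θ + B) * ‖k‖ ^ 2 := by
    have hnθ : ‖(p.θ * k ^ 2 : ℂ)‖ = p.θ * ‖k‖ ^ 2 := by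
      rw [norm_mul, norm_pow, Complex.norm_real, Real.norm_eq_abs, abs_of_pos hθ]
    have hnτ : ‖(1 / p.τ : ℂ)‖ = 1 / p.τ := by
      rw [norm_div, norm_one, Complex.norm_real, Real.norm_eq_abs, abs_of_pos hτ]
    have hnm : ‖a‖ * ‖b‖ = p.β * ‖k‖ ^ 2 := by
      rw [← norm_mul, hm, norm_mul, norm_pow, Complex.norm_real, Real.norm_eq_abs, abs_of_pos hβ]
    have h1 : p.θ * ‖k‖ ^ 2 ≤ ‖a‖ + ‖b‖ + 1 / p.τ := by
      rw [← hnθ, ← hnτ]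
      have : (p.θ * k ^ 2 : ℂ) = a + b - 1 / p.τ := by rw [h]; ring
      rw [this]
      exact (norm_sub_le _ _).trans (add_le_add_left (norm_add_le _ _) _)
    have hk2' : 1 / p.τ ≤ p.θ * ‖k‖ ^ 2 / 2 := by
      have : 2 / p.τ = 2 * (1 / p.τ) := by ring
      linarith
    have h2 : p.θ * ‖k‖ ^ 2 / 4 ≤ ‖a‖ := by linarith
    have hk0 : 0 < ‖k‖ ^ 2 := by positivity
    have h3 : ‖b‖ ≤ 4 * p.β / p.θ := by
      rw [le_div_iff₀ hθ]
      refine le_of_mul_le_mul_right ?_ hk0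
      nlinarith [norm_nonneg b]
    have h4 : ‖b‖ ≤ B := h3.trans (by rw [hB]; linarith [one_div_pos.2 hτ])
    have h5 : ‖a - p.θ * k ^ 2‖ ≤ B := by
      have : a - p.θ * k ^ 2 = 1 / p.τ - b := by linear_combination h
      rw [this]
      refine (norm_sub_le _ _).trans ?_
      rw [hnτ, hB]; linarith
    have h6 : p.θ / 2 * ‖k‖ ^ 2 ≤ ‖a - b‖ := by
      have : (p.θ * k ^ 2 : ℂ) = (a - b) - (a - p.θ * k ^ 2) + b := by ring
      have h7 : ‖(p.θ * k ^ 2 : ℂ)‖ ≤ ‖a - b‖ + ‖a - p.θ * k ^ 2‖ + ‖b‖ := by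
        nth_rewrite 1 [this]
        exact (norm_add_le _ _).trans (add_le_add_left (norm_sub_le _ _) _)
      rw [hnθ] at h7
      linarith
    refine ⟨⟨h, hm, ?_, ?_⟩, h4, h5, h6, ?_⟩
    · rintro rfl
      rw [sub_self, norm_zero] at h6
      nlinarith
    · rintro rfl; simp at hk1; linarith
    · have : a = (a - p.θ * k ^ 2) + p.θ * k ^ 2 := by ring
      rw [this]
      refine (norm_add_le _ _).trans ?_
      rw [hnθ]
      have : 1 ≤ ‖k‖ ^ 2 := one_le_pow₀ hk1
      nlinarith
  refine ⟨1 + 2 / p.τ / p.θ + 4 * B / p.θ, B, ?_, hB0.le, fun k hk => ?_⟩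
  · have : 0 ≤ 2 / p.τ / p.θ := by positivity
    have : 0 ≤ 4 * B / p.θ := by positivity
    linarith
  · have e1 : 0 ≤ 2 / p.τ / p.θ := by positivity
    have e2 : 0 ≤ 4 * B / p.θ := by positivity
    have hk1 : 1 ≤ ‖k‖ := by linarith
    have hkk : ‖k‖ ≤ ‖k‖ ^ 2 := by nlinarith
    have hk2 : 2 / p.τ ≤ p.θ * ‖k‖ ^ 2 := by
      have : 2 / p.τ / p.θ ≤ ‖k‖ ^ 2 := by linarith
      rwa [div_le_iff₀ hθ, mul_comm] at this
    have hk3 : 4 * B ≤ p.θ * ‖k‖ ^ 2 := by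
      have : 4 * B / p.θ ≤ ‖k‖ ^ 2 := by linarith
      rw [div_le_iff₀ hθ] at this
      linarith
    have hs := ω_add hp k
    have hm := ω_mul hp k
    -- Which of `ω₁`, `ω₂` is the large root depends on the direction of `k`.
    rcases le_total ‖p.ω₂ k‖ ‖p.ω₁ k‖ with h | h
    · exact ⟨_, _, hsum k _ _ hs hm hk1 hk2 hk3 h⟩
    · exact ⟨_, _, hsum k _ _ (by rw [add_comm]; exact hs) (by rw [mul_comm]; exact hm)
        hk1 hk2 hk3 h⟩

/-- Vieta turns `θ k² - b` into `a - 1/τ`. Applied to the bounded root, this shows that the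
quadratic terms in `k` cancel and its coordinate grows only linearly. -/
theorem IsPair.coord_boundaryVec {k a b : ℂ} (h : p.IsPair k a b) (q r : ℝ → ℝ) (s : ℝ) :
    coord k b (p.boundaryVec q r k s) = (a - 1 / p.τ) * q s + I * k * r s := by
  have h1 : (a - 1 / p.τ : ℂ) = p.θ * k ^ 2 - b := by linear_combination h.add
  rw [h1, coord, boundaryVec]
  simp
  linear_combination (-(k ^ 2 * p.θ * q s)) * Complex.I_sq

theorem norm_eigenvector_le {k c : ℂ} {m : ℝ} (hk : 0 < ‖k‖) (hm : 1 ≤ m) (hc : ‖c‖ ≤ m * ‖k‖) :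
    ‖(![1, c / (I * k)] : Fin 2 → ℂ)‖ ≤ m := by
  refine (pi_norm_le_iff_of_nonneg (by linarith)).2 fun i => ?_
  fin_cases i
  · simpa using hm
  · simp only [Fin.mk_one, Matrix.cons_val_one, Matrix.cons_val_fin_one]
    rw [norm_div, norm_mul, Complex.norm_I, one_mul, div_le_iff₀ hk]
    exact hc

theorem norm_coord_boundaryVec_le {k a b : ℂ} (h : p.IsPair k a b) {q r : ℝ → ℝ} {s M₁ M₂ m : ℝ}
    (hq : |q s| ≤ M₁) (hr : |r s| ≤ M₂) (h1 : ‖a - 1 / p.τ‖ ≤ m) (h2 : ‖k‖ ≤ m) :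
    ‖coord k b (p.boundaryVec q r k s)‖ ≤ (M₁ + M₂) * m := by
  rw [h.coord_boundaryVec]
  refine (norm_add_le _ _).trans ?_
  rw [norm_mul, norm_mul (I * k), norm_mul I k, Complex.norm_I, one_mul, Complex.norm_real,
    Complex.norm_real, Real.norm_eq_abs, Real.norm_eq_abs]
  have hm : 0 ≤ m := (norm_nonneg k).trans h2
  calc ‖a - 1 / p.τ‖ * |q s| + ‖k‖ * |r s| ≤ m * M₁ + m * M₂ := by gcongr
    _ = _ := by ring

/-- Pointwise bound of the integrand of `boundaryInt`. -/
theorem exists_norm_boundary_le (hp : p.Admissible) {q r : ℝ → ℝ} {t : ℝ}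
    (hq : ContinuousOn q (Icc 0 t)) (hr : ContinuousOn r (Icc 0 t)) (ht : 0 ≤ t) :
    ∃ k₀ B C : ℝ, 1 ≤ k₀ ∧ 0 ≤ B ∧ 0 ≤ C ∧ ∀ k : ℂ, k₀ ≤ ‖k‖ → ∃ ρ : ℝ,
      p.θ * (k ^ 2).re - B ≤ ρ ∧ ∀ s ∈ Icc 0 t,
      ‖(NormedSpace.exp (-((t : ℂ) - s) • p.Lam k)).mulVec (p.boundaryVec q r k s)‖
        ≤ C * (‖k‖ * Real.exp (-(ρ * (t - s))) + 1 / ‖k‖) := by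
  obtain ⟨k₀, B, hk₀, hB, hpair⟩ := exists_pair hp
  obtain ⟨M₁, hM₁⟩ := isCompact_Icc.exists_bound_of_continuousOn hq
  obtain ⟨M₂, hM₂⟩ := isCompact_Icc.exists_bound_of_continuousOn hr
  have hθ := θ_pos hp
  have hτ := hp.τ_pos
  have h0 : (0 : ℝ) ∈ Icc 0 t := ⟨le_rfl, ht⟩
  set M := M₁ + M₂ with hM
  have hM1 : 0 ≤ M₁ := (norm_nonneg _).trans (hM₁ 0 h0)
  have hM2 : 0 ≤ M₂ := (norm_nonneg _).trans (hM₂ 0 h0)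
  set A := p.θ + B with hA
  set D := A + 1 / p.τ + 1 with hD
  have hA0 : 0 < A := by positivity
  have hD0 : 0 < D := by positivity
  -- For the large root the coordinate is of order `|k|²` and the eigenvector of order `|k|`; for
  -- the bounded root the orders are `|k|` and 1. Division by `|a - b| ≥ θ|k|²/2` produces the two
  -- terms of the bound, with `ρ = Re a`.
  set C := 2 / p.θ * (M * D * (1 + A) + Real.exp (B * t) * (1 + B) * (M * (B + 1 / p.τ + 1)))
    with hC
  refine ⟨k₀, B, C, hk₀, hB, by positivity, fun k hk => ?_⟩
  obtain ⟨a, b, hab, hb, ha, hd, ha2⟩ := hpair k hk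
  have hk1 : 1 ≤ ‖k‖ := hk₀.trans hk
  have hk0 : 0 < ‖k‖ := by linarith
  have hkk : ‖k‖ ≤ ‖k‖ ^ 2 := by nlinarith
  have hk2 : 1 ≤ ‖k‖ ^ 2 := by linarith
  have hnτ : ‖(1 / p.τ : ℂ)‖ = 1 / p.τ := by
    rw [norm_div, norm_one, Complex.norm_real, Real.norm_eq_abs, abs_of_pos hτ]
  refine ⟨a.re, ?_, fun s hs => ?_⟩
  · have h1 := (Complex.abs_re_le_norm _).trans ha
    have h2 : (a - p.θ * k ^ 2 : ℂ).re = a.re - p.θ * (k ^ 2).re := by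
      rw [Complex.sub_re, Complex.re_ofReal_mul]
    rw [h2] at h1
    linarith [(abs_le.1 h1).1]
  · have hq' := hM₁ s hs
    have hr' := hM₂ s hs
    rw [Real.norm_eq_abs] at hq' hr'
    have hτ1 : 0 < 1 / p.τ := one_div_pos.2 hτ
    have hca : ‖coord k b (p.boundaryVec q r k s)‖ ≤ M * (D * ‖k‖ ^ 2) := by
      refine norm_coord_boundaryVec_le hab hq' hr' ?_ ?_
      · refine (norm_sub_le _ _).trans ?_
        rw [hnτ, hD]
        have : 1 / p.τ ≤ 1 / p.τ * ‖k‖ ^ 2 := le_mul_of_one_le_right hτ1.le hk2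
        linarith
      · refine hkk.trans (le_mul_of_one_le_left (by positivity) ?_)
        rw [hD]; linarith
    have hcb : ‖coord k a (p.boundaryVec q r k s)‖ ≤ M * ((B + 1 / p.τ + 1) * ‖k‖) := by
      refine norm_coord_boundaryVec_le hab.symm hq' hr' ?_ ?_
      · refine (norm_sub_le _ _).trans ?_
        rw [hnτ]
        have : B + 1 / p.τ + 1 ≤ (B + 1 / p.τ + 1) * ‖k‖ :=
          le_mul_of_one_le_right (by positivity) hk1
        linarith
      · refine le_mul_of_one_le_left hk0.le ?_
        linarith
    have hva : ‖(![1, a / (I * k)] : Fin 2 → ℂ)‖ ≤ (1 + A) * ‖k‖ := by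
      refine norm_eigenvector_le hk0 ?_ ?_
      · have : 1 + A ≤ (1 + A) * ‖k‖ := le_mul_of_one_le_right (by positivity) hk1
        linarith
      · refine ha2.trans ?_
        have : 0 ≤ ‖k‖ ^ 2 := by positivity
        calc A * ‖k‖ ^ 2 ≤ (1 + A) * ‖k‖ ^ 2 := by gcongr; linarith
          _ = _ := by ring
    have hvb : ‖(![1, b / (I * k)] : Fin 2 → ℂ)‖ ≤ 1 + B := by
      refine norm_eigenvector_le hk0 (by linarith) (hb.trans ?_)
      have : 1 + B ≤ (1 + B) * ‖k‖ := le_mul_of_one_le_right (by positivity) hk1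
      linarith
    have hts : 0 ≤ t - s := by linarith [hs.2]
    have ets : ((t : ℂ) - s) = ((t - s : ℝ) : ℂ) := by push_cast; rfl
    have hea : ‖Complex.exp (-(a * ((t : ℂ) - s)))‖ = Real.exp (-(a.re * (t - s))) := by
      rw [ets, norm_exp_neg_mul]
    have heb : ‖Complex.exp (-(b * ((t : ℂ) - s)))‖ ≤ Real.exp (B * t) := by
      rw [ets, norm_exp_neg_mul]
      refine Real.exp_le_exp.2 ?_
      have h1 : -b.re ≤ B := (neg_le_abs _).trans ((Complex.abs_re_le_norm b).trans hb)
      have h2 : t - s ≤ t := by linarith [hs.1]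
      calc -(b.re * (t - s)) = -b.re * (t - s) := by ring
        _ ≤ B * (t - s) := by gcongr
        _ ≤ B * t := by gcongr
    rw [hab.exp_mulVec, norm_smul, norm_div, norm_one]
    have hd0 : 0 < p.θ / 2 * ‖k‖ ^ 2 := by positivity
    set e := Real.exp (-(a.re * (t - s))) with he
    have he0 : 0 < e := Real.exp_pos _
    have hmain : ‖Complex.exp (-(a * ((t : ℂ) - s))) • coord k b (p.boundaryVec q r k s) •
          ![1, a / (I * k)] - Complex.exp (-(b * ((t : ℂ) - s))) •
          coord k a (p.boundaryVec q r k s) • ![1, b / (I * k)]‖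
        ≤ e * (M * (D * ‖k‖ ^ 2) * ((1 + A) * ‖k‖))
          + Real.exp (B * t) * (M * ((B + 1 / p.τ + 1) * ‖k‖) * (1 + B)) := by
      refine (norm_sub_le _ _).trans (add_le_add ?_ ?_)
      · rw [norm_smul, norm_smul, hea]; gcongr
      · rw [norm_smul, norm_smul]; gcongr
    calc 1 / ‖a - b‖ * _ ≤ 1 / (p.θ / 2 * ‖k‖ ^ 2) *
          (e * (M * (D * ‖k‖ ^ 2) * ((1 + A) * ‖k‖))
          + Real.exp (B * t) * (M * ((B + 1 / p.τ + 1) * ‖k‖) * (1 + B))) := by gcongr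
      _ = 2 / p.θ * (M * D * (1 + A)) * (‖k‖ * e)
          + 2 / p.θ * (Real.exp (B * t) * (1 + B) * (M * (B + 1 / p.τ + 1))) * (1 / ‖k‖) := by
        field_simp
      _ ≤ C * (‖k‖ * e) + C * (1 / ‖k‖) := by
        have h1 : 0 ≤ M * D * (1 + A) := by positivity
        have h2 : 0 ≤ Real.exp (B * t) * (1 + B) * (M * (B + 1 / p.τ + 1)) := by positivity
        gcongr
        · rw [hC]; gcongr; linarith
        · rw [hC]; gcongr; linarith
      _ = _ := by ring

theorem integral_exp_le_inv {ρ t : ℝ} (hρ : 0 < ρ) :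
    ∫ s in (0 : ℝ)..t, Real.exp (-(ρ * (t - s))) ≤ 1 / ρ := by
  have h (s : ℝ) : HasDerivAt (fun s => Real.exp (-(ρ * (t - s))) / ρ)
      (Real.exp (-(ρ * (t - s)))) s := by
    have h1 : HasDerivAt (fun s : ℝ => -(ρ * (t - s))) ρ s := by
      simpa using (((hasDerivAt_id s).const_sub t).const_mul ρ).fun_neg
    simpa [hρ.ne'] using h1.exp.div_const ρ
  rw [intervalIntegral.integral_eq_sub_of_hasDerivAt (fun s _ => h s)
    ((by fun_prop : Continuous fun s : ℝ => Real.exp (-(ρ * (t - s)))).intervalIntegrable _ _)]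
  have : 0 ≤ Real.exp (-(ρ * (t - 0))) / ρ := by positivity
  simp only [sub_self, mul_zero, neg_zero, Real.exp_zero]
  linarith

/-- Two regimes. Below the hyperbola the real part of the large root is bounded from below, and its
exponential stays bounded. Near the real axis that real part is at least of order `|k|²`, and the
integration over time gains this factor; here `e^{ikX}` would give no decay. -/
theorem exists_norm_boundaryInt_le (hp : p.Admissible) {q r : ℝ → ℝ} {t : ℝ}
    (hq : ContinuousOn q (Icc 0 t)) (hr : ContinuousOn r (Icc 0 t)) (ht : 0 ≤ t) :
    ∃ k₁ C : ℝ, 1 ≤ k₁ ∧ 0 ≤ C ∧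
      (∀ k : ℂ, k₁ ≤ ‖k‖ → -(1 / p.μ ^ 2) ≤ (k ^ 2).re → ‖p.boundaryInt q r t k‖ ≤ C * ‖k‖) ∧
      ∀ k : ℂ, k₁ ≤ ‖k‖ → ‖k‖ ^ 2 / 2 ≤ (k ^ 2).re → ‖p.boundaryInt q r t k‖ ≤ C / ‖k‖ := by
  obtain ⟨k₀, B, C, hk₀, hB, hC, h⟩ := exists_norm_boundary_le hp hq hr ht
  have hθ := θ_pos hp
  have hμ := hp.μ_pos
  set ρ₀ : ℝ := p.θ * (1 / p.μ ^ 2) + B with hρ₀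
  have hρ0 : 0 ≤ ρ₀ := by positivity
  have key (k : ℂ) (ρ : ℝ) (hs : ∀ s ∈ Icc 0 t,
      ‖(NormedSpace.exp (-((t : ℂ) - s) • p.Lam k)).mulVec (p.boundaryVec q r k s)‖
        ≤ C * (‖k‖ * Real.exp (-(ρ * (t - s))) + 1 / ‖k‖)) :
      ‖p.boundaryInt q r t k‖
        ≤ C * (‖k‖ * (∫ s in (0 : ℝ)..t, Real.exp (-(ρ * (t - s)))) + t / ‖k‖) := by
    have hc : Continuous fun s : ℝ => Real.exp (-(ρ * (t - s))) := by fun_prop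
    refine (intervalIntegral.norm_integral_le_of_norm_le ht
      (ae_of_all _ fun s h => hs s (Ioc_subset_Icc_self h))
      ((by fun_prop : Continuous fun s : ℝ =>
        C * (‖k‖ * Real.exp (-(ρ * (t - s))) + 1 / ‖k‖)).intervalIntegrable _ _)).trans_eq ?_
    rw [intervalIntegral.integral_const_mul, intervalIntegral.integral_add
      ((hc.const_mul _).intervalIntegrable _ _) (by simp), intervalIntegral.integral_const_mul,
      intervalIntegral.integral_const]
    simp
    left; ring
  set k₁ := k₀ + 4 * B / p.θ + 1 with hk₁
  have e1 : 0 ≤ 4 * B / p.θ := by positivity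
  refine ⟨k₁, C * (t * Real.exp (ρ₀ * t) + t + 4 / p.θ), by linarith, by positivity,
    fun k hk hre => ?_, fun k hk hre => ?_⟩
  · obtain ⟨ρ, hρ, hs⟩ := h k (by linarith)
    have hk1 : 1 ≤ ‖k‖ := by linarith
    have h1 : -ρ₀ ≤ ρ := by
      have := mul_le_mul_of_nonneg_left hre hθ.le
      rw [hρ₀]; linarith
    have h2 : ∫ s in (0 : ℝ)..t, Real.exp (-(ρ * (t - s))) ≤ t * Real.exp (ρ₀ * t) := by
      have : ∫ s in (0 : ℝ)..t, Real.exp (-(ρ * (t - s)))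
          ≤ ∫ _ in (0 : ℝ)..t, Real.exp (ρ₀ * t) := by
        refine intervalIntegral.integral_mono_on ht
          ((by fun_prop : Continuous fun s : ℝ => Real.exp (-(ρ * (t - s)))).intervalIntegrable _ _)
          (by simp) fun s hs => Real.exp_le_exp.2 ?_
        have h3 : 0 ≤ t - s := by linarith [hs.2]
        have h4 : t - s ≤ t := by linarith [hs.1]
        calc -(ρ * (t - s)) = -ρ * (t - s) := by ring
          _ ≤ ρ₀ * (t - s) := by gcongr; linarith
          _ ≤ ρ₀ * t := by gcongr
      simpa using this
    refine (key k ρ hs).trans ?_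
    rw [mul_assoc]
    gcongr
    have h3 : t / ‖k‖ ≤ t * ‖k‖ := by
      rw [div_le_iff₀ (by linarith), mul_assoc]
      exact le_mul_of_one_le_right ht (by nlinarith)
    have h4 : 0 ≤ 4 / p.θ * ‖k‖ := by positivity
    have h5 := mul_le_mul_of_nonneg_left h2 (norm_nonneg k)
    linarith
  · obtain ⟨ρ, hρ, hs⟩ := h k (by linarith)
    have hk1 : 1 ≤ ‖k‖ := by linarith
    have hk0 : 0 < ‖k‖ := by linarith
    have h0 : B ≤ p.θ * ‖k‖ ^ 2 / 4 := by
      have h3 : 4 * B / p.θ ≤ ‖k‖ ^ 2 := by nlinarith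
      rw [div_le_iff₀ hθ] at h3
      linarith
    have h1 : p.θ * ‖k‖ ^ 2 / 4 ≤ ρ := by
      have := mul_le_mul_of_nonneg_left hre hθ.le
      linarith
    have hρp : 0 < ρ := lt_of_lt_of_le (by positivity) h1
    have h2 : ∫ s in (0 : ℝ)..t, Real.exp (-(ρ * (t - s))) ≤ 4 / p.θ / ‖k‖ ^ 2 := by
      refine (integral_exp_le_inv hρp).trans ((one_div_le_one_div_of_le (by positivity) h1).trans_eq ?_)
      field_simp
    refine (key k ρ hs).trans ?_
    rw [mul_div_assoc]
    gcongr
    have h3 := mul_le_mul_of_nonneg_left h2 hk0.le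
    have h4 : ‖k‖ * (4 / p.θ / ‖k‖ ^ 2) = 4 / p.θ / ‖k‖ := by field_simp
    have h5 : 0 ≤ t * Real.exp (ρ₀ * t) / ‖k‖ := by positivity
    rw [add_div, add_div]
    linarith

/-- Terms with moderate growth can be moved from the real line to `∂D₀⁺`. -/
theorem IsCorner.tendsto_integral_of_bound (hp : p.Admissible) {R ν₀ y₀ : ℝ}
    (hc : p.IsCorner R ν₀ y₀) {E : ℂ → Fin 2 → ℂ} (hE : Differentiable ℂ E) {k₁ C : ℝ}
    (hk₁ : 1 ≤ k₁) (hC : 0 ≤ C)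
    (h1 : ∀ k : ℂ, k₁ ≤ ‖k‖ → -(1 / p.μ ^ 2) ≤ (k ^ 2).re → ‖E k‖ ≤ C * ‖k‖)
    (h2 : ∀ k : ℂ, k₁ ≤ ‖k‖ → ‖k‖ ^ 2 / 2 ≤ (k ^ 2).re → ‖E k‖ ≤ C / ‖k‖) {X : ℝ} (hX : 0 < X) :
    p.IntegrableUpper R (fun k => Complex.exp (I * k * X) • E k) ∧
      Tendsto (fun z : ℝ × ℝ => ∫ k in z.1..z.2, Complex.exp (I * (k : ℝ) * X) • E (k : ℝ))
        (atBot ×ˢ atTop) (𝓝 (p.integralUpper R fun k => Complex.exp (I * k * X) • E k)) := by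
  obtain ⟨c, hc0, him⟩ := exists_le_im_K hp
  have hμ := hp.μ_pos
  have hnorm (k : ℂ) : ‖Complex.exp (I * k * X) • E k‖
      = Real.exp (-(X * k.im)) * ‖E k‖ := by
    rw [norm_smul, norm_exp_I_mul]
  set m : ℝ := 1 / (p.α + p.μ ^ 2 / p.τ) with hm
  have hm0 : 0 < m := by
    have := hp.α_pos; have := hp.τ_pos; positivity
  -- On the curve five powers of `|κ|` are used: one against the growth of `E` and four to dominate
  -- `ν²`. In `T` three powers of `η` are used: one for `|k| ≤ 3η`, and two for `1/ξ²`, where `η >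
  -- |ξ|/2` costs the factor 4.
  set Q : ℝ := C * ((Nat.factorial 5 : ℝ) / (X * c) ^ 5) / m ^ 2 with hQ
  set T : ℝ := 3 * C * ((Nat.factorial 3 : ℝ) / X ^ 3) * 4 with hT
  have hQ0 : 0 ≤ Q := by positivity
  have hT0 : 0 ≤ T := by positivity
  refine hc.tendsto_integral hp (G := fun k => Complex.exp (I * k * X) • E k)
    ?_ hX (C := Q + T + C) (N := k₁ ^ 2 / m) (B₀ := k₁) (by positivity) ?_ ?_
  · have h3 : Differentiable ℂ fun k : ℂ => Complex.exp (I * k * X) := by fun_prop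
    exact h3.smul hE
  · intro ν hν
    have hk : m * |ν| ≤ ‖p.κ ν‖ ^ 2 := le_norm_κ_sq hp ν
    have hk' : k₁ ^ 2 ≤ ‖p.κ ν‖ ^ 2 := by
      rw [div_le_iff₀ hm0] at hν
      linarith
    have hk1 : k₁ ≤ ‖p.κ ν‖ := le_of_sq_le_sq hk' (norm_nonneg _)
    have hk0 : 0 < ‖p.κ ν‖ := by linarith
    have hν0 : 0 < |ν| := lt_of_lt_of_le (by positivity) hν
    have h3 := h1 _ hk1 (by rw [κ_sq]; exact neg_le_re_kSq hp ν)
    have h4 : c * ‖p.κ ν‖ ≤ (p.κ ν).im := by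
      rw [κ_eq]
      exact him _ (by simp)
    rw [hnorm]
    have h5 := pow_mul_exp_neg_le 5 (mul_pos hX hc0) hk0.le
    have h6 : Real.exp (-(X * (p.κ ν).im)) ≤ Real.exp (-(X * c * ‖p.κ ν‖)) := by
      refine Real.exp_le_exp.2 (neg_le_neg ?_)
      rw [mul_assoc]; gcongr
    have h7 : (m * |ν|) ^ 2 ≤ ‖p.κ ν‖ ^ 4 := by
      calc (m * |ν|) ^ 2 ≤ (‖p.κ ν‖ ^ 2) ^ 2 := by gcongr
        _ = _ := by ring
    calc Real.exp (-(X * (p.κ ν).im)) * ‖E (p.κ ν)‖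
        ≤ Real.exp (-(X * c * ‖p.κ ν‖)) * (C * ‖p.κ ν‖) := by gcongr
      _ = C * (‖p.κ ν‖ ^ 5 * Real.exp (-(X * c * ‖p.κ ν‖))) / ‖p.κ ν‖ ^ 4 := by field_simp
      _ ≤ C * ((Nat.factorial 5 : ℝ) / (X * c) ^ 5) / (m * |ν|) ^ 2 := by gcongr
      _ = Q / ν ^ 2 := by rw [hQ, mul_pow m, sq_abs, div_div]
      _ ≤ _ := by gcongr; linarith
  · intro ξ η hξ hη hle
    set k : ℂ := ξ + η * I with hk
    have hkre : k.re = ξ := by simp [hk]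
    have hkim : k.im = η := by simp [hk]
    have hsq : ‖k‖ ^ 2 = ξ ^ 2 + η ^ 2 := by
      rw [← Complex.normSq_eq_norm_sq, Complex.normSq_apply, hkre, hkim]; ring
    have hre : (k ^ 2).re = ξ ^ 2 - η ^ 2 := by
      rw [sq, Complex.mul_re, hkre, hkim]; ring
    have hξk : |ξ| ≤ ‖k‖ := by rw [← hkre]; exact Complex.abs_re_le_norm k
    have hξ0 : 0 < |ξ| := by linarith
    rw [hnorm, hkim]
    have hξ2 : |ξ| ^ 2 = ξ ^ 2 := sq_abs ξ
    -- Below slope 1/2 one has `Re k² ≥ |k|²/2` and the decay of `E` suffices; above it the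
    -- exponential does the work.
    rcases le_or_gt η (|ξ| / 2) with hη2 | hη2
    · have h3 := h2 k (by linarith) (by rw [hsq, hre]; nlinarith)
      have h4 : C / ‖k‖ ≤ C / |ξ| := by gcongr
      have h5 : C / |ξ| ≤ (Q + T + C) / |ξ| := by gcongr; linarith
      have h6 : 0 ≤ (Q + T + C) / ξ ^ 2 := by positivity
      calc Real.exp (-(X * η)) * ‖E k‖
          ≤ Real.exp (-(X * η)) * ((Q + T + C) / |ξ|) := by gcongr; linarith
        _ ≤ _ := by linarith
    · have h3 := h1 k (by linarith) (by rw [hre]; linarith)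
      have hη0 : 0 < η := by linarith
      have h4 : ‖k‖ ≤ 3 * η := by
        refine (Complex.norm_le_abs_re_add_abs_im k).trans ?_
        rw [hkre, hkim, abs_of_pos hη0]; linarith
      have h5 := pow_mul_exp_neg_le 3 hX hη
      have h6 : ξ ^ 2 / 4 ≤ η ^ 2 := by rw [← hξ2]; nlinarith
      have hξ3 : 0 < ξ ^ 2 := by rw [← hξ2]; positivity
      have h7 : 0 ≤ (Q + T + C) / |ξ| * Real.exp (-(X * η)) := by positivity
      calc Real.exp (-(X * η)) * ‖E k‖
          ≤ Real.exp (-(X * η)) * (C * (3 * η)) := by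
            gcongr; exact h3.trans (by gcongr)
        _ = 3 * C * (η ^ 3 * Real.exp (-(X * η))) / η ^ 2 := by field_simp
        _ ≤ 3 * C * ((Nat.factorial 3 : ℝ) / X ^ 3) / (ξ ^ 2 / 4) := by gcongr
        _ = T / ξ ^ 2 := by rw [hT]; field_simp
        _ ≤ (Q + T + C) / ξ ^ 2 := by gcongr; linarith
        _ ≤ _ := by linarith

end Params

end GK

namespace GK

/-! ### The Fourier transform of a solution -/

theorem hat_derivWithin {l : ℝ} (hl : 0 < l) {y : ℝ → ℝ} (hy : DifferentiableOn ℝ y (Icc 0 l))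
    (hy' : ContinuousOn (derivWithin y (Icc 0 l)) (Icc 0 l)) (k : ℂ) :
    hat l (derivWithin y (Icc 0 l)) k
      = Complex.exp (-(I * k * l)) * y l - y 0 + I * k * hat l y k := by
  have hexp (x : ℝ) : HasDerivAt (fun x : ℝ => Complex.exp (-(I * k * x)))
      (Complex.exp (-(I * k * x)) * -(I * k)) x := by
    have h1 : HasDerivAt (fun x : ℝ => -(I * k * x)) (-(I * k)) x := by
      simpa using ((Complex.ofRealCLM.hasDerivAt (x := x)).const_mul (I * k)).fun_neg
    exact h1.cexp
  have hce : Continuous fun x : ℝ => Complex.exp (-(I * k * x)) := by fun_prop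
  have hcy : ContinuousOn (fun x => (y x : ℂ)) (Icc 0 l) :=
    Complex.continuous_ofReal.comp_continuousOn hy.continuousOn
  have hcy' : ContinuousOn (fun x => ((derivWithin y (Icc 0 l) x : ℝ) : ℂ)) (Icc 0 l) :=
    Complex.continuous_ofReal.comp_continuousOn hy'
  have h1 : IntervalIntegrable (fun x : ℝ => Complex.exp (-(I * k * x)) * (derivWithin y (Icc 0 l) x : ℝ))
      volume 0 l := (hce.continuousOn.mul hcy').intervalIntegrable_of_Icc hl.le
  have h2 : IntervalIntegrable (fun x : ℝ => Complex.exp (-(I * k * x)) * y x) volume 0 l :=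
    (hce.continuousOn.mul hcy).intervalIntegrable_of_Icc hl.le
  have h := intervalIntegral.integral_eq_sub_of_hasDerivAt_of_le hl.le
    (f := fun x : ℝ => Complex.exp (-(I * k * x)) * y x)
    (f' := fun x : ℝ => Complex.exp (-(I * k * x)) * (derivWithin y (Icc 0 l) x : ℝ)
      - I * k * (Complex.exp (-(I * k * x)) * y x)) (hce.continuousOn.mul hcy) (fun x hx => ?_)
    (h1.sub (h2.const_mul _))
  · rw [intervalIntegral.integral_sub h1 (h2.const_mul _), intervalIntegral.integral_const_mul] at h
    simp only [Complex.ofReal_zero, mul_zero, neg_zero, Complex.exp_zero, one_mul] at h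
    rw [hat, hat]
    linear_combination h
  · have h3 : HasDerivAt y (derivWithin y (Icc 0 l) x) x := by
      have h4 := (hy x (Ioo_subset_Icc_self hx)).hasDerivWithinAt
      exact h4.hasDerivAt (Icc_mem_nhds hx.1 hx.2)
    refine ((hexp x).mul h3.ofReal_comp).congr_deriv ?_
    ring

theorem continuousOn_hat {l : ℝ} (hl : 0 < l) {u : ℝ → ℝ → ℝ}
    (hu : ContinuousOn (fun z : ℝ × ℝ => u z.1 z.2) (Icc 0 l ×ˢ Ici 0)) :
    ContinuousOn (fun z : ℂ × ℝ => hat l (fun x => u x z.2) z.1) (univ ×ˢ Ici 0) := by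
  have h : Continuous fun z : ℂ × ℝ => hat l (fun x => u x (max 0 z.2)) z.1 := by
    refine continuous_intervalIntegral_param hl.le ?_
    refine ContinuousOn.mul (by fun_prop) (Complex.continuous_ofReal.comp_continuousOn ?_)
    have h1 : ContinuousOn (fun w : (ℂ × ℝ) × ℝ => ((w.2, max 0 w.1.2) : ℝ × ℝ))
        (univ ×ˢ Icc 0 l) := by fun_prop
    exact hu.comp h1 fun w hw => ⟨hw.2, mem_Ici.2 (le_max_left _ _)⟩
  refine h.continuousOn.congr fun z hz => ?_
  simp only [max_eq_right (mem_Ici.1 hz.2)]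

theorem differentiable_hat {l : ℝ} (hl : 0 < l) {y : ℝ → ℝ} (hy : ContinuousOn y (Icc 0 l)) :
    Differentiable ℂ (hat l y) := by
  refine differentiable_intervalIntegral_param hl.le ?_ fun x _ => ?_
  · exact ContinuousOn.mul (by fun_prop) (Complex.continuous_ofReal.comp_continuousOn
      (hy.comp continuousOn_snd fun z hz => hz.2))
  · fun_prop

theorem HasContDt.hasDerivAt {l : ℝ} {u : ℝ → ℝ → ℝ} (h : HasContDt l u) {x s : ℝ}
    (hx : x ∈ Icc 0 l) (hs : 0 < s) : HasDerivAt (fun s => u x s) (dt u x s) s :=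
  ((h.1 x hx) s hs.le).hasDerivWithinAt.hasDerivAt (Ici_mem_nhds hs)

/-- Joint continuity follows from continuity in `x` at one fixed time and a Lipschitz bound in time
that is uniform in `x`, the time derivative being bounded on compact sets. -/
theorem HasContDt.continuousOn {l : ℝ} {u : ℝ → ℝ → ℝ} (h : HasContDt l u) (h' : HasContDx l u) :
    ContinuousOn (fun z : ℝ × ℝ => u z.1 z.2) (Icc 0 l ×ˢ Ici 0) := by
  rintro ⟨x₀, s₀⟩ ⟨hx₀, hs₀⟩
  have hsub : Icc 0 l ×ˢ Icc 0 (s₀ + 1) ⊆ Icc 0 l ×ˢ Ici (0 : ℝ) :=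
    prod_mono le_rfl fun s hs => hs.1
  obtain ⟨M, hM⟩ := (isCompact_Icc.prod isCompact_Icc).exists_bound_of_continuousOn (h.2.mono hsub)
  have hlip : ∀ x ∈ Icc 0 l, ∀ s ∈ Icc 0 (s₀ + 1), ‖u x s - u x s₀‖ ≤ M * ‖s - s₀‖ := by
    intro x hx s hs
    refine (convex_Icc (0 : ℝ) (s₀ + 1)).norm_image_sub_le_of_norm_hasDerivWithin_le
      (f := fun s => u x s) (f' := fun s => dt u x s)
      (fun r hr => ((h.1 x hx r hr.1).hasDerivWithinAt.mono fun y hy => hy.1))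
      (fun r hr => hM (x, r) ⟨hx, hr⟩) ⟨hs₀, by simp⟩ hs
  have hc : ContinuousWithinAt (fun z : ℝ × ℝ => u z.1 s₀) (Icc 0 l ×ˢ Ici 0) (x₀, s₀) :=
    ContinuousWithinAt.comp (g := fun x => u x s₀) (f := Prod.fst) (t := Icc 0 l)
      ((h'.1 s₀ hs₀).continuousOn x₀ hx₀) continuousWithinAt_fst fun z hz => hz.1
  have h0 : Tendsto (fun z : ℝ × ℝ => u z.1 z.2 - u z.1 s₀)
      (𝓝[Icc 0 l ×ˢ Ici 0] (x₀, s₀)) (𝓝 0) := by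
    refine squeeze_zero_norm' (a := fun z : ℝ × ℝ => M * ‖z.2 - s₀‖) ?_ ?_
    · have h1 : ∀ᶠ z : ℝ × ℝ in 𝓝[Icc 0 l ×ˢ Ici 0] (x₀, s₀), z.2 < s₀ + 1 :=
        (continuousWithinAt_snd (s := Icc 0 l ×ˢ Ici (0 : ℝ)) (p := (x₀, s₀))).eventually
          (gt_mem_nhds (by simp))
      filter_upwards [h1, self_mem_nhdsWithin] with z hz1 hz2
      exact hlip z.1 hz2.1 z.2 ⟨hz2.2, hz1.le⟩
    · have h2 : Continuous fun z : ℝ × ℝ => M * ‖z.2 - s₀‖ := by fun_prop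
      have h3 := (h2.tendsto (x₀, s₀)).mono_left (nhdsWithin_le_nhds (s := Icc 0 l ×ˢ Ici (0 : ℝ)))
      simpa using h3
  have h4 := h0.add hc
  simp only [sub_add_cancel, zero_add] at h4
  exact h4

theorem continuousOn_slice_left {l : ℝ} {u : ℝ → ℝ → ℝ}
    (hu : ContinuousOn (fun z : ℝ × ℝ => u z.1 z.2) (Icc 0 l ×ˢ Ici 0)) {s : ℝ} (hs : 0 ≤ s) :
    ContinuousOn (fun x => u x s) (Icc 0 l) :=
  hu.comp (f := fun x => (x, s)) (by fun_prop) fun _ hx => ⟨hx, hs⟩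

theorem continuousOn_slice_right {l : ℝ} {u : ℝ → ℝ → ℝ}
    (hu : ContinuousOn (fun z : ℝ × ℝ => u z.1 z.2) (Icc 0 l ×ˢ Ici 0)) {x : ℝ}
    (hx : x ∈ Icc 0 l) : ContinuousOn (fun s => u x s) (Ici 0) :=
  hu.comp (f := fun s => (x, s)) (by fun_prop) fun _ hs => ⟨hx, hs⟩

theorem HasContDt.hasDerivAt_hat {l : ℝ} (hl : 0 < l) {u : ℝ → ℝ → ℝ} (h : HasContDt l u)
    (hu : ContinuousOn (fun z : ℝ × ℝ => u z.1 z.2) (Icc 0 l ×ˢ Ici 0)) (k : ℂ) {s : ℝ}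
    (hs : 0 < s) :
    HasDerivAt (fun s => hat l (fun x => u x s) k) (hat l (fun x => dt u x s) k) s := by
  have hce : Continuous fun x : ℝ => Complex.exp (-(I * k * x)) := by fun_prop
  have hint {v : ℝ → ℝ → ℝ} (hv : ContinuousOn (fun z : ℝ × ℝ => v z.1 z.2) (Icc 0 l ×ˢ Ici 0))
      {r : ℝ} (hr : 0 ≤ r) : IntervalIntegrable
        (fun x : ℝ => Complex.exp (-(I * k * x)) * v x r) volume 0 l :=
    (hce.continuousOn.mul (Complex.continuous_ofReal.comp_continuousOn
      (continuousOn_slice_left hv hr))).intervalIntegrable_of_Icc hl.le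
  have hc : ContinuousOn (fun z : ℝ × ℝ => Complex.exp (-(I * k * z.1)) * (dt u z.1 z.2 : ℂ))
      (Icc 0 l ×ˢ Icc 0 (s + 1)) := by
    refine ContinuousOn.mul (by fun_prop) (Complex.continuous_ofReal.comp_continuousOn
      (h.2.mono (prod_mono le_rfl fun r hr => hr.1)))
  obtain ⟨M, hM⟩ := (isCompact_Icc.prod isCompact_Icc).exists_bound_of_continuousOn hc
  have hnhds : Ioo 0 (s + 1) ∈ 𝓝 s := Ioo_mem_nhds hs (by simp)
  refine (intervalIntegral.hasDerivAt_integral_of_dominated_loc_of_deriv_le (μ := volume)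
    (F := fun r x => Complex.exp (-(I * k * x)) * (u x r : ℂ))
    (F' := fun r x => Complex.exp (-(I * k * x)) * (dt u x r : ℂ)) (bound := fun _ => M)
    hnhds ?_ (hint hu hs.le) (hint h.2 hs.le).def'.aestronglyMeasurable ?_ (by simp) ?_).2
  · filter_upwards [hnhds] with r hr
    exact (hint hu hr.1.le).def'.aestronglyMeasurable
  · refine ae_of_all _ fun x hx r hr => hM (x, r) ⟨?_, Ioo_subset_Icc_self hr⟩
    rw [uIoc_of_le hl.le] at hx
    exact Ioc_subset_Icc_self hx
  · refine ae_of_all _ fun x hx r hr => ?_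
    rw [uIoc_of_le hl.le] at hx
    exact (h.hasDerivAt (Ioc_subset_Icc_self hx) hr.1).ofReal_comp.const_mul _

theorem hat_congr {l : ℝ} (hl : 0 < l) {y z : ℝ → ℝ} (h : ∀ x ∈ Icc 0 l, y x = z x) (k : ℂ) :
    hat l y k = hat l z k := by
  refine intervalIntegral.integral_congr fun x hx => ?_
  rw [uIcc_of_le hl.le] at hx
  simp only [h x hx]

theorem hat_linear {l : ℝ} (hl : 0 < l) {y z : ℝ → ℝ} (hy : ContinuousOn y (Icc 0 l))
    (hz : ContinuousOn z (Icc 0 l)) (a b : ℝ) (k : ℂ) :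
    hat l (fun x => a * y x + b * z x) k = a * hat l y k + b * hat l z k := by
  have hce : Continuous fun x : ℝ => Complex.exp (-(I * k * x)) := by fun_prop
  have hint {v : ℝ → ℝ} (hv : ContinuousOn v (Icc 0 l)) : IntervalIntegrable
        (fun x : ℝ => Complex.exp (-(I * k * x)) * v x) volume 0 l :=
    (hce.continuousOn.mul (Complex.continuous_ofReal.comp_continuousOn hv)
      ).intervalIntegrable_of_Icc hl.le
  rw [hat, hat, hat, ← intervalIntegral.integral_const_mul, ← intervalIntegral.integral_const_mul,
    ← intervalIntegral.integral_add ((hint hy).const_mul _) ((hint hz).const_mul _)]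
  refine intervalIntegral.integral_congr fun x _ => ?_
  push_cast
  ring

/-- The boundary values `β e - θ q_x`. -/
def flux (p : Params) (e q : ℝ → ℝ → ℝ) (x s : ℝ) : ℝ := p.β * e x s - p.θ * dx p.l q x s

/-- The Fourier transform of the solution at time `s`. -/
def uHat (p : Params) (e q : ℝ → ℝ → ℝ) (k : ℂ) (s : ℝ) : Fin 2 → ℂ :=
  ![hat p.l (fun x => e x s) k, hat p.l (fun x => q x s) k]

namespace IsSolution

variable {p : Params} {d : Data} {e q : ℝ → ℝ → ℝ}

theorem continuousOn_e (hs : IsSolution p d e q) :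
    ContinuousOn (fun z : ℝ × ℝ => e z.1 z.2) (Icc 0 p.l ×ˢ Ici 0) :=
  hs.e_dt.continuousOn hs.e_dx

theorem continuousOn_q (hs : IsSolution p d e q) :
    ContinuousOn (fun z : ℝ × ℝ => q z.1 z.2) (Icc 0 p.l ×ˢ Ici 0) :=
  hs.q_dt.continuousOn hs.q_dx

/-- The equations hold up to the boundary. -/
theorem energy' (hp : p.Admissible) (hs : IsSolution p d e q) {x t : ℝ} (hx : x ∈ Icc 0 p.l)
    (ht : 0 < t) : dt e x t = d.f x t - dx p.l q x t := by
  have h : EqOn (fun x => dt e x t) (fun x => d.f x t - dx p.l q x t) (Ioo 0 p.l) := fun x hx => by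
    have := hs.energy x hx t ht
    simp only
    linarith
  refine h.of_subset_closure (continuousOn_slice_left hs.e_dt.2 ht.le)
    ((continuousOn_slice_left hs.f_cont ht.le).sub (continuousOn_slice_left hs.q_dx.2 ht.le))
    Ioo_subset_Icc_self ?_ hx
  rw [closure_Ioo hp.l_pos.ne]

theorem guyerKrumhansl' (hp : p.Admissible) (hs : IsSolution p d e q) {x t : ℝ}
    (hx : x ∈ Icc 0 p.l) (ht : 0 < t) :
    dt q x t = -(1 / p.τ) * q x t + (p.θ * dx p.l (dx p.l q) x t + -p.β * dx p.l e x t) := by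
  have hτ := hp.τ_pos
  have h : EqOn (fun x => dt q x t) (fun x => -(1 / p.τ) * q x t +
      (p.θ * dx p.l (dx p.l q) x t + -p.β * dx p.l e x t)) (Ioo 0 p.l) := fun x hx => by
    have := hs.guyerKrumhansl x hx t ht
    simp only [Params.θ, Params.β]
    field_simp
    linarith
  refine h.of_subset_closure (continuousOn_slice_left hs.q_dt.2 ht.le)
    (((continuousOn_slice_left hs.continuousOn_q ht.le).const_mul _).add
      (((continuousOn_slice_left hs.q_dxx.2 ht.le).const_mul _).add
      ((continuousOn_slice_left hs.e_dx.2 ht.le).const_mul _)))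
    Ioo_subset_Icc_self ?_ hx
  rw [closure_Ioo hp.l_pos.ne]

theorem continuousOn_flux (hs : IsSolution p d e q) {x : ℝ} (hx : x ∈ Icc 0 p.l) :
    ContinuousOn (flux p e q x) (Ici 0) :=
  ((continuousOn_slice_right hs.continuousOn_e hx).const_mul _).sub
    ((continuousOn_slice_right hs.q_dx.2 hx).const_mul _)

/-- Integration by parts in `x`. The term with `q_xx` is integrated twice, which produces both parts
of the entry `r - ikθ q` of the boundary vector, with `r = β e - θ q_x`. -/
theorem hasDerivAt_uHat (hp : p.Admissible) (hs : IsSolution p d e q) (k : ℂ) {s : ℝ}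
    (h0 : 0 < s) :
    HasDerivAt (uHat p e q k) (-((p.Lam k).mulVec (uHat p e q k s)) + (FHat p d k s
      + p.boundaryVec (q 0) (flux p e q 0) k s
      - Complex.exp (-(I * k * p.l)) • p.boundaryVec (q p.l) (flux p e q p.l) k s)) s := by
  have hl := hp.l_pos
  have h1 := hs.e_dt.hasDerivAt_hat hl hs.continuousOn_e k h0
  have h2 := hs.q_dt.hasDerivAt_hat hl hs.continuousOn_q k h0
  have be := hat_derivWithin hl (hs.e_dx.1 s h0.le) (continuousOn_slice_left hs.e_dx.2 h0.le) k
  have bq := hat_derivWithin hl (hs.q_dx.1 s h0.le) (continuousOn_slice_left hs.q_dx.2 h0.le) k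
  have bqq := hat_derivWithin hl (hs.q_dxx.1 s h0.le) (continuousOn_slice_left hs.q_dxx.2 h0.le) k
  have e1 : hat p.l (fun x => dt e x s) k
      = fHat p d k s - hat p.l (derivWithin (fun y => q y s) (Icc 0 p.l)) k := by
    rw [hat_congr hl (z := fun x => (1 : ℝ) * d.f x s + (-1 : ℝ) * dx p.l q x s)
      (fun x hx => by rw [hs.energy' hp hx h0]; ring),
      hat_linear hl (continuousOn_slice_left hs.f_cont h0.le)
        (continuousOn_slice_left hs.q_dx.2 h0.le), fHat]
    push_cast
    have : (fun x => dx p.l q x s) = derivWithin (fun y => q y s) (Icc 0 p.l) := rfl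
    rw [this]; ring
  have e2 : hat p.l (fun x => dt q x s) k = -(1 / p.τ) * hat p.l (fun x => q x s) k
      + (p.θ * hat p.l (derivWithin (fun y => dx p.l q y s) (Icc 0 p.l)) k
      - p.β * hat p.l (derivWithin (fun y => e y s) (Icc 0 p.l)) k) := by
    rw [hat_congr hl (z := fun x => -(1 / p.τ) * q x s
      + (1 : ℝ) * (p.θ * dx p.l (dx p.l q) x s + -p.β * dx p.l e x s))
      (fun x hx => by rw [hs.guyerKrumhansl' hp hx h0]; ring),
      hat_linear hl (z := fun x => p.θ * dx p.l (dx p.l q) x s + -p.β * dx p.l e x s)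
        (continuousOn_slice_left hs.continuousOn_q h0.le)
        (((continuousOn_slice_left hs.q_dxx.2 h0.le).const_mul _).add
        ((continuousOn_slice_left hs.e_dx.2 h0.le).const_mul _)),
      hat_linear hl (continuousOn_slice_left hs.q_dxx.2 h0.le)
        (continuousOn_slice_left hs.e_dx.2 h0.le)]
    push_cast
    have : (fun x => dx p.l (dx p.l q) x s)
        = derivWithin (fun y => dx p.l q y s) (Icc 0 p.l) := rfl
    rw [this]
    have : (fun x => dx p.l e x s) = derivWithin (fun y => e y s) (Icc 0 p.l) := rfl
    rw [this]; ring
  have e3 : hat p.l (fun y => dx p.l q y s) k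
      = hat p.l (derivWithin (fun y => q y s) (Icc 0 p.l)) k := rfl
  refine hasDerivAt_pi.2 fun i => ?_
  fin_cases i
  · refine h1.congr_deriv ?_
    rw [e1, bq]
    simp [uHat, Params.Lam, FHat, Params.boundaryVec]
    ring
  · refine h2.congr_deriv ?_
    rw [e2, bqq, be, e3, bq]
    simp [uHat, Params.Lam, FHat, Params.boundaryVec, flux]
    linear_combination (p.θ * k ^ 2 * hat p.l (fun x => q x s) k) * Complex.I_sq

theorem continuousOn_FHat (hp : p.Admissible) (hs : IsSolution p d e q) :
    ContinuousOn (fun z : ℂ × ℝ => FHat p d z.1 z.2) (univ ×ˢ Ici 0) := by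
  refine continuousOn_pi.2 fun i => ?_
  fin_cases i
  · exact continuousOn_hat hp.l_pos hs.f_cont
  · exact continuousOn_const

theorem continuousOn_uHat (hp : p.Admissible) (hs : IsSolution p d e q) :
    ContinuousOn (fun z : ℂ × ℝ => uHat p e q z.1 z.2) (univ ×ˢ Ici 0) := by
  refine continuousOn_pi.2 fun i => ?_
  fin_cases i
  · exact continuousOn_hat hp.l_pos hs.continuousOn_e
  · exact continuousOn_hat hp.l_pos hs.continuousOn_q

theorem uHat_zero (hp : p.Admissible) (hs : IsSolution p d e q) (k : ℂ) :
    uHat p e q k 0 = u0Hat p d k := by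
  rw [uHat, u0Hat, hat_congr hp.l_pos hs.init_e, hat_congr hp.l_pos hs.init_q]

/-- The identity on which everything rests: integrated against `e^{ikx}` it yields the
representation, and its coordinates for the two roots are the global relations. -/
theorem uHat_eq (hp : p.Admissible) (hs : IsSolution p d e q) (k : ℂ) {t : ℝ} (ht : 0 ≤ t) :
    uHat p e q k t = (NormedSpace.exp (-(t : ℂ) • p.Lam k)).mulVec (u0Hat p d k)
      + (∫ s in (0 : ℝ)..t, (NormedSpace.exp (-((t : ℂ) - s) • p.Lam k)).mulVec (FHat p d k s))
      + p.boundaryInt (q 0) (flux p e q 0) t k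
      - Complex.exp (-(I * k * p.l)) • p.boundaryInt (q p.l) (flux p e q p.l) t k := by
  have hl := hp.l_pos
  have h0 : (0 : ℝ) ∈ Icc 0 p.l := left_mem_Icc.2 hl.le
  have h1 : p.l ∈ Icc 0 p.l := right_mem_Icc.2 hl.le
  have hsub : Icc 0 t ⊆ Ici 0 := fun s hs => hs.1
  have slice {v : ℂ → ℝ → Fin 2 → ℂ}
      (hv : ContinuousOn (fun z : ℂ × ℝ => v z.1 z.2) (univ ×ˢ Icc 0 t)) :
      ContinuousOn (fun s => v k s) (Icc 0 t) :=
    hv.comp (f := fun s => (k, s)) (by fun_prop) fun s hs => ⟨mem_univ _, hs⟩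
  have hF := (hs.continuousOn_FHat hp).mono (prod_mono (subset_univ _) hsub :
    univ ×ˢ Icc 0 t ⊆ univ ×ˢ Ici 0)
  have hU := (hs.continuousOn_uHat hp).mono (prod_mono (subset_univ _) hsub :
    univ ×ˢ Icc 0 t ⊆ univ ×ˢ Ici 0)
  have hL := Params.continuousOn_boundaryVec (p := p)
    ((continuousOn_slice_right hs.continuousOn_q h0).mono hsub)
    ((hs.continuousOn_flux h0).mono hsub)
  have hR := Params.continuousOn_boundaryVec (p := p)
    ((continuousOn_slice_right hs.continuousOn_q h1).mono hsub)
    ((hs.continuousOn_flux h1).mono hsub)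
  have h := duhamel (p.Lam k) ht (slice hU)
    (((slice hF).add (slice hL)).sub ((slice hR).const_smul (Complex.exp (-(I * k * p.l)))))
    fun s h => hs.hasDerivAt_uHat hp k h.1
  have hi {v : ℂ → ℝ → Fin 2 → ℂ}
      (hv : ContinuousOn (fun z : ℂ × ℝ => v z.1 z.2) (univ ×ˢ Icc 0 t)) :
      IntervalIntegrable (fun s : ℝ => (NormedSpace.exp (-((t : ℂ) - s) • p.Lam k)).mulVec (v k s))
        volume 0 t :=
    (slice (v := fun k s => (NormedSpace.exp (-((t : ℂ) - s) • p.Lam k)).mulVec (v k s))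
      (Params.continuousOn_exp_mulVec hv)).intervalIntegrable_of_Icc ht
  rw [h, hs.uHat_zero hp]
  simp only [Pi.sub_apply, Pi.add_apply, Pi.smul_apply, Matrix.mulVec_add, Matrix.mulVec_sub,
    Matrix.mulVec_smul]
  have hR' : IntervalIntegrable (fun s : ℝ => Complex.exp (-(I * k * p.l)) •
      (NormedSpace.exp (-((t : ℂ) - s) • p.Lam k)).mulVec
        (p.boundaryVec (q p.l) (flux p e q p.l) k s)) volume 0 t := (hi hR).smul (Complex.exp (-(I * k * p.l)))
  rw [intervalIntegral.integral_sub ((hi hF).add (hi hL)) hR',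
    intervalIntegral.integral_add (hi hF) (hi hL), intervalIntegral.integral_smul]
  simp only [Params.boundaryInt]
  abel

end IsSolution

end GK

namespace GK

/-! ### The global relations -/

namespace Params

variable (p : Params)

/-- The coefficient `σ` for the root `a`. -/
def sig (γ : ℝ) (a k : ℂ) : ℂ := I * k * (p.β - p.θ * a) + γ * (1 / p.τ - a)

/-- The determinant `Δ` for the root `a` and the boundary coefficients `γ`, `γ'`. -/
def det (γ γ' : ℝ) (a k : ℂ) : ℂ :=
  Complex.exp (I * k * p.l) * p.sig γ a k * p.sig γ' a k
    - Complex.exp (-(I * k * p.l)) * p.sig γ a (-k) * p.sig γ' a (-k)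

/-- The vector with coordinates `x`, `y` with respect to the eigenvectors for the roots `a`, `b`. -/
def eigenSum (k a b x y : ℂ) : Fin 2 → ℂ :=
  (1 / (a - b)) • (x • ![1, a / (I * k)] - y • ![1, b / (I * k)])

/-- The boundary integral of `boundaryInt` in the coordinate of the root `a`. -/
def coordInt (q r : ℝ → ℝ) (a k : ℂ) (t : ℝ) : ℂ :=
  ∫ s in (0 : ℝ)..t, Complex.exp (-(a * (t - s))) * ((a - 1 / p.τ) * q s + I * k * r s)

variable {p}

theorem det_comm (γ γ' : ℝ) (a k : ℂ) : p.det γ γ' a k = p.det γ' γ a k := by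
  rw [det, det]; ring

theorem det_neg (γ γ' : ℝ) (a k : ℂ) : p.det γ γ' a (-k) = -p.det γ γ' a k := by
  simp only [det, neg_neg, mul_neg, neg_mul]; ring

/-- The condition at `x = l` reads `q - γl e = -h`, which is the left condition with coefficient
`-γl`. So one computation serves both ends and yields `-σ_l(-k)` on the right. -/
theorem sig_neg_left (γ : ℝ) (a k : ℂ) : p.sig (-γ) a k = -p.sig γ a (-k) := by
  rw [sig, sig]; push_cast; ring

/-- Expresses the coefficient by the root `ω₁` to which it belongs. After this `σ` and `Δ` depend
only on one root and `k`, and both roots are treated together by `sig` and `det`. -/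
theorem ω₂_sub (hp : p.Admissible) (k : ℂ) : p.ω₂ k - p.θ * k ^ 2 = 1 / p.τ - p.ω₁ k := by
  linear_combination ω_add hp k

theorem ω₁_sub (hp : p.Admissible) (k : ℂ) : p.ω₁ k - p.θ * k ^ 2 = 1 / p.τ - p.ω₂ k := by
  linear_combination ω_add hp k

theorem σ₁_eq (hp : p.Admissible) (γ : ℝ) (k : ℂ) : p.σ₁ γ k = p.sig γ (p.ω₁ k) k := by
  rw [σ₁, sig, ω₂_sub hp]

theorem σ₂_eq (hp : p.Admissible) (γ : ℝ) (k : ℂ) : p.σ₂ γ k = p.sig γ (p.ω₂ k) k := by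
  rw [σ₂, sig, ω₁_sub hp]

theorem σ₁_neg (hp : p.Admissible) (γ : ℝ) (k : ℂ) : p.σ₁ γ (-k) = p.sig γ (p.ω₁ k) (-k) := by
  rw [σ₁_eq hp, ω₁_neg]

theorem σ₂_neg (hp : p.Admissible) (γ : ℝ) (k : ℂ) : p.σ₂ γ (-k) = p.sig γ (p.ω₂ k) (-k) := by
  rw [σ₂_eq hp, ω₂_neg]

theorem Δ₁_eq (hp : p.Admissible) (k : ℂ) : p.Δ₁ k = p.det p.γ0 p.γl (p.ω₁ k) k := by
  rw [Δ₁, det, σ₁_eq hp, σ₁_eq hp, σ₁_neg hp, σ₁_neg hp]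

theorem Δ₂_eq (hp : p.Admissible) (k : ℂ) : p.Δ₂ k = p.det p.γ0 p.γl (p.ω₂ k) k := by
  rw [Δ₂, det, σ₂_eq hp, σ₂_eq hp, σ₂_neg hp, σ₂_neg hp]

theorem S_mulVec (k x y : ℂ) : (p.S k).mulVec ![x, -y] = eigenSum k (p.ω₁ k) (p.ω₂ k) x y := by
  ext i
  fin_cases i
  · simp [S, eigenSum, Matrix.mulVec, dotProduct]; ring
  · simp [S, eigenSum, Matrix.mulVec, dotProduct]; ring

theorem eigenSum_add (k a b x y x' y' : ℂ) :
    eigenSum k a b (x + x') (y + y') = eigenSum k a b x y + eigenSum k a b x' y' := by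
  simp only [eigenSum, add_smul]; module

theorem eigenSum_neg (k a b x y : ℂ) : eigenSum k a b (-x) (-y) = -eigenSum k a b x y := by
  simp only [eigenSum]; module

theorem IsPair.exp_mulVec_eq {k a b : ℂ} (h : p.IsPair k a b) (s : ℂ) (v : Fin 2 → ℂ) :
    (NormedSpace.exp (-s • p.Lam k)).mulVec v
      = eigenSum k a b (Complex.exp (-(a * s)) * coord k b v)
          (Complex.exp (-(b * s)) * coord k a v) := by
  rw [h.exp_mulVec, eigenSum, smul_smul, smul_smul]

theorem IsPair.coord_eigenSum {k a b : ℂ} (h : p.IsPair k a b) (x y : ℂ) :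
    coord k b (eigenSum k a b x y) = x := by
  have hab : a - b ≠ 0 := sub_ne_zero.2 h.ne
  have hk := h.k_ne
  have hI := Complex.I_ne_zero
  simp [coord, eigenSum]
  field_simp
  ring

theorem integral_eigenSum {k a b : ℂ} {f g : ℝ → ℂ} {t : ℝ}
    (hf : IntervalIntegrable f volume 0 t) (hg : IntervalIntegrable g volume 0 t) :
    ∫ s in (0 : ℝ)..t, eigenSum k a b (f s) (g s)
      = eigenSum k a b (∫ s in (0 : ℝ)..t, f s) (∫ s in (0 : ℝ)..t, g s) := by
  have h1 : IntervalIntegrable (fun s => f s • (![1, a / (I * k)] : Fin 2 → ℂ)) volume 0 t :=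
    ⟨hf.1.smul_const _, hf.2.smul_const _⟩
  have h2 : IntervalIntegrable (fun s => g s • (![1, b / (I * k)] : Fin 2 → ℂ)) volume 0 t :=
    ⟨hg.1.smul_const _, hg.2.smul_const _⟩
  simp only [eigenSum]
  rw [intervalIntegral.integral_smul, intervalIntegral.integral_sub h1 h2,
    intervalIntegral.integral_smul_const, intervalIntegral.integral_smul_const]

theorem continuousOn_coordInt {q r : ℝ → ℝ} {t : ℝ} (hq : ContinuousOn q (Icc 0 t))
    (hr : ContinuousOn r (Icc 0 t)) (a k : ℂ) :
    ContinuousOn (fun s : ℝ => Complex.exp (-(a * (t - s))) *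
      ((a - 1 / p.τ) * q s + I * k * r s)) (Icc 0 t) := by
  have h1 := Complex.continuous_ofReal.comp_continuousOn hq
  have h2 := Complex.continuous_ofReal.comp_continuousOn hr
  exact ContinuousOn.mul (by fun_prop) ((continuousOn_const.mul h1).add (continuousOn_const.mul h2))

theorem IsPair.boundaryInt_eq {k a b : ℂ} (h : p.IsPair k a b) {q r : ℝ → ℝ} {t : ℝ} (ht : 0 ≤ t)
    (hq : ContinuousOn q (Icc 0 t)) (hr : ContinuousOn r (Icc 0 t)) :
    p.boundaryInt q r t k
      = eigenSum k a b (p.coordInt q r a k t) (p.coordInt q r b k t) := by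
  rw [coordInt, coordInt, ← integral_eigenSum
    ((continuousOn_coordInt hq hr a k).intervalIntegrable_of_Icc ht)
    ((continuousOn_coordInt hq hr b k).intervalIntegrable_of_Icc ht), boundaryInt]
  refine intervalIntegral.integral_congr fun s _ => ?_
  simp only [h.exp_mulVec_eq, h.coord_boundaryVec, h.symm.coord_boundaryVec]

end Params

open Params

/-- The interval is half-open because the boundary conditions and equations are available only at
positive times. -/
theorem tilde_congr {y z : ℝ → ℝ} {t : ℝ} (ht : 0 ≤ t) (h : ∀ s ∈ Ioc 0 t, y s = z s) (a : ℂ) :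
    tilde y a t = tilde z a t := by
  refine intervalIntegral.integral_congr_ae (ae_of_all _ fun s hs => ?_)
  rw [uIoc_of_le ht] at hs
  rw [h s hs]

theorem tilde_neg (y : ℝ → ℝ) (a : ℂ) (t : ℝ) : tilde (fun s => -y s) a t = -tilde y a t := by
  rw [tilde, tilde, ← intervalIntegral.integral_neg]
  simp

theorem intervalIntegrable_tilde {y : ℝ → ℝ} {t : ℝ} (ht : 0 ≤ t) (hy : ContinuousOn y (Icc 0 t))
    (a : ℂ) : IntervalIntegrable (fun s : ℝ => Complex.exp (-(a * (t - s))) * y s) volume 0 t :=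
  (ContinuousOn.mul (by fun_prop)
    (Complex.continuous_ofReal.comp_continuousOn hy)).intervalIntegrable_of_Icc ht

theorem tilde_deriv {y y' : ℝ → ℝ} {t : ℝ} (ht : 0 ≤ t) (hy : ContinuousOn y (Icc 0 t))
    (hy' : ContinuousOn y' (Icc 0 t)) (hd : ∀ s ∈ Ioo 0 t, HasDerivAt y (y' s) s) (a : ℂ) :
    tilde y' a t = y t - Complex.exp (-(a * t)) * y 0 - a * tilde y a t := by
  have hexp (s : ℝ) : HasDerivAt (fun s : ℝ => Complex.exp (-(a * (t - s))))
      (Complex.exp (-(a * (t - s))) * a) s := by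
    have h1 : HasDerivAt (fun s : ℝ => -(a * ((t : ℂ) - s))) a s := by
      simpa using (((Complex.ofRealCLM.hasDerivAt (x := s)).const_sub (t : ℂ)).const_mul a).fun_neg
    exact h1.cexp
  have h1 := intervalIntegrable_tilde ht hy a
  have h2 := intervalIntegrable_tilde ht hy' a
  have h := intervalIntegral.integral_eq_sub_of_hasDerivAt_of_le ht
    (f := fun s : ℝ => Complex.exp (-(a * (t - s))) * y s)
    (f' := fun s : ℝ => a * (Complex.exp (-(a * (t - s))) * y s)
      + Complex.exp (-(a * (t - s))) * y' s)
    (ContinuousOn.mul (by fun_prop) (Complex.continuous_ofReal.comp_continuousOn hy))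
    (fun s hs => ?_) ((h1.const_mul _).add h2)
  · rw [intervalIntegral.integral_add (h1.const_mul _) h2,
      intervalIntegral.integral_const_mul] at h
    simp only [sub_self, mul_zero, neg_zero, Complex.exp_zero, one_mul, Complex.ofReal_zero,
      sub_zero] at h
    rw [tilde, tilde]
    linear_combination h
  · refine ((hexp s).mul (hd s hs).ofReal_comp).congr_deriv ?_
    ring

/-- The boundary integral, expressed by the boundary condition and the energy equation. -/
theorem Params.coordInt_eq {p : Params} {y y' G F : ℝ → ℝ} {t γ : ℝ} (ht : 0 ≤ t)
    (hy : ContinuousOn y (Icc 0 t)) (hy' : ContinuousOn y' (Icc 0 t)) (hG : ContinuousOn G (Icc 0 t))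
    (hF : ContinuousOn F (Icc 0 t)) (hd : ∀ s ∈ Ioo 0 t, HasDerivAt y (y' s) s) (a k : ℂ) :
    p.coordInt (fun s => G s - γ * y s) (fun s => p.β * y s - p.θ * (F s - y' s)) a k t
      = p.sig γ a k * tilde y a t - (1 / p.τ - a) * tilde G a t
        - I * k * p.θ * (y 0 * Complex.exp (-(a * t)) + tilde F a t) + I * k * p.θ * y t := by
  have h1 := intervalIntegrable_tilde ht hy a
  have h2 := intervalIntegrable_tilde ht hy' a
  have h3 := intervalIntegrable_tilde ht hG a
  have h4 := intervalIntegrable_tilde ht hF a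
  have e : p.coordInt (fun s => G s - γ * y s) (fun s => p.β * y s - p.θ * (F s - y' s)) a k t
      = (I * k * p.β + γ * (1 / p.τ - a)) * tilde y a t + (a - 1 / p.τ) * tilde G a t
        + (-(I * k * p.θ) * tilde F a t + I * k * p.θ * tilde y' a t) := by
    simp only [tilde, ← intervalIntegral.integral_const_mul]
    rw [← intervalIntegral.integral_add (h1.const_mul _) (h3.const_mul _),
      ← intervalIntegral.integral_add (h4.const_mul _) (h2.const_mul _),
      ← intervalIntegral.integral_add ((h1.const_mul _).add (h3.const_mul _))
        ((h4.const_mul _).add (h2.const_mul _)), coordInt]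
    refine intervalIntegral.integral_congr fun s _ => ?_
    push_cast
    ring
  -- Integration by parts in time removes `y'`: it supplies the part `-ikθ a` of `σ`, the initial
  -- value, and the extra term with `y t`.
  rw [e, tilde_deriv ht hy hy' hd, sig]
  ring

section Generic

variable (p : Params) (d : Data)

/-- The known part of the global relation for the root `a`, `b` being the other one. -/
def known (a b k : ℂ) (t : ℝ) : ℂ :=
  Complex.exp (-(a * t)) * coord k b (u0Hat p d k)
    + (∫ s in (0 : ℝ)..t, -b * Complex.exp (-(a * (t - s))) * fHat p d k s)
    - (1 / p.τ - a) * (tilde d.g a t + Complex.exp (-(I * k * p.l)) * tilde d.h a t)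
    - I * k * p.θ * ((d.φ 0 * Complex.exp (-(a * t)) + tilde (d.f 0) a t)
      - Complex.exp (-(I * k * p.l)) * (d.φ p.l * Complex.exp (-(a * t)) + tilde (d.f p.l) a t))

/-- The entries of `a'`, up to sign. -/
def leftCoeff (a b k : ℂ) (t : ℝ) : ℂ :=
  -p.sig p.γ0 a k * (1 / p.det p.γ0 p.γl a k *
    (-(Complex.exp (I * k * p.l) * p.sig p.γl a k) * known p d a b k t
      + Complex.exp (-(I * k * p.l)) * p.sig p.γl a (-k) * known p d a b (-k) t))
  + (1 / p.τ - a) * tilde d.g a t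
  + I * k * p.θ * (d.φ 0 * Complex.exp (-(a * t)) + tilde (d.f 0) a t)

/-- The entries of `b'`, up to sign. -/
def rightCoeff (a b k : ℂ) (t : ℝ) : ℂ :=
  p.sig p.γl a (-k) * (1 / p.det p.γ0 p.γl a k *
    (p.sig p.γ0 a (-k) * known p d a b k t - p.sig p.γ0 a k * known p d a b (-k) t))
  - (1 / p.τ - a) * tilde d.h a t
  + I * k * p.θ * (d.φ p.l * Complex.exp (-(a * t)) + tilde (d.f p.l) a t)

variable {p d}

theorem V₁_add_W₁ (hp : p.Admissible) (k : ℂ) (t : ℝ) :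
    V₁ p d k t + W₁ p d k t = known p d (p.ω₁ k) (p.ω₂ k) k t := by
  rw [V₁, W₁, known, Φ₁, F₁, L₁, R₁, ω₂_sub hp, coord, u0Hat]
  simp
  ring

theorem V₂_add_W₂ (hp : p.Admissible) (k : ℂ) (t : ℝ) :
    V₂ p d k t + W₂ p d k t = -known p d (p.ω₂ k) (p.ω₁ k) k t := by
  rw [V₂, W₂, known, Φ₂, F₂, L₂, R₂, ω₁_sub hp, coord, u0Hat]
  simp
  ring

theorem aPrime_eq (hp : p.Admissible) (k : ℂ) (t : ℝ) :
    aPrime p d k t = ![leftCoeff p d (p.ω₁ k) (p.ω₂ k) k t, -leftCoeff p d (p.ω₂ k) (p.ω₁ k) k t] := by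
  rw [aPrime, eLeft₁, eLeft₂, V₁_add_W₁ hp, V₁_add_W₁ hp, V₂_add_W₂ hp, V₂_add_W₂ hp,
    ω₂_sub hp, ω₁_sub hp, Δ₁_eq hp, Δ₂_eq hp, σ₁_neg hp, σ₂_neg hp, σ₁_eq hp, σ₁_eq hp, σ₂_eq hp,
    σ₂_eq hp, L₁, L₂, ω₁_neg, ω₂_neg]
  ext i
  fin_cases i
  · simp [leftCoeff]
  · simp [leftCoeff]; ring

theorem bPrime_eq (hp : p.Admissible) (k : ℂ) (t : ℝ) :
    bPrime p d k t
      = ![rightCoeff p d (p.ω₁ k) (p.ω₂ k) k t, -rightCoeff p d (p.ω₂ k) (p.ω₁ k) k t] := by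
  rw [bPrime, eRight₁, eRight₂, V₁_add_W₁ hp, V₁_add_W₁ hp, V₂_add_W₂ hp, V₂_add_W₂ hp,
    ω₂_sub hp, ω₁_sub hp, Δ₁_eq hp, Δ₂_eq hp, σ₁_neg hp, σ₂_neg hp, σ₁_neg hp, σ₂_neg hp,
    σ₁_eq hp, σ₂_eq hp, R₁, R₂, ω₁_neg, ω₂_neg]
  ext i
  fin_cases i
  · simp [rightCoeff]
  · simp [rightCoeff]; ring

/-- The terms of the global relation that contain the solution at time `t`. -/
def remainder (p : Params) (e q : ℝ → ℝ → ℝ) (t : ℝ) (a k : ℂ) : ℂ :=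
  (a - 1 / p.τ) * hat p.l (fun x => e x t) k
    + I * k * (hat p.l (fun x => q x t) k + p.θ * hat p.l (fun x => dx p.l e x t) k)

namespace IsSolution

variable {e q : ℝ → ℝ → ℝ}

/-- The energy equation, continued to the boundary, eliminates `q_x`, and the boundary condition
eliminates `q`. Only the time transform of `e(0, ·)` and the value `e(0, t)` remain unknown. -/
theorem coordInt_left (hp : p.Admissible) (hs : IsSolution p d e q) {t : ℝ} (ht : 0 ≤ t) (a k : ℂ) :
    p.coordInt (q 0) (flux p e q 0) a k t
      = p.sig p.γ0 a k * tilde (e 0) a t - (1 / p.τ - a) * tilde d.g a t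
        - I * k * p.θ * (d.φ 0 * Complex.exp (-(a * t)) + tilde (d.f 0) a t)
        + I * k * p.θ * e 0 t := by
  have h0 : (0 : ℝ) ∈ Icc 0 p.l := left_mem_Icc.2 hp.l_pos.le
  have hsub : Icc 0 t ⊆ Ici 0 := fun s hs => hs.1
  have he := (continuousOn_slice_right hs.continuousOn_e h0).mono hsub
  have hq := (continuousOn_slice_right hs.continuousOn_q h0).mono hsub
  have h := p.coordInt_eq (y := e 0) (y' := dt e 0) (G := fun s => q 0 s + p.γ0 * e 0 s)
    (F := d.f 0) (γ := p.γ0) ht he ((continuousOn_slice_right hs.e_dt.2 h0).mono hsub)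
    (hq.add (he.const_mul _)) ((continuousOn_slice_right hs.f_cont h0).mono hsub)
    (fun s hs' => hs.e_dt.hasDerivAt h0 hs'.1) a k
  rw [tilde_congr (y := fun s => q 0 s + p.γ0 * e 0 s) (z := d.g) ht (fun s hs' => by rw [← hs.bdry_left s hs'.1]; ring),
    hs.init_e 0 h0] at h
  rw [← h]
  refine intervalIntegral.integral_congr_ae (ae_of_all _ fun s hs' => ?_)
  rw [uIoc_of_le ht] at hs'
  simp only [flux, hs.energy' hp h0 hs'.1, add_sub_cancel_right, sub_sub_cancel]

theorem coordInt_right (hp : p.Admissible) (hs : IsSolution p d e q) {t : ℝ} (ht : 0 ≤ t)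
    (a k : ℂ) :
    p.coordInt (q p.l) (flux p e q p.l) a k t
      = -p.sig p.γl a (-k) * tilde (e p.l) a t + (1 / p.τ - a) * tilde d.h a t
        - I * k * p.θ * (d.φ p.l * Complex.exp (-(a * t)) + tilde (d.f p.l) a t)
        + I * k * p.θ * e p.l t := by
  have h0 : p.l ∈ Icc 0 p.l := right_mem_Icc.2 hp.l_pos.le
  have hsub : Icc 0 t ⊆ Ici 0 := fun s hs => hs.1
  have he := (continuousOn_slice_right hs.continuousOn_e h0).mono hsub
  have hq := (continuousOn_slice_right hs.continuousOn_q h0).mono hsub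
  have h := p.coordInt_eq (y := e p.l) (y' := dt e p.l) (G := fun s => q p.l s + -p.γl * e p.l s)
    (F := d.f p.l) (γ := -p.γl) ht he ((continuousOn_slice_right hs.e_dt.2 h0).mono hsub)
    (hq.add (he.const_mul _)) ((continuousOn_slice_right hs.f_cont h0).mono hsub)
    (fun s hs' => hs.e_dt.hasDerivAt h0 hs'.1) a k
  rw [tilde_congr (y := fun s => q p.l s + -p.γl * e p.l s) (z := fun s => -d.h s) ht
    (fun s hs' => by rw [← hs.bdry_right s hs'.1]; ring), tilde_neg,
    hs.init_e p.l h0, sig_neg_left] at h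
  have e1 : p.coordInt (q p.l) (flux p e q p.l) a k t = p.coordInt
      (fun s => q p.l s + -p.γl * e p.l s - -p.γl * e p.l s)
      (fun s => p.β * e p.l s - p.θ * (d.f p.l s - dt e p.l s)) a k t := by
    refine intervalIntegral.integral_congr_ae (ae_of_all _ fun s hs' => ?_)
    rw [uIoc_of_le ht] at hs'
    simp only [flux, hs.energy' hp h0 hs'.1, add_sub_cancel_right, sub_sub_cancel]
  rw [e1, h]
  ring

/-- Writing `-θk²` as `ikθ · ik` and using the transform of `e_x` splits off boundary values of `e`
at time `t`. They cancel the like terms of `coordInt_left` and `coordInt_right` in the global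
relation. -/
theorem coord_uHat (hp : p.Admissible) (hs : IsSolution p d e q) {k a b : ℂ} (h : p.IsPair k a b)
    {t : ℝ} (ht : 0 ≤ t) :
    coord k b (uHat p e q k t) = remainder p e q t a k
      + I * k * p.θ * (e 0 t - Complex.exp (-(I * k * p.l)) * e p.l t) := by
  have h1 := hat_derivWithin hp.l_pos (hs.e_dx.1 t ht) (continuousOn_slice_left hs.e_dx.2 ht) k
  have h2 : (fun x => dx p.l e x t) = derivWithin (fun y => e y t) (Icc 0 p.l) := rfl
  have h3 : (a - 1 / p.τ : ℂ) = p.θ * k ^ 2 - b := by linear_combination h.add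
  rw [remainder, h2, h1, coord, uHat, h3]
  simp
  linear_combination (-(k ^ 2 * p.θ * hat p.l (fun x => e x t) k)) * Complex.I_sq

/-- The global relation. -/
theorem known_eq (hp : p.Admissible) (hs : IsSolution p d e q) {k a b : ℂ} (h : p.IsPair k a b)
    {t : ℝ} (ht : 0 ≤ t) :
    known p d a b k t = remainder p e q t a k - p.sig p.γ0 a k * tilde (e 0) a t
      - Complex.exp (-(I * k * p.l)) * p.sig p.γl a (-k) * tilde (e p.l) a t := by
  have h0 : (0 : ℝ) ∈ Icc 0 p.l := left_mem_Icc.2 hp.l_pos.le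
  have h1 : p.l ∈ Icc 0 p.l := right_mem_Icc.2 hp.l_pos.le
  have hsub : Icc 0 t ⊆ Ici 0 := fun s hs => hs.1
  have hF : ContinuousOn (fun s => fHat p d k s) (Icc 0 t) :=
    (continuousOn_hat hp.l_pos hs.f_cont).comp (f := fun s : ℝ => (k, s)) (by fun_prop)
      fun s hs => ⟨mem_univ _, hs.1⟩
  have hFi (c c' : ℂ) : IntervalIntegrable
      (fun s : ℝ => -c' * Complex.exp (-(c * (t - s))) * fHat p d k s) volume 0 t :=
    (ContinuousOn.mul (by fun_prop) hF).intervalIntegrable_of_Icc ht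
  have hsrc : ∫ s in (0 : ℝ)..t, (NormedSpace.exp (-((t : ℂ) - s) • p.Lam k)).mulVec (FHat p d k s)
      = eigenSum k a b (∫ s in (0 : ℝ)..t, -b * Complex.exp (-(a * (t - s))) * fHat p d k s)
          (∫ s in (0 : ℝ)..t, -a * Complex.exp (-(b * (t - s))) * fHat p d k s) := by
    rw [← integral_eigenSum (hFi a b) (hFi b a)]
    refine intervalIntegral.integral_congr fun s _ => ?_
    simp only [h.exp_mulVec_eq]
    congr 1 <;> simp [coord, FHat] <;> ring
  have hU := hs.uHat_eq hp k ht
  rw [hsrc, h.exp_mulVec_eq, h.boundaryInt_eq ht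
    ((continuousOn_slice_right hs.continuousOn_q h0).mono hsub)
    ((hs.continuousOn_flux h0).mono hsub), h.boundaryInt_eq ht
    ((continuousOn_slice_right hs.continuousOn_q h1).mono hsub)
    ((hs.continuousOn_flux h1).mono hsub)] at hU
  have hlin (v w : Fin 2 → ℂ) (c : ℂ) : coord k b (v - c • w) = coord k b v - c * coord k b w := by
    simp [coord]; ring
  have hU2 := congrArg (coord k b) hU
  rw [← eigenSum_add, ← eigenSum_add, hlin, h.coord_eigenSum, h.coord_eigenSum,
    hs.coord_uHat hp h ht, hs.coordInt_left hp ht, hs.coordInt_right hp ht] at hU2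
  rw [known]
  linear_combination -hU2

/-- `a'` as the true boundary integral and a correction without exponential growth. -/
theorem leftCoeff_eq (hp : p.Admissible) (hs : IsSolution p d e q) {k a b : ℂ} (h : p.IsPair k a b)
    {t : ℝ} (ht : 0 ≤ t) (hdet : p.det p.γ0 p.γl a k ≠ 0 ∨ p.sig p.γ0 a k = 0) :
    leftCoeff p d a b k t = -p.coordInt (q 0) (flux p e q 0) a k t + (I * k * p.θ * e 0 t
      + p.sig p.γ0 a k / p.det p.γ0 p.γl a k *
        (p.sig p.γl a k * (Complex.exp (I * k * p.l) * remainder p e q t a k)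
          - Complex.exp (-(I * k * p.l)) * p.sig p.γl a (-k) * remainder p e q t a (-k))) := by
  -- When the relations at `k` and `-k` are inserted, the transform of `e(l, ·)` cancels and that of
  -- `e(0, ·)` acquires the factor `Δ`: this is Cramer's rule. In the exempt case `sig = 0` removes
  -- the fraction, whatever its value.
  rw [leftCoeff, hs.known_eq hp h ht, hs.known_eq hp h.neg ht, hs.coordInt_left hp ht]
  rcases hdet with hdet | hdet
  · have hE : Complex.exp (I * k * p.l) * Complex.exp (-(I * k * p.l)) = 1 := by
      rw [← Complex.exp_add, add_neg_cancel, Complex.exp_zero]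
    have e1 : Complex.exp (-(I * -k * p.l)) = Complex.exp (I * k * p.l) := by congr 1; ring
    rw [e1, neg_neg]
    have hD : p.det p.γ0 p.γl a k = Complex.exp (I * k * p.l) * p.sig p.γ0 a k * p.sig p.γl a k
      - Complex.exp (-(I * k * p.l)) * p.sig p.γ0 a (-k) * p.sig p.γl a (-k) := rfl
    set D := p.det p.γ0 p.γl a k
    field_simp
    rw [hD]
    ring
  · rw [hdet]; ring

/-- Taken at `-k`, since `∂D₀⁻ = -∂D₀⁺`. The correction then has the form of the left one with the
two ends interchanged, so the same vanishing theorem covers it. -/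
theorem rightCoeff_eq (hp : p.Admissible) (hs : IsSolution p d e q) {k a b : ℂ} (h : p.IsPair k a b)
    {t : ℝ} (ht : 0 ≤ t) (hdet : p.det p.γ0 p.γl a k ≠ 0 ∨ p.sig p.γl a k = 0) :
    rightCoeff p d a b (-k) t = -p.coordInt (q p.l) (flux p e q p.l) a (-k) t
      + -(I * k * p.θ * e p.l t
      + p.sig p.γl a k / p.det p.γl p.γ0 a k *
        (p.sig p.γ0 a k * remainder p e q t a (-k)
          - Complex.exp (-(I * k * p.l)) * p.sig p.γ0 a (-k)
            * (Complex.exp (I * k * p.l) * remainder p e q t a k))) := by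
  rw [rightCoeff, neg_neg, hs.known_eq hp h ht, hs.known_eq hp h.neg ht, hs.coordInt_right hp ht,
    neg_neg, det_neg, det_comm p.γl]
  rcases hdet with hdet | hdet
  · have hE : Complex.exp (I * k * p.l) * Complex.exp (-(I * k * p.l)) = 1 := by
      rw [← Complex.exp_add, add_neg_cancel, Complex.exp_zero]
    have e1 : Complex.exp (-(I * -k * p.l)) = Complex.exp (I * k * p.l) := by congr 1; ring
    rw [e1]
    have hD : p.det p.γ0 p.γl a k = Complex.exp (I * k * p.l) * p.sig p.γ0 a k * p.sig p.γl a k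
      - Complex.exp (-(I * k * p.l)) * p.sig p.γ0 a (-k) * p.sig p.γl a (-k) := rfl
    set D := p.det p.γ0 p.γl a k
    have e2 : Complex.exp (-(I * k * p.l)) * p.sig p.γ0 a (-k)
            * (Complex.exp (I * k * p.l) * remainder p e q t a k)
        = p.sig p.γ0 a (-k) * remainder p e q t a k := by
      linear_combination (p.sig p.γ0 a (-k) * remainder p e q t a k) * hE
    rw [e2]
    field_simp
    rw [hD]
    ring_nf
  · rw [hdet]; ring

end IsSolution

end Generic

end GK

namespace GK

/-! ### The corrections have no contribution -/

namespace Params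

/-- The part of the coefficients that contains the solution at time `t`. -/
def reflection (p : Params) (γ γ' : ℝ) (z z' a k : ℂ) : ℂ :=
  p.sig γ a k / p.det γ γ' a k *
    (p.sig γ' a k * z - Complex.exp (-(I * k * p.l)) * p.sig γ' a (-k) * z')

variable {p : Params}

theorem norm_add_le_two_mul {x y : ℂ} (h : ‖x‖ ≤ ‖y‖ / 3) :
    ‖x + y‖ ≤ 2 * ‖x - y‖ ∧ 2 / 3 * ‖y‖ ≤ ‖x - y‖ := by
  have h1 := norm_add_le x y
  have h2 := norm_sub_norm_le y x
  rw [norm_sub_rev] at h2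
  constructor <;> linarith

theorem sig_self (hp : p.Admissible) (γ : ℝ) {ω : ℂ} (k : ℂ) :
    p.sig γ ω k = I * k * (p.α - p.μ ^ 2 * ω) / p.τ + γ * (1 - p.τ * ω) / p.τ := by
  have hτ : (p.τ : ℂ) ≠ 0 := by exact_mod_cast hp.τ_pos.ne'
  rw [sig, β, θ]; push_cast; field_simp

/-- The factor `α τ - μ²` isolates the exceptional case; otherwise only the size of `ikα/τ + γ ω`
matters. -/
theorem sig_dual (hp : p.Admissible) (γ : ℝ) {ω : ℂ} (hd : (p.α - p.μ ^ 2 * ω : ℂ) ≠ 0) (k : ℂ) :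
    p.sig γ (p.dual ω) k = (p.α * p.τ - p.μ ^ 2) / (p.τ * (p.α - p.μ ^ 2 * ω)) *
      (I * k * (p.α / p.τ) + γ * ω) := by
  have hτ : (p.τ : ℂ) ≠ 0 := by exact_mod_cast hp.τ_pos.ne'
  have hd' : (p.α - ω * p.μ ^ 2 : ℂ) ≠ 0 := by rwa [mul_comm ω]
  rw [sig, dual, ratio, β, θ]; push_cast; field_simp; ring

/-- Up to sign and a common factor `σ(k)` and `σ(-k)` are a sum and a difference in which one
summand dominates. For the root `ω` it is the one with `ik`; for the dual root it is `γ ω`, as `|ω|`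
is at least of order `|k|²`, unless `γ = 0`, when only one summand is present. -/
theorem exists_norm_sig_le (hp : p.Admissible) {γ : ℝ} (hγ : 0 ≤ γ) :
    ∃ κ₀ : ℝ, ∀ ω : ℂ, ω.re ≤ 0 → ω ≠ 0 → κ₀ ≤ ‖p.K ω‖ →
      (‖p.sig γ ω (p.K ω)‖ ≤ 2 * ‖p.sig γ ω (-p.K ω)‖ ∧ p.sig γ ω (-p.K ω) ≠ 0) ∧
      ‖p.sig γ (p.dual ω) (p.K ω)‖ ≤ 2 * ‖p.sig γ (p.dual ω) (-p.K ω)‖ ∧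
        (p.α * p.τ ≠ p.μ ^ 2 → p.sig γ (p.dual ω) (-p.K ω) ≠ 0) := by
  have hα := hp.α_pos
  have hτ := hp.τ_pos
  have hμ := hp.μ_pos
  set r : ℝ := 1 / p.α + p.τ / p.μ ^ 2 with hr
  have hr0 : 0 < r := by positivity
  -- The first summand gives `|Q| ≤ |P|/3` for the root `ω`, the second `|P| ≤ |Q|/3` for the dual
  -- root. For `γ = 0` the second is 0 by the convention for division.
  refine ⟨3 * γ * r + 3 * r * (p.α / p.τ) / γ, fun ω hω h0 hk => ?_⟩
  have e1 : 0 ≤ 3 * γ * r := by positivity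
  have e2 : 0 ≤ 3 * r * (p.α / p.τ) / γ := by positivity
  set k := p.K ω with hkdef
  have hk0 : k ≠ 0 := K_ne_zero hp hω h0
  have hkn : 0 < ‖k‖ := norm_pos_iff.2 hk0
  have hd := den_ne hp hω
  have hτ' : (p.τ : ℂ) ≠ 0 := by exact_mod_cast hτ.ne'
  have hτn : ‖(p.τ : ℂ)‖ = p.τ := by rw [Complex.norm_real, Real.norm_eq_abs, abs_of_pos hτ]
  have hγn : ‖(γ : ℂ)‖ = γ := by rw [Complex.norm_real, Real.norm_eq_abs, abs_of_nonneg hγ]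
  constructor
  · set P : ℂ := I * k * (p.α - p.μ ^ 2 * ω) / p.τ with hP
    set Q : ℂ := γ * (1 - p.τ * ω) / p.τ with hQ
    have hPn : ‖P‖ = ‖k‖ * ‖(p.α - p.μ ^ 2 * ω : ℂ)‖ / p.τ := by
      rw [hP, norm_div, norm_mul, norm_mul, Complex.norm_I, one_mul, hτn]
    have hPpos : 0 < ‖P‖ := by
      rw [hPn]; have := norm_pos_iff.2 hd; positivity
    have hQP : ‖Q‖ ≤ ‖P‖ / 3 := by
      rw [hPn, hQ, norm_div, norm_mul, hτn, hγn, div_right_comm]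
      refine div_le_div_of_nonneg_right ?_ hτ.le
      have h1 := mul_le_mul_of_nonneg_left (norm_num_le hp hω) hγ
      have h2 : 3 * γ * r * ‖(p.α - p.μ ^ 2 * ω : ℂ)‖ ≤ ‖k‖ * ‖(p.α - p.μ ^ 2 * ω : ℂ)‖ := by
        gcongr; linarith
      linarith
    have e3 : p.sig γ ω k = Q + P := by rw [sig_self hp]; ring
    have e4 : p.sig γ ω (-k) = Q - P := by rw [sig_self hp]; ring
    obtain ⟨h1, h2⟩ := norm_add_le_two_mul hQP
    rw [e3, e4]
    exact ⟨h1, norm_pos_iff.1 (lt_of_lt_of_le (by positivity) h2)⟩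
  · set c : ℂ := (p.α * p.τ - p.μ ^ 2) / (p.τ * (p.α - p.μ ^ 2 * ω)) with hc
    set P : ℂ := I * k * (p.α / p.τ) with hP
    set Q : ℂ := γ * ω with hQ
    have hPn : ‖P‖ = ‖k‖ * (p.α / p.τ) := by
      rw [hP, norm_mul, norm_mul, Complex.norm_I, one_mul, norm_div, hτn, Complex.norm_real,
        Real.norm_eq_abs, abs_of_pos hα]
    have e3 : p.sig γ (p.dual ω) k = c * (P + Q) := by rw [sig_dual hp γ hd]
    have e4 : p.sig γ (p.dual ω) (-k) = -(c * (P - Q)) := by rw [sig_dual hp γ hd]; ring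
    have hc0 : p.α * p.τ ≠ p.μ ^ 2 → c ≠ 0 := fun h => by
      refine div_ne_zero (sub_ne_zero.2 ?_) (mul_ne_zero hτ' hd)
      exact_mod_cast h
    have key : ‖P + Q‖ ≤ 2 * ‖P - Q‖ ∧ P - Q ≠ 0 := by
      rcases hγ.eq_or_lt with h | h
      · have : Q = 0 := by rw [hQ, ← h]; simp
        rw [this, add_zero, sub_zero]
        refine ⟨by linarith [norm_nonneg P], norm_pos_iff.1 ?_⟩
        rw [hPn]; positivity
      · have hQn : ‖Q‖ = γ * ‖ω‖ := by rw [hQ, norm_mul, hγn]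
        have hQpos : 0 < ‖Q‖ := by rw [hQn]; have := norm_pos_iff.2 h0; positivity
        have h1 : ‖P‖ ≤ ‖Q‖ / 3 := by
          rw [hPn, hQn]
          have h2 : 3 * r * (p.α / p.τ) / γ * ‖k‖ ≤ r * ‖ω‖ := by
            calc 3 * r * (p.α / p.τ) / γ * ‖k‖ ≤ ‖k‖ * ‖k‖ := by gcongr; linarith
              _ = ‖k‖ ^ 2 := by ring
              _ ≤ _ := norm_K_sq_le hp hω
          have h3 : r * (3 * (‖k‖ * (p.α / p.τ))) ≤ r * (γ * ‖ω‖) := by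
            rw [div_mul_eq_mul_div, div_le_iff₀ h] at h2
            linarith
          linarith [le_of_mul_le_mul_left h3 hr0]
        obtain ⟨h2, h3⟩ := norm_add_le_two_mul h1
        exact ⟨h2, norm_pos_iff.1 (lt_of_lt_of_le (by positivity) h3)⟩
    rw [e3, e4, norm_neg, norm_mul, norm_mul]
    refine ⟨?_, fun h => neg_ne_zero.2 (mul_ne_zero (hc0 h) key.2)⟩
    have := mul_le_mul_of_nonneg_left key.1 (norm_nonneg c)
    linarith

/-- After multiplication by `E` the first product is at most `(1/8) · 4 = 1/2` of the second in
modulus. -/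
theorem det_bound {s s' m m' E : ℂ} (hE : E ≠ 0) (hE2 : ‖E‖ ^ 2 ≤ 1 / 8)
    (h : ‖s‖ ≤ 2 * ‖m‖) (h' : ‖s'‖ ≤ 2 * ‖m'‖) :
    ‖m‖ * ‖m'‖ / 2 ≤ ‖E * (E * s * s' - E⁻¹ * m * m')‖ := by
  have e : E * (E * s * s' - E⁻¹ * m * m') = E ^ 2 * (s * s') - m * m' := by field_simp
  have h1 := norm_sub_norm_le (m * m') (E ^ 2 * (s * s'))
  rw [norm_sub_rev, norm_mul, norm_mul, norm_mul, norm_pow] at h1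
  have h2 : ‖s‖ * ‖s'‖ ≤ 2 * ‖m‖ * (2 * ‖m'‖) := by gcongr
  have h3 : ‖E‖ ^ 2 * (‖s‖ * ‖s'‖) ≤ 1 / 8 * (2 * ‖m‖ * (2 * ‖m'‖)) := by gcongr
  rw [e]
  linarith

/-- Multiplying numerator and denominator by `E` removes the growing factor `E⁻¹`; what is left is
bounded by `det_bound`. -/
theorem norm_reflection_aux {s s' m m' E z z' : ℂ} (hE : E ≠ 0) (hE2 : ‖E‖ ^ 2 ≤ 1 / 8)
    (h : ‖s‖ ≤ 2 * ‖m‖) (h' : ‖s'‖ ≤ 2 * ‖m'‖) :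
    ‖s / (E * s * s' - E⁻¹ * m * m') * (s' * z - E⁻¹ * m' * z')‖ ≤ 8 * ‖z‖ + 4 * ‖z'‖ := by
  have hd := det_bound hE hE2 h h'
  have e : s / (E * s * s' - E⁻¹ * m * m') * (s' * z - E⁻¹ * m' * z')
      = s * (E * s' * z - m' * z') / (E * (E * s * s' - E⁻¹ * m * m')) := by
    have : E * s' * z - m' * z' = E * (s' * z - E⁻¹ * m' * z') := by field_simp
    rw [this, mul_left_comm, mul_div_mul_left _ _ hE, div_mul_eq_mul_div]
  have hE1 : ‖E‖ ≤ 1 := by nlinarith [norm_nonneg E]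
  rw [e, norm_div]
  refine div_le_of_le_mul₀ (norm_nonneg _) (by positivity) ?_
  have h1 : ‖E * s' * z - m' * z'‖ ≤ 2 * ‖m'‖ * ‖z‖ + ‖m'‖ * ‖z'‖ := by
    refine (norm_sub_le _ _).trans ?_
    rw [norm_mul, norm_mul, norm_mul]
    have : ‖E‖ * ‖s'‖ ≤ 1 * (2 * ‖m'‖) := by gcongr
    rw [one_mul] at this
    gcongr
  calc ‖s * (E * s' * z - m' * z')‖ ≤ 2 * ‖m‖ * (2 * ‖m'‖ * ‖z‖ + ‖m'‖ * ‖z'‖) := by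
        rw [norm_mul]; gcongr
    _ = (8 * ‖z‖ + 4 * ‖z'‖) * (‖m‖ * ‖m'‖ / 2) := by ring
    _ ≤ _ := by gcongr

theorem exists_reflection_bound (hp : p.Admissible) {γ γ' : ℝ} (hγ : 0 ≤ γ) (hγ' : 0 ≤ γ') :
    ∃ κ₀ : ℝ, 1 ≤ κ₀ ∧ ∀ ω : ℂ, ω.re ≤ 0 → ω ≠ 0 → κ₀ ≤ ‖p.K ω‖ →
      (p.det γ γ' ω (p.K ω) ≠ 0 ∧
        (p.α * p.τ ≠ p.μ ^ 2 → p.det γ γ' (p.dual ω) (p.K ω) ≠ 0)) ∧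
      ∀ a : ℂ, a = ω ∨ a = p.dual ω → ∀ z z' : ℂ,
        ‖p.reflection γ γ' z z' a (p.K ω)‖ ≤ 8 * ‖z‖ + 4 * ‖z'‖ := by
  obtain ⟨κ₁, h₁⟩ := exists_norm_sig_le hp hγ
  obtain ⟨κ₂, h₂⟩ := exists_norm_sig_le hp hγ'
  obtain ⟨c, hc, him⟩ := exists_le_im_K hp
  have hl := hp.l_pos
  -- The last entry forces `2 l Im k ≥ 7`, so that `|e^{ikl}|² ≤ e^{-7} ≤ 1/8`.
  refine ⟨max (max κ₁ κ₂) (max 1 (7 / (2 * p.l * c))), (le_max_left _ _).trans (le_max_right _ _),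
    fun ω hω h0 hk => ?_⟩
  simp only [max_le_iff] at hk
  obtain ⟨⟨hk1, hk2⟩, -, hk4⟩ := hk
  obtain ⟨⟨a1, a2⟩, a3, a4⟩ := h₁ ω hω h0 hk1
  obtain ⟨⟨b1, b2⟩, b3, b4⟩ := h₂ ω hω h0 hk2
  have hE0 : Complex.exp (I * p.K ω * p.l) ≠ 0 := Complex.exp_ne_zero _
  have hE2 : ‖Complex.exp (I * p.K ω * p.l)‖ ^ 2 ≤ 1 / 8 := by
    rw [norm_exp_I_mul, ← Real.exp_nat_mul]
    have h1 : 7 ≤ 2 * (p.l * (p.K ω).im) := by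
      rw [div_le_iff₀ (by positivity)] at hk4
      have := mul_le_mul_of_nonneg_left (him ω hω) hl.le
      linarith
    have h2 : Real.exp (((2 : ℕ) : ℝ) * -(p.l * (p.K ω).im)) = (Real.exp (2 * (p.l * (p.K ω).im)))⁻¹ := by
      rw [← Real.exp_neg]; congr 1; push_cast; ring
    rw [h2, ← one_div]
    exact one_div_le_one_div_of_le (by norm_num) (by linarith [Real.add_one_le_exp (2 * (p.l * (p.K ω).im))])
  have hdet (a : ℂ) (ha : ‖p.sig γ a (p.K ω)‖ ≤ 2 * ‖p.sig γ a (-p.K ω)‖)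
      (ha' : ‖p.sig γ' a (p.K ω)‖ ≤ 2 * ‖p.sig γ' a (-p.K ω)‖) (hn : p.sig γ a (-p.K ω) ≠ 0)
      (hn' : p.sig γ' a (-p.K ω) ≠ 0) : p.det γ γ' a (p.K ω) ≠ 0 := by
    have h := det_bound hE0 hE2 ha ha'
    rw [det, Complex.exp_neg]
    intro h3
    rw [h3, mul_zero, norm_zero] at h
    have := norm_pos_iff.2 hn
    have := norm_pos_iff.2 hn'
    have : 0 < ‖p.sig γ a (-p.K ω)‖ * ‖p.sig γ' a (-p.K ω)‖ := by positivity
    linarith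
  refine ⟨⟨hdet _ a1 b1 a2 b2, fun h => hdet _ a3 b3 (a4 h) (b4 h)⟩, ?_⟩
  rintro a (rfl | rfl) z z'
  · rw [reflection, det, Complex.exp_neg]
    exact norm_reflection_aux hE0 hE2 a1 b1
  · rw [reflection, det, Complex.exp_neg]
    exact norm_reflection_aux hE0 hE2 a3 b3

theorem dual_ne (hp : p.Admissible) {ω : ℂ} (hω : ω.re ≤ 0) : p.dual ω ≠ ω := by
  intro h
  have := re_dual_pos hp hω
  rw [h] at this
  linarith

theorem isPair_K (hp : p.Admissible) {ω : ℂ} (hω : ω.re ≤ 0) (h0 : ω ≠ 0) :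
    p.IsPair (p.K ω) (p.dual ω) ω :=
  ⟨by rw [K_sq, add_comm]; exact add_dual hp (den_ne hp hω), by rw [K_sq, mul_comm, mul_dual],
    dual_ne hp hω, K_ne_zero hp hω h0⟩

theorem differentiableAt_dual {ω : ℂ} (hω : (p.α - p.μ ^ 2 * ω : ℂ) ≠ 0) :
    DifferentiableAt ℂ p.dual ω := by
  have : DifferentiableAt ℂ (fun ω : ℂ => (p.α / p.τ : ℂ) * ((1 - p.τ * ω) / (p.α - p.μ ^ 2 * ω))) ω := by
    fun_prop (disch := exact hω)
  exact this

theorem differentiableAt_sig {γ : ℝ} {f g : ℂ → ℂ} {ω : ℂ} (hf : DifferentiableAt ℂ f ω)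
    (hg : DifferentiableAt ℂ g ω) : DifferentiableAt ℂ (fun ω => p.sig γ (f ω) (g ω)) ω := by
  simp only [sig]; fun_prop

theorem differentiableAt_det {γ γ' : ℝ} {f g : ℂ → ℂ} {ω : ℂ} (hf : DifferentiableAt ℂ f ω)
    (hg : DifferentiableAt ℂ g ω) : DifferentiableAt ℂ (fun ω => p.det γ γ' (f ω) (g ω)) ω := by
  simp only [det]
  have h1 := differentiableAt_sig (p := p) (γ := γ) hf hg
  have h2 := differentiableAt_sig (p := p) (γ := γ') hf hg
  have h3 := differentiableAt_sig (p := p) (γ := γ) hf hg.fun_neg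
  have h4 := differentiableAt_sig (p := p) (γ := γ') hf hg.fun_neg
  fun_prop

theorem differentiableAt_reflection {γ γ' : ℝ} {f g z z' : ℂ → ℂ} {ω : ℂ}
    (hf : DifferentiableAt ℂ f ω) (hg : DifferentiableAt ℂ g ω) (hz : DifferentiableAt ℂ z ω)
    (hz' : DifferentiableAt ℂ z' ω) (hd : p.det γ γ' (f ω) (g ω) ≠ 0) :
    DifferentiableAt ℂ (fun ω => p.reflection γ γ' (z ω) (z' ω) (f ω) (g ω)) ω := by
  simp only [reflection]
  have h1 := differentiableAt_sig (p := p) (γ := γ) hf hg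
  have h2 := differentiableAt_sig (p := p) (γ := γ') hf hg
  have h4 := differentiableAt_sig (p := p) (γ := γ') hf hg.fun_neg
  have h5 := differentiableAt_det (p := p) (γ := γ) (γ' := γ') hf hg
  have h6 := h1.fun_div h5 hd
  fun_prop

theorem sig_dual_eq_zero (hp : p.Admissible) (γ : ℝ) {ω : ℂ} (hd : (p.α - p.μ ^ 2 * ω : ℂ) ≠ 0)
    (h : p.α * p.τ = p.μ ^ 2) (k : ℂ) : p.sig γ (p.dual ω) k = 0 := by
  have : (p.α * p.τ - p.μ ^ 2 : ℂ) = 0 := by exact_mod_cast sub_eq_zero.2 h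
  rw [sig_dual hp γ hd, this, zero_div, zero_mul]

theorem differentiableAt_eigenSum {f a b x y : ℂ → ℂ} {ω : ℂ} (hf : DifferentiableAt ℂ f ω)
    (ha : DifferentiableAt ℂ a ω) (hb : DifferentiableAt ℂ b ω) (hx : DifferentiableAt ℂ x ω)
    (hy : DifferentiableAt ℂ y ω) (hab : a ω ≠ b ω) (h0 : f ω ≠ 0) :
    DifferentiableAt ℂ (fun ω => eigenSum (f ω) (a ω) (b ω) (x ω) (y ω)) ω := by
  have h1 : a ω - b ω ≠ 0 := sub_ne_zero.2 hab
  have h2 : I * f ω ≠ 0 := mul_ne_zero Complex.I_ne_zero h0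
  have e1 : DifferentiableAt ℂ (fun ω => 1 / (a ω - b ω)) ω :=
    (differentiableAt_const _).fun_div (ha.fun_sub hb) h1
  have e2 : DifferentiableAt ℂ (fun ω => a ω / (I * f ω)) ω :=
    ha.fun_div (hf.const_mul I) h2
  have e3 : DifferentiableAt ℂ (fun ω => b ω / (I * f ω)) ω :=
    hb.fun_div (hf.const_mul I) h2
  refine differentiableAt_pi.2 fun i => ?_
  fin_cases i
  · simp [eigenSum]
    simp only [one_div] at e1
    exact e1.fun_mul (hx.fun_sub hy)
  · simp [eigenSum]
    simp only [one_div] at e1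
    exact e1.fun_mul ((hx.fun_mul e2).fun_sub (hy.fun_mul e3))

theorem norm_eigenSum_le {k a b x y : ℂ} {N m : ℝ} (hab : 1 ≤ ‖a - b‖) (hk : 1 ≤ ‖k‖) (hm : 1 ≤ m)
    (ha : ‖a‖ ≤ m) (hb : ‖b‖ ≤ m) (hx : ‖x‖ ≤ N) (hy : ‖y‖ ≤ N) :
    ‖eigenSum k a b x y‖ ≤ 2 * (N * m) := by
  have hN : 0 ≤ N := (norm_nonneg _).trans hx
  have hk0 : 0 < ‖k‖ := by linarith
  have hmk : m ≤ m * ‖k‖ := le_mul_of_one_le_right (by linarith) hk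
  have h1 := norm_eigenvector_le hk0 hm (ha.trans hmk)
  have h2 := norm_eigenvector_le hk0 hm (hb.trans hmk)
  rw [eigenSum, norm_smul, norm_div, norm_one]
  have h3 : 1 / ‖a - b‖ ≤ 1 := by rw [div_le_one (by linarith)]; exact hab
  have h4 : ‖x • (![1, a / (I * k)] : Fin 2 → ℂ) - y • ![1, b / (I * k)]‖ ≤ N * m + N * m := by
    refine (norm_sub_le _ _).trans (add_le_add ?_ ?_)
    · rw [norm_smul]; gcongr
    · rw [norm_smul]; gcongr
  calc 1 / ‖a - b‖ * _ ≤ 1 * (N * m + N * m) := by gcongr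
    _ = _ := by ring

/-- The corrections to the coefficients `a'`, `b'` do not contribute to the contour integrals. -/
theorem IsCorner.integralUpper_reflection (hp : p.Admissible) {R ν₀ y₀ : ℝ} (hR : 0 < R)
    (hc : p.IsCorner R ν₀ y₀) {γ γ' : ℝ} (hγ : 0 ≤ γ) (hγ' : 0 ≤ γ')
    (hdet : ∀ ω ∈ p.region R, p.det γ γ' ω (p.K ω) ≠ 0)
    (hdet' : p.α * p.τ ≠ p.μ ^ 2 → ∀ ω ∈ p.region R, p.det γ γ' (p.dual ω) (p.K ω) ≠ 0)
    {u v u' v' : ℂ → ℂ} (hu : Differentiable ℂ u) (hv : Differentiable ℂ v)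
    (hu' : Differentiable ℂ u') (hv' : Differentiable ℂ v') {M : ℝ}
    (hM : ∀ k : ℂ, 0 ≤ k.im → ‖u k‖ ≤ M ∧ ‖v k‖ ≤ M ∧ ‖u' k‖ ≤ M ∧ ‖v' k‖ ≤ M)
    {c ε : ℂ} (hε : ‖ε‖ = 1) {X : ℝ} (hX : 0 < X) {N : ℂ → ℂ → ℂ} (hN : ∀ a k, N a k =
      I * k * p.θ * c + p.reflection γ γ' ((a - 1 / p.τ) * u k + I * k * v k)
        ((a - 1 / p.τ) * u' k + I * k * v' k) a k) {F : ℂ → Fin 2 → ℂ}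
    (hF : ∀ ω ∈ p.region R, F (p.K ω) = Complex.exp (I * p.K ω * X) •
      ε • eigenSum (ε * p.K ω) (p.dual ω) ω (N (p.dual ω) (p.K ω)) (N ω (p.K ω))) :
    p.IntegrableUpper R F ∧ p.integralUpper R F = 0 := by
  have hα := hp.α_pos
  have hτ := hp.τ_pos
  have hμ := hp.μ_pos
  have hθ := θ_pos hp
  -- `ε = 1` serves the contour in the upper half-plane, `ε = -1` the reflected one in the lower
  -- half-plane.
  have hε0 : ε ≠ 0 := norm_ne_zero_iff.1 (by rw [hε]; exact one_ne_zero)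
  obtain ⟨κ₀, hκ₀, hbound⟩ := exists_reflection_bound hp hγ hγ'
  obtain ⟨c₁, hc₁, him⟩ := exists_le_im_K hp
  have hM0 : 0 ≤ M := (norm_nonneg _).trans (hM 0 le_rfl).1
  set r : ℝ := 1 / p.α + p.τ / p.μ ^ 2 with hr
  have hr0 : 0 < r := by positivity
  set m : ℝ := 1 / (p.α + p.μ ^ 2 / p.τ) with hm
  have hm0 : 0 < m := by positivity
  -- the domain of holomorphy
  set f₃ : ℂ → ℂ := fun ω => if p.α * p.τ = p.μ ^ 2 then 1 else p.det γ γ' (p.dual ω) (p.K ω)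
    with hf₃
  -- `V` is the set where the roots are distinct and the determinants do not vanish. `f₃` exempts
  -- the dual root when `α τ = μ²`, where its determinant is identically 0 and its correction
  -- vanishes with `σ`.
  set f : ℂ → ℂ := fun ω => (p.dual ω - ω) * p.det γ γ' ω (p.K ω) * f₃ ω with hf
  have hdf : DifferentiableOn ℂ f p.regular := by
    intro ω hω
    have h1 := differentiableAt_dual hω.1
    have h2 := differentiableAt_K hω
    have h3 := differentiableAt_det (p := p) (γ := γ) (γ' := γ') differentiableAt_id h2
    have h4 : DifferentiableAt ℂ f₃ ω := by
      by_cases h : p.α * p.τ = p.μ ^ 2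
      · simp [hf₃, h]
      · simp only [hf₃, h, if_false]
        exact differentiableAt_det h1 h2
    exact (((h1.fun_sub differentiableAt_id).fun_mul h3).fun_mul h4).differentiableWithinAt
  set V : Set ℂ := p.regular ∩ f ⁻¹' {0}ᶜ with hV
  have hVo : IsOpen V := hdf.continuousOn.isOpen_inter_preimage isOpen_regular
    isOpen_compl_singleton
  have hVR : p.region R ⊆ V := by
    rintro ω hω
    refine ⟨mem_regular hp hω.1 hω.2.1, ?_⟩
    refine mul_ne_zero (mul_ne_zero (sub_ne_zero.2 (dual_ne hp hω.1)) (hdet ω hω)) ?_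
    by_cases h : p.α * p.τ = p.μ ^ 2
    · simp [hf₃, h]
    · simp only [hf₃, h, if_false]
      exact hdet' h ω hω
  set H : ℂ → Fin 2 → ℂ := fun ω => Complex.exp (I * p.K ω * X) •
      ε • eigenSum (ε * p.K ω) (p.dual ω) ω (N (p.dual ω) (p.K ω)) (N ω (p.K ω)) with hH
  have hHd : DifferentiableOn ℂ H V := by
    rintro ω ⟨hω, hω2⟩
    have hω2' : f ω ≠ 0 := hω2
    rw [hf] at hω2'
    obtain ⟨h12, h3⟩ := mul_ne_zero_iff.1 hω2'
    obtain ⟨h1, h2⟩ := mul_ne_zero_iff.1 h12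
    have hdu := differentiableAt_dual hω.1
    have hK := differentiableAt_K hω
    have hz (a : ℂ → ℂ) (ha : DifferentiableAt ℂ a ω) {u v : ℂ → ℂ} (hu : Differentiable ℂ u)
        (hv : Differentiable ℂ v) : DifferentiableAt ℂ
        (fun ω => (a ω - 1 / p.τ) * u (p.K ω) + I * p.K ω * v (p.K ω)) ω :=
      ((ha.sub_const _).fun_mul ((hu _).comp ω hK)).fun_add
        ((hK.const_mul I).fun_mul ((hv _).comp ω hK))
    have hN1 : DifferentiableAt ℂ (fun ω => N ω (p.K ω)) ω := by
      simp only [hN]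
      exact (((hK.const_mul I).mul_const _).mul_const _).fun_add (differentiableAt_reflection
        differentiableAt_id hK (hz _ differentiableAt_id hu hv) (hz _ differentiableAt_id hu' hv') h2)
    have hN2 : DifferentiableAt ℂ (fun ω => N (p.dual ω) (p.K ω)) ω := by
      simp only [hN]
      refine (((hK.const_mul I).mul_const _).mul_const _).fun_add ?_
      by_cases h : p.α * p.τ = p.μ ^ 2
      · have h0 : (fun ω => p.reflection γ γ' ((p.dual ω - 1 / p.τ) * u (p.K ω) + I * p.K ω * v (p.K ω))
          ((p.dual ω - 1 / p.τ) * u' (p.K ω) + I * p.K ω * v' (p.K ω)) (p.dual ω) (p.K ω))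
            =ᶠ[𝓝 ω] fun _ => 0 := by
          filter_upwards [isOpen_regular.mem_nhds hω] with w hw
          rw [reflection, sig_dual_eq_zero hp γ hw.1 h, zero_div, zero_mul]
        exact (differentiableAt_const _).congr_of_eventuallyEq h0
      · simp only [hf₃, h, if_false] at h3
        exact differentiableAt_reflection hdu hK (hz _ hdu hu hv) (hz _ hdu hu' hv') h3
    have he : DifferentiableAt ℂ (fun ω => Complex.exp (I * p.K ω * X)) ω :=
      ((hK.const_mul I).mul_const _).cexp
    exact (he.fun_smul ((differentiableAt_eigenSum (hK.const_mul ε) hdu differentiableAt_id hN2 hN1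
      (sub_ne_zero.1 h1) (mul_ne_zero hε0 (K_ne_zero_of_regular hω))).const_smul ε)
        ).differentiableWithinAt
  -- decay
  set A : ℝ := 1 + p.α / p.τ * r with hA
  have hA1 : 1 ≤ A := by rw [hA]; linarith [show 0 < p.α / p.τ * r by positivity]
  set Z : ℝ := (A + 1 / p.τ + (1 + r)) * M with hZ
  have hZ0 : 0 ≤ Z := by positivity
  set B : ℝ := (1 + r) * p.θ * ‖c‖ + 12 * Z with hB
  have hB0 : 0 ≤ B := by positivity
  -- The integrand is of order `|ω|² e^{-X c₁ |k|}`, with one factor `|ω|` from `N` and one from the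
  -- eigenvectors. Eight powers of `|k|` dominate `|ω|⁴` and leave the decay `|ω|⁻²`.
  refine hc.integralUpper_eq_zero hp hR hVo hVR hHd hF
    (C := 2 * (B * A) * ((Nat.factorial 8 : ℝ) / (X * c₁) ^ 8) / m ^ 4)
    (ρ := 1 + A + κ₀ ^ 2 / m) fun ω hω hρ => ?_
  have hωre := hω.1
  have hω0 := hω.2.1
  have e1 : 0 ≤ κ₀ ^ 2 / m := by positivity
  have hω1 : 1 ≤ ‖ω‖ := by linarith
  have hωp : 0 < ‖ω‖ := by linarith
  set k := p.K ω with hk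
  have hkl : m * ‖ω‖ ≤ ‖k‖ ^ 2 := le_norm_K_sq hp hωre
  have hkκ : κ₀ ≤ ‖k‖ := by
    refine le_of_sq_le_sq (le_trans ?_ hkl) (norm_nonneg _)
    have : κ₀ ^ 2 / m ≤ ‖ω‖ := by linarith
    rw [div_le_iff₀ hm0] at this
    linarith
  have hk1 : 1 ≤ ‖k‖ := hκ₀.trans hkκ
  have hku : ‖k‖ ≤ (1 + r) * ‖ω‖ := by
    have h1 : ‖k‖ ^ 2 ≤ r * ‖ω‖ := norm_K_sq_le hp hωre
    nlinarith
  have hdual : ‖p.dual ω‖ ≤ p.α / p.τ * r := by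
    have : ‖(p.α / p.τ : ℂ)‖ = p.α / p.τ := by
      rw [norm_div, Complex.norm_real, Complex.norm_real, Real.norm_eq_abs, Real.norm_eq_abs,
        abs_of_pos hα, abs_of_pos hτ]
    rw [dual, norm_mul, this]
    have := norm_ratio_le hp hωre
    gcongr
  have hkim : 0 ≤ k.im := im_K_nonneg ω
  obtain ⟨M1, M2, M3, M4⟩ := hM k hkim
  have haA (a : ℂ) (ha : a = ω ∨ a = p.dual ω) : ‖a‖ ≤ A * ‖ω‖ := by
    rcases ha with rfl | rfl
    · exact le_mul_of_one_le_left hωp.le hA1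
    · refine hdual.trans (le_trans ?_ (le_mul_of_one_le_right (by linarith) hω1))
      rw [hA]; linarith
  have hzb (a : ℂ) (ha : ‖a‖ ≤ A * ‖ω‖) (u v : ℂ) (hu : ‖u‖ ≤ M) (hv : ‖v‖ ≤ M) :
      ‖(a - 1 / p.τ) * u + I * k * v‖ ≤ Z * ‖ω‖ := by
    have hnτ : ‖(1 / p.τ : ℂ)‖ = 1 / p.τ := by
      rw [norm_div, norm_one, Complex.norm_real, Real.norm_eq_abs, abs_of_pos hτ]
    have h1 : ‖a - 1 / p.τ‖ ≤ (A + 1 / p.τ) * ‖ω‖ := by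
      refine (norm_sub_le _ _).trans ?_
      rw [hnτ]
      have : 1 / p.τ ≤ 1 / p.τ * ‖ω‖ := le_mul_of_one_le_right (by positivity) hω1
      linarith
    refine (norm_add_le _ _).trans ?_
    rw [norm_mul, norm_mul, norm_mul, Complex.norm_I, one_mul]
    calc ‖a - 1 / p.τ‖ * ‖u‖ + ‖k‖ * ‖v‖
        ≤ (A + 1 / p.τ) * ‖ω‖ * M + (1 + r) * ‖ω‖ * M := by gcongr
      _ = _ := by rw [hZ]; ring
  have hNb (a : ℂ) (ha : a = ω ∨ a = p.dual ω) : ‖N a k‖ ≤ B * ‖ω‖ := by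
    rw [hN]
    refine (norm_add_le _ _).trans ?_
    have h1 := (hbound ω hωre hω0 hkκ).2 a ha ((a - 1 / p.τ) * u k + I * k * v k)
      ((a - 1 / p.τ) * u' k + I * k * v' k)
    have h2 := hzb a (haA a ha) _ _ M1 M2
    have h3 := hzb a (haA a ha) _ _ M3 M4
    have h4 : ‖I * k * p.θ * c‖ ≤ (1 + r) * ‖ω‖ * p.θ * ‖c‖ := by
      rw [norm_mul, norm_mul, norm_mul, Complex.norm_I, one_mul, Complex.norm_real,
        Real.norm_eq_abs, abs_of_pos hθ]
      gcongr
    calc _ ≤ (1 + r) * ‖ω‖ * p.θ * ‖c‖ + (8 * (Z * ‖ω‖) + 4 * (Z * ‖ω‖)) := by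
          refine add_le_add h4 (h1.trans ?_); gcongr
      _ = _ := by rw [hB]; ring
  have hsub : 1 ≤ ‖p.dual ω - ω‖ := by
    have := norm_sub_norm_le ω (p.dual ω)
    rw [norm_sub_rev] at this
    linarith
  have hsum := norm_eigenSum_le (k := ε * k) hsub (by rw [norm_mul, hε, one_mul]; exact hk1)
    (hA1.trans (le_mul_of_one_le_right (by linarith) hω1)) (haA _ (Or.inr rfl)) (haA _ (Or.inl rfl))
    (hNb _ (Or.inr rfl)) (hNb _ (Or.inl rfl))
  have hexp : Real.exp (-(X * k.im)) ≤ Real.exp (-(X * c₁ * ‖k‖)) := by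
    refine Real.exp_le_exp.2 (neg_le_neg ?_)
    rw [mul_assoc]
    have := him ω hωre
    gcongr
  have h8 := pow_mul_exp_neg_le 8 (mul_pos hX hc₁) (norm_nonneg k)
  have hm4 : m ^ 4 * ‖ω‖ ^ 4 ≤ ‖k‖ ^ 8 := by
    calc m ^ 4 * ‖ω‖ ^ 4 = (m * ‖ω‖) ^ 4 := by ring
      _ ≤ (‖k‖ ^ 2) ^ 4 := by gcongr
      _ = _ := by ring
  have he0 := Real.exp_pos (-(X * c₁ * ‖k‖))
  have hfin : ‖ω‖ ^ 2 * Real.exp (-(X * c₁ * ‖k‖))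
      ≤ (Nat.factorial 8 : ℝ) / (X * c₁) ^ 8 / m ^ 4 / ‖ω‖ ^ 2 := by
    rw [le_div_iff₀ (by positivity), le_div_iff₀ (by positivity)]
    calc ‖ω‖ ^ 2 * Real.exp (-(X * c₁ * ‖k‖)) * ‖ω‖ ^ 2 * m ^ 4
        = m ^ 4 * ‖ω‖ ^ 4 * Real.exp (-(X * c₁ * ‖k‖)) := by ring
      _ ≤ ‖k‖ ^ 8 * Real.exp (-(X * c₁ * ‖k‖)) := by gcongr
      _ ≤ _ := h8
  rw [hH]
  simp only
  rw [norm_smul, norm_smul, hε, one_mul, norm_exp_I_mul]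
  calc _ ≤ Real.exp (-(X * c₁ * ‖k‖)) * (2 * (B * ‖ω‖ * (A * ‖ω‖))) := by gcongr
    _ = 2 * (B * A) * (‖ω‖ ^ 2 * Real.exp (-(X * c₁ * ‖k‖))) := by ring
    _ ≤ 2 * (B * A) * ((Nat.factorial 8 : ℝ) / (X * c₁) ^ 8 / m ^ 4 / ‖ω‖ ^ 2) := by gcongr
    _ = _ := by ring

end Params

end GK

namespace GK

/-! ### The contour integrals -/

namespace Params

variable {p : Params}

/-- `dual` is a fractional linear map with value `1/τ` at 0: either it is constant or it takes this
value nowhere else. -/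
theorem dual_eq_iff (hp : p.Admissible) {ω : ℂ} (hω : ω.re ≤ 0) (h0 : ω ≠ 0) :
    p.dual ω = 1 / p.τ ↔ p.α * p.τ = p.μ ^ 2 := by
  have hτ : (p.τ : ℂ) ≠ 0 := by exact_mod_cast hp.τ_pos.ne'
  have hd := den_ne hp hω
  have e : p.dual ω = 1 / p.τ ↔ ω * (p.α * p.τ - p.μ ^ 2 : ℂ) = 0 := by
    rw [dual, ratio, div_mul_div_comm, div_eq_div_iff (mul_ne_zero hτ hd) hτ]
    constructor
    · intro h
      have : (p.τ : ℂ) * (ω * (p.α * p.τ - p.μ ^ 2 : ℂ)) = 0 := by linear_combination -h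
      exact (mul_eq_zero.1 this).resolve_left hτ
    · intro h
      linear_combination (-(p.τ : ℂ)) * h
  rw [e, mul_eq_zero, or_iff_right h0, sub_eq_zero]
  norm_cast

/-- Every point of the closure in the upper half-plane is `K ω` with `ω = ω₂ k`, so
`exists_reflection_bound` applies. The lower half-plane follows because `Δ` is odd in `k`. -/
theorem exists_poleFree (hp : p.Admissible) :
    ∃ R₀ : ℝ, 0 < R₀ ∧ ∀ R : ℝ, R₀ ≤ R → p.PoleFree R := by
  obtain ⟨κ₀, hκ₀, h⟩ := exists_reflection_bound hp hp.γ0_nonneg hp.γl_nonneg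
  have key : ∀ k : ℂ, (p.ω₂ k).re ≤ 0 → 0 < k.im → κ₀ ≤ ‖k‖ →
      (p.ω₁ k ≠ 1 / p.τ → p.Δ₁ k ≠ 0) ∧ (p.ω₂ k ≠ 1 / p.τ → p.Δ₂ k ≠ 0) := by
    intro k hk him hκ
    have h0 : p.ω₂ k ≠ 0 := ω₂_ne_zero hp (by rintro rfl; simp at him)
    obtain ⟨⟨h1, h2⟩, -⟩ := h (p.ω₂ k) hk h0 (by rwa [K_ω₂ hp hk him])
    rw [K_ω₂ hp hk him] at h1 h2
    rw [Δ₁_eq hp, Δ₂_eq hp, ω₁_eq_dual hp hk, ne_eq, dual_eq_iff hp hk h0]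
    exact ⟨h2, fun _ => h1⟩
  refine ⟨κ₀, by linarith, fun R hR k hk => ?_⟩
  obtain ⟨h1, h2⟩ := mem_closure_D₀ hp hk
  have hk0 : k ≠ 0 := by
    rintro rfl; rw [norm_zero] at h2; linarith
  rcases (im_ne_zero_of_re_ω₂ hp hk0 h1).lt_or_gt with him | him
  · have := key (-k) (by rwa [ω₂_neg]) (by simpa using him) (by rw [norm_neg]; linarith)
    rw [ω₁_neg, ω₂_neg, Δ₁_eq hp, Δ₂_eq hp, ω₁_neg, ω₂_neg, det_neg, det_neg, neg_ne_zero,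
      neg_ne_zero] at this
    rwa [Δ₁_eq hp, Δ₂_eq hp]
  · exact key k h1 him (by linarith)

theorem PoleFree.det_ne (hp : p.Admissible) {R : ℝ} (h : p.PoleFree R) {ω : ℂ}
    (hω : ω ∈ p.region R) : p.det p.γ0 p.γl ω (p.K ω) ≠ 0 := by
  have h1 := (h _ (K_mem_closure_D₀ hp hω.1 hω.2.1 hω.2.2)).2
  rw [Δ₂_eq hp, ω₂_K hp hω.1] at h1
  refine h1 fun h2 => ?_
  have h3 : ω.re = 1 / p.τ := by
    rw [h2]
    have : (1 / p.τ : ℂ) = ((1 / p.τ : ℝ) : ℂ) := by push_cast; rfl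
    rw [this, Complex.ofReal_re]
  have := hω.1
  rw [h3] at this
  linarith [one_div_pos.2 hp.τ_pos]

theorem PoleFree.det_dual_ne (hp : p.Admissible) {R : ℝ} (h : p.PoleFree R)
    (hne : p.α * p.τ ≠ p.μ ^ 2) {ω : ℂ} (hω : ω ∈ p.region R) :
    p.det p.γ0 p.γl (p.dual ω) (p.K ω) ≠ 0 := by
  have h1 := (h _ (K_mem_closure_D₀ hp hω.1 hω.2.1 hω.2.2)).1
  rw [Δ₁_eq hp, ω₁_K hp hω.1, ne_eq, dual_eq_iff hp hω.1 hω.2.1] at h1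
  exact h1 hne

theorem IntegrableUpper.sub {R : ℝ} {F G : ℂ → Fin 2 → ℂ} (hF : p.IntegrableUpper R F)
    (hG : p.IntegrableUpper R G) : p.IntegrableUpper R (fun k => F k - G k) ∧
      p.integralUpper R (fun k => F k - G k) = p.integralUpper R F - p.integralUpper R G := by
  simp only [IntegrableUpper, integralUpper, smul_sub]
  refine ⟨⟨hF.1.sub hG.1, hF.2.sub hG.2⟩, ?_⟩
  rw [integral_sub hF.1 hG.1, integral_sub hF.2 hG.2]
  abel

theorem neg_mem_D {k : ℂ} : -k ∈ p.D ↔ k ∈ p.D := by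
  simp only [D, mem_ofPred_eq, ω₁_neg, ω₂_neg]

theorem mul_exp_sub_pi (R y : ℝ) :
    (R * Complex.exp (I * ((y - Real.pi : ℝ) : ℂ)) : ℂ) = -(R * Complex.exp (I * y)) := by
  have : I * ((y - Real.pi : ℝ) : ℂ) = I * y - Real.pi * I := by push_cast; ring
  rw [this, Complex.exp_sub, Complex.exp_pi_mul_I]; ring

theorem arc_Dminus {R : ℝ} (hR : 0 < R) :
    {y : ℝ | y ∈ Ioc (-Real.pi) Real.pi ∧ R * Complex.exp (I * y) ∈ p.Dplus}
      = (fun y : ℝ => y - Real.pi) ⁻¹'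
        {y : ℝ | y ∈ Ioc (-Real.pi) Real.pi ∧ R * Complex.exp (I * y) ∈ p.Dminus} := by
  have hpi := Real.pi_pos
  ext y
  simp only [mem_preimage, mem_ofPred_eq, Dplus, Dminus, mul_exp_sub_pi, neg_mem_D, mem_Ioc,
    im_mul_exp, Real.sin_sub_pi, mul_neg, neg_lt_zero, mul_pos_iff_of_pos_left hR]
  constructor
  · rintro ⟨⟨h1, h2⟩, h3, h4⟩
    refine ⟨⟨?_, by linarith⟩, h3, h4⟩
    by_contra! h
    have := Real.sin_nonpos_of_nonpos_of_neg_pi_le (x := y) (by linarith) h1.le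
    linarith
  · rintro ⟨⟨h1, h2⟩, h3, h4⟩
    refine ⟨⟨by linarith, ?_⟩, h3, h4⟩
    by_contra! h
    have := Real.sin_nonneg_of_nonneg_of_le_pi (x := y - Real.pi) (by linarith) (by linarith)
    rw [Real.sin_sub_pi] at this
    linarith

/-- `k ↦ -k` carries one contour onto the other, shifting the angle on the arc by `π`; the sign
comes from `dk`. -/
theorem integralLower_eq {R : ℝ} (hR : 0 < R) {F : ℂ → Fin 2 → ℂ}
    (h : p.IntegrableUpper R fun k => F (-k)) :
    p.IntegrableLower R F ∧ p.integralLower R F = -p.integralUpper R fun k => F (-k) := by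
  have hmp := measurePreserving_sub_right (volume : Measure ℝ) Real.pi
  have hemb : MeasurableEmbedding fun y : ℝ => y - Real.pi :=
    (MeasurableEquiv.subRight Real.pi).measurableEmbedding
  have e : (fun y : ℝ => (I * (R * Complex.exp (I * y))) • F (R * Complex.exp (I * y)))
      ∘ (fun y : ℝ => y - Real.pi) = fun y : ℝ =>
        -((I * (R * Complex.exp (I * y))) • F (-(R * Complex.exp (I * y)))) := by
    funext y
    simp only [Function.comp, mul_exp_sub_pi, mul_neg, neg_smul]
  have h2 := h.2
  rw [arc_Dminus hR] at h2
  refine ⟨⟨?_, ?_⟩, ?_⟩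
  · simp only [neg_smul]; exact h.1.neg
  · rw [← hmp.integrableOn_comp_preimage hemb, e]
    exact h2.neg
  · have h3 := hmp.setIntegral_preimage_emb hemb
      (fun y : ℝ => (I * (R * Complex.exp (I * y))) • F (R * Complex.exp (I * y)))
      {y : ℝ | y ∈ Ioc (-Real.pi) Real.pi ∧ R * Complex.exp (I * y) ∈ p.Dminus}
    have h4 (y : ℝ) := congrFun e y
    simp only [Function.comp] at h4
    simp only [h4, integral_neg] at h3
    rw [integralLower, integralUpper, ← h3, arc_Dminus hR]
    simp only [neg_smul, integral_neg]
    abel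

end Params

/-- For `0 ≤ x ≤ l` both `e^{ikx}` and `e^{ik(l-x)}` are bounded in the upper half-plane. This and
`norm_exp_mul_hat_le` are the two forms in which the solution at time `t` enters the corrections. -/
theorem norm_hat_neg_le {l M : ℝ} (hl : 0 < l) {y : ℝ → ℝ} (hy : ∀ x ∈ Icc 0 l, |y x| ≤ M) {k : ℂ}
    (hk : 0 ≤ k.im) : ‖hat l y (-k)‖ ≤ M * l := by
  have h := intervalIntegral.norm_integral_le_of_norm_le_const (a := 0) (b := l) (C := M)
    (f := fun x : ℝ => Complex.exp (-(I * -k * x)) * (y x : ℂ)) fun x hx => ?_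
  · rwa [sub_zero, abs_of_pos hl] at h
  · rw [uIoc_of_le hl.le] at hx
    have e : -(I * -k * x) = I * k * x := by ring
    rw [norm_mul, e, norm_exp_I_mul, Complex.norm_real, Real.norm_eq_abs]
    have h1 : Real.exp (-(x * k.im)) ≤ 1 := Real.exp_le_one_iff.2 (by nlinarith [hx.1])
    have h2 := hy x (Ioc_subset_Icc_self hx)
    calc _ ≤ 1 * M := by gcongr
      _ = M := one_mul M

theorem norm_exp_mul_hat_le {l M : ℝ} (hl : 0 < l) {y : ℝ → ℝ} (hy : ∀ x ∈ Icc 0 l, |y x| ≤ M)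
    {k : ℂ} (hk : 0 ≤ k.im) : ‖Complex.exp (I * k * l) * hat l y k‖ ≤ M * l := by
  have h := intervalIntegral.norm_integral_le_of_norm_le_const (a := 0) (b := l) (C := M)
    (f := fun x : ℝ => Complex.exp (I * k * l) * (Complex.exp (-(I * k * x)) * (y x : ℂ)))
    fun x hx => ?_
  · rwa [sub_zero, abs_of_pos hl, intervalIntegral.integral_const_mul] at h
  · rw [uIoc_of_le hl.le] at hx
    have e : I * k * l + -(I * k * x) = I * k * ((l - x : ℝ) : ℂ) := by push_cast; ring
    rw [← mul_assoc, ← Complex.exp_add, norm_mul, e, norm_exp_I_mul, Complex.norm_real,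
      Real.norm_eq_abs]
    have h1 : Real.exp (-((l - x) * k.im)) ≤ 1 := Real.exp_le_one_iff.2 (by nlinarith [hx.2])
    have h2 := hy x (Ioc_subset_Icc_self hx)
    calc _ ≤ 1 * M := by gcongr
      _ = M := one_mul M

namespace IsSolution

open Params

variable {p : Params} {d : Data} {e q : ℝ → ℝ → ℝ}

/-- The functions `u`, `v` with `remainder = (a - 1/τ) u + i k v` and their bounds. -/
theorem exists_bound_remainder (hp : p.Admissible) (hs : IsSolution p d e q) {t : ℝ} (ht : 0 ≤ t) :
    ∃ (u v u' v' : ℂ → ℂ) (M : ℝ), Differentiable ℂ u ∧ Differentiable ℂ v ∧ Differentiable ℂ u' ∧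
      Differentiable ℂ v' ∧
      (∀ k : ℂ, 0 ≤ k.im → ‖u k‖ ≤ M ∧ ‖v k‖ ≤ M ∧ ‖u' k‖ ≤ M ∧ ‖v' k‖ ≤ M) ∧
      (∀ a k, Complex.exp (I * k * p.l) * remainder p e q t a k
        = (a - 1 / p.τ) * u k + I * k * v k) ∧
      ∀ a k, remainder p e q t a (-k) = (a - 1 / p.τ) * u' k + I * k * v' k := by
  have hl := hp.l_pos
  have hθ := θ_pos hp
  have c1 := continuousOn_slice_left hs.continuousOn_e ht
  have c2 := continuousOn_slice_left hs.continuousOn_q ht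
  have c3 := continuousOn_slice_left hs.e_dx.2 ht
  obtain ⟨M₁, h1⟩ := isCompact_Icc.exists_bound_of_continuousOn c1
  obtain ⟨M₂, h2⟩ := isCompact_Icc.exists_bound_of_continuousOn c2
  obtain ⟨M₃, h3⟩ := isCompact_Icc.exists_bound_of_continuousOn c3
  have h0 : (0 : ℝ) ∈ Icc 0 p.l := left_mem_Icc.2 hl.le
  have m1 : 0 ≤ M₁ := (norm_nonneg _).trans (h1 0 h0)
  have m2 : 0 ≤ M₂ := (norm_nonneg _).trans (h2 0 h0)
  have m3 : 0 ≤ M₃ := (norm_nonneg _).trans (h3 0 h0)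
  have d1 := differentiable_hat hl c1
  have d2 := differentiable_hat hl c2
  have d3 := differentiable_hat hl c3
  have hneg : Differentiable ℂ fun k : ℂ => -k := differentiable_neg
  have dE : Differentiable ℂ fun k : ℂ => Complex.exp (I * k * p.l) := by fun_prop
  have hθn : ‖(p.θ : ℂ)‖ = p.θ := by rw [Complex.norm_real, Real.norm_eq_abs, abs_of_pos hθ]
  have b2 : 0 ≤ M₂ * p.l := by positivity
  have b1 : 0 ≤ M₁ * p.l := by positivity
  have b3 : 0 ≤ p.θ * (M₃ * p.l) := by positivity
  refine ⟨fun k => Complex.exp (I * k * p.l) * hat p.l (fun x => e x t) k,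
    fun k => Complex.exp (I * k * p.l) * hat p.l (fun x => q x t) k
      + p.θ * (Complex.exp (I * k * p.l) * hat p.l (fun x => dx p.l e x t) k),
    fun k => hat p.l (fun x => e x t) (-k),
    fun k => -(hat p.l (fun x => q x t) (-k) + p.θ * hat p.l (fun x => dx p.l e x t) (-k)),
    M₁ * p.l + (M₂ * p.l + p.θ * (M₃ * p.l)), dE.mul d1,
    (dE.mul d2).add ((dE.mul d3).const_mul _), d1.comp hneg,
    ((d2.comp hneg).add ((d3.comp hneg).const_mul _)).neg, fun k hk => ⟨?_, ?_, ?_, ?_⟩,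
    fun a k => ?_, fun a k => ?_⟩
  · linarith [norm_exp_mul_hat_le hl h1 hk]
  · refine (norm_add_le _ _).trans ?_
    rw [norm_mul (p.θ : ℂ), hθn]
    have := mul_le_mul_of_nonneg_left (norm_exp_mul_hat_le hl h3 hk) hθ.le
    linarith [norm_exp_mul_hat_le hl h2 hk]
  · linarith [norm_hat_neg_le hl h1 hk]
  · rw [norm_neg]
    refine (norm_add_le _ _).trans ?_
    rw [norm_mul (p.θ : ℂ), hθn]
    have := mul_le_mul_of_nonneg_left (norm_hat_neg_le hl h3 hk) hθ.le
    linarith [norm_hat_neg_le hl h2 hk]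
  · rw [remainder]; ring
  · rw [remainder]; ring

/-- The determinant condition of `leftCoeff_eq` and `rightCoeff_eq` on the contour. -/
theorem det_or (hp : p.Admissible) {R : ℝ} (h : p.PoleFree R) {ω : ℂ} (hω : ω ∈ p.region R)
    (γ : ℝ) : p.det p.γ0 p.γl (p.dual ω) (p.K ω) ≠ 0 ∨ p.sig γ (p.dual ω) (p.K ω) = 0 := by
  by_cases hne : p.α * p.τ = p.μ ^ 2
  · exact Or.inr (sig_dual_eq_zero hp γ (den_ne hp hω.1) hne _)
  · exact Or.inl (h.det_dual_ne hp hne hω)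

/-- On the contour the two integrands add up to the correction alone, whose integral vanishes. So
the known `a'` may replace the unknown boundary integral with the opposite sign. -/
theorem integralUpper_upperIntegrand (hp : p.Admissible) (hs : IsSolution p d e q) {R : ℝ}
    (hR : 0 < R) (hpole : p.PoleFree R) {x t : ℝ} (hx : 0 < x) (ht : 0 ≤ t)
    (hI : p.IntegrableUpper R
      (fun k => Complex.exp (I * k * x) • p.boundaryInt (q 0) (flux p e q 0) t k)) :
    p.IntegrableUpper R (upperIntegrand p d x t) ∧
      p.integralUpper R (upperIntegrand p d x t) = -p.integralUpper R
        (fun k => Complex.exp (I * k * x) • p.boundaryInt (q 0) (flux p e q 0) t k) := by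
  obtain ⟨ν₀, y₀, hc⟩ := exists_isCorner hp hR
  obtain ⟨u, v, u', v', M, hu, hv, hu', hv', hM, h1, h2⟩ := hs.exists_bound_remainder hp ht
  have h0 : (0 : ℝ) ∈ Icc 0 p.l := left_mem_Icc.2 hp.l_pos.le
  have hsub : Icc 0 t ⊆ Ici 0 := fun s hs => hs.1
  have hcq := (continuousOn_slice_right hs.continuousOn_q h0).mono hsub
  have hcr := (hs.continuousOn_flux h0).mono hsub
  have h := hc.integralUpper_reflection hp hR hp.γ0_nonneg hp.γl_nonneg
    (fun ω hω => hpole.det_ne hp hω) (fun hne ω hω => hpole.det_dual_ne hp hne hω) hu hv hu' hv' hM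
    (c := e 0 t) (ε := 1) norm_one hx (fun a k => rfl) (F := fun k => upperIntegrand p d x t k
      + Complex.exp (I * k * x) • p.boundaryInt (q 0) (flux p e q 0) t k) fun ω hω => ?_
  · have h3 := h.1.sub hI
    simp only [add_sub_cancel_right] at h3
    refine ⟨h3.1, ?_⟩
    rw [h3.2, h.2, zero_sub]
  · have hpair := isPair_K hp hω.1 hω.2.1
    rw [upperIntegrand, aPrime_eq hp, S_mulVec, ω₁_K hp hω.1, ω₂_K hp hω.1,
      hs.leftCoeff_eq hp hpair ht (det_or hp hpole hω _),
      hs.leftCoeff_eq hp hpair.symm ht (Or.inl (hpole.det_ne hp hω)),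
      hpair.boundaryInt_eq ht hcq hcr, ← smul_add, ← eigenSum_add, one_smul, one_mul]
    congr 2
    · rw [reflection, h1, h2]; ring
    · rw [reflection, h1, h2]; ring

/-- The mirror image of the previous argument: the reflection brings a second change of sign, and
the roles of `γ0` and `γl` and of the two remainders are exchanged. -/
theorem integralLower_lowerIntegrand (hp : p.Admissible) (hs : IsSolution p d e q) {R : ℝ}
    (hR : 0 < R) (hpole : p.PoleFree R) {x t : ℝ} (hx : x < p.l) (ht : 0 ≤ t)
    (hI : p.IntegrableUpper R (fun k => Complex.exp (I * k * (p.l - x : ℝ)) •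
      p.boundaryInt (q p.l) (flux p e q p.l) t (-k))) :
    p.IntegrableLower R (lowerIntegrand p d x t) ∧
      p.integralLower R (lowerIntegrand p d x t) = p.integralUpper R
        (fun k => Complex.exp (I * k * (p.l - x : ℝ)) •
          p.boundaryInt (q p.l) (flux p e q p.l) t (-k)) := by
  obtain ⟨ν₀, y₀, hc⟩ := exists_isCorner hp hR
  obtain ⟨u, v, u', v', M, hu, hv, hu', hv', hM, h1, h2⟩ := hs.exists_bound_remainder hp ht
  have h0 : p.l ∈ Icc 0 p.l := right_mem_Icc.2 hp.l_pos.le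
  have hsub : Icc 0 t ⊆ Ici 0 := fun s hs => hs.1
  have hcq := (continuousOn_slice_right hs.continuousOn_q h0).mono hsub
  have hcr := (hs.continuousOn_flux h0).mono hsub
  have h := hc.integralUpper_reflection hp hR hp.γl_nonneg hp.γ0_nonneg
    (fun ω hω => by rw [det_comm]; exact hpole.det_ne hp hω)
    (fun hne ω hω => by rw [det_comm]; exact hpole.det_dual_ne hp hne hω) hu' hv' hu hv
    (fun k hk => ⟨(hM k hk).2.2.1, (hM k hk).2.2.2, (hM k hk).1, (hM k hk).2.1⟩)
    (c := e p.l t) (ε := -1) (by simp) (sub_pos.2 hx) (fun a k => rfl)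
    (F := fun k => lowerIntegrand p d x t (-k)
      + Complex.exp (I * k * (p.l - x : ℝ)) • p.boundaryInt (q p.l) (flux p e q p.l) t (-k))
    fun ω hω => ?_
  · have h3 := h.1.sub hI
    simp only [add_sub_cancel_right] at h3
    have h4 := integralLower_eq hR h3.1
    refine ⟨h4.1, ?_⟩
    rw [h4.2, h3.2, h.2, zero_sub, neg_neg]
  · have hpair := isPair_K hp hω.1 hω.2.1
    have e1 : I * -p.K ω * (x - p.l) = I * p.K ω * (p.l - x : ℝ) := by push_cast; ring
    rw [lowerIntegrand, bPrime_eq hp, S_mulVec, ω₁_neg, ω₂_neg, ω₁_K hp hω.1, ω₂_K hp hω.1,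
      hs.rightCoeff_eq hp hpair ht (det_or hp hpole hω _),
      hs.rightCoeff_eq hp hpair.symm ht (Or.inl (hpole.det_ne hp hω)),
      hpair.neg.boundaryInt_eq ht hcq hcr, e1, ← smul_add, ← eigenSum_add, neg_one_smul,
      ← eigenSum_neg, neg_one_mul]
    congr 2
    · rw [reflection, h1, h2]; ring
    · rw [reflection, h1, h2]; ring

end IsSolution

end GK

namespace GK

/-! ### The integrals along the real line -/

theorem tendsto_integral_of_le {g : ℝ → Fin 2 → ℂ} (hg : Continuous g) {C N : ℝ}
    (h : ∀ k, N ≤ |k| → ‖g k‖ ≤ C / k ^ 2) :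
    Tendsto (fun z : ℝ × ℝ => ∫ k in z.1..z.2, g k) (atBot ×ˢ atTop) (𝓝 (∫ k, g k)) := by
  have hint : Integrable g := by
    refine hg.locallyIntegrable.integrable_of_isBigO_cocompact (g := fun k : ℝ => (1 + k ^ 2)⁻¹) ?_
      (integrable_inv_one_add_sq.integrableAtFilter _)
    refine Asymptotics.IsBigO.of_bound (2 * |C|) ?_
    have h1 : ∀ᶠ k : ℝ in cocompact ℝ, max N 1 ≤ |k| := by
      have := tendsto_norm_cocompact_atTop (E := ℝ)
      exact this.eventually_ge_atTop _
    filter_upwards [h1] with k hk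
    have hk1 : 1 ≤ |k| := (le_max_right _ _).trans hk
    have hk2 : 1 ≤ k ^ 2 := by rw [← sq_abs]; exact one_le_pow₀ hk1
    refine (h k ((le_max_left _ _).trans hk)).trans ?_
    have h4 : (0 : ℝ) < k ^ 2 := by linarith
    rw [norm_inv, Real.norm_eq_abs, abs_of_pos (by positivity : (0 : ℝ) < 1 + k ^ 2),
      ← div_eq_mul_inv, div_le_div_iff₀ h4 (by positivity)]
    have h2 := le_abs_self C
    have h3 := abs_nonneg C
    calc C * (1 + k ^ 2) ≤ |C| * (k ^ 2 + k ^ 2) := by gcongr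
      _ = _ := by ring
  exact intervalIntegral_tendsto_integral hint tendsto_fst tendsto_snd

theorem norm_hat_real_le {l : ℝ} (hl : 0 < l) {y : ℝ → ℝ} (hy : DifferentiableOn ℝ y (Icc 0 l))
    (hy' : ContinuousOn (derivWithin y (Icc 0 l)) (Icc 0 l)) :
    ∃ Y : ℝ, 0 ≤ Y ∧ ∀ k : ℝ, 1 ≤ |k| → ‖hat l y k‖ ≤ Y / |k| := by
  obtain ⟨M, hM⟩ := isCompact_Icc.exists_bound_of_continuousOn hy'
  have hM0 : 0 ≤ M := (norm_nonneg _).trans (hM 0 (left_mem_Icc.2 hl.le))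
  refine ⟨|y l| + |y 0| + M * l, by positivity, fun k hk => ?_⟩
  have hk0 : 0 < |k| := by linarith
  have h := hat_derivWithin hl hy hy' k
  have h1 : ‖hat l (derivWithin y (Icc 0 l)) k‖ ≤ M * l := by
    have := norm_hat_neg_le hl hM (k := -(k : ℂ)) (by simp)
    rwa [neg_neg] at this
  have h2 : ‖Complex.exp (-(I * k * l))‖ = 1 := by
    have : -(I * k * l) = ((-(k * l) : ℝ) : ℂ) * I := by push_cast; ring
    rw [this, Complex.norm_exp_ofReal_mul_I]
  have h3 : I * k * hat l y k
      = hat l (derivWithin y (Icc 0 l)) k - Complex.exp (-(I * k * l)) * y l + y 0 := by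
    rw [h]; ring
  have h4 := congrArg norm h3
  rw [norm_mul, norm_mul, Complex.norm_I, one_mul, Complex.norm_real, Real.norm_eq_abs] at h4
  rw [le_div_iff₀ hk0, mul_comm, h4]
  refine (norm_add_le _ _).trans ?_
  have h5 := norm_sub_le (hat l (derivWithin y (Icc 0 l)) k) (Complex.exp (-(I * k * l)) * y l)
  rw [norm_mul, h2, one_mul, Complex.norm_real, Real.norm_eq_abs] at h5
  rw [Complex.norm_real, Real.norm_eq_abs]
  linarith

theorem norm_exp_sub_exp_le {z w : ℂ} (h : ‖z - w‖ ≤ 1) :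
    ‖Complex.exp z - Complex.exp w‖ ≤ Real.exp w.re * (2 * ‖z - w‖) := by
  have : Complex.exp z - Complex.exp w = Complex.exp w * (Complex.exp (z - w) - 1) := by
    rw [mul_sub, ← Complex.exp_add, mul_one, add_sub_cancel]
  rw [this, norm_mul, Complex.norm_exp]
  gcongr
  exact Complex.norm_exp_sub_one_le h

namespace Params

variable {p : Params}

/-- The leading behaviour of `e^{-tΛ(k)} v` for large real `k`. -/
theorem exists_norm_exp_sub_le (hp : p.Admissible) {t Y : ℝ} (ht : 0 < t) (hY : 0 ≤ Y) :
    ∃ C N : ℝ, ∀ (k : ℝ) (v : Fin 2 → ℂ), N ≤ |k| → ‖v 0‖ ≤ Y / |k| → ‖v 1‖ ≤ Y / |k| →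
      ‖(NormedSpace.exp (-(t : ℂ) • p.Lam k)).mulVec v
        - (Complex.exp (-(p.β / p.θ * t)) * v 0) • ![1, 0]‖ ≤ C / k ^ 2 := by
  obtain ⟨k₀, B, hk₀, hB, hpair⟩ := exists_pair hp
  have hβ := β_pos hp
  have hθ := θ_pos hp
  -- The bounded root tends to `β/θ`: from `θ a (b - β/θ) = -β (a - θk²)` and `|a| ≥ θ|k|²/4` the
  -- distance is at most `D / |k|²`.
  set D : ℝ := 4 * p.β * B / p.θ ^ 2 with hD
  have hD0 : 0 ≤ D := by positivity
  set A : ℝ := p.θ + B with hA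
  have hA0 : 0 < A := by positivity
  set G : ℝ := Real.exp (B * t) with hG
  have hG0 : 0 < G := Real.exp_pos _
  set C₁ : ℝ := G / (p.θ * t) * ((B + 1) * Y) + G * Y + 2 * D * t * A * Y + B * Y with hC₁
  set C₂ : ℝ := G / (p.θ * t) * ((B + 1) * Y) * A + G * ((A * Y + Y) * B) with hC₂
  have hC₁0 : 0 ≤ C₁ := by positivity
  have hC₂0 : 0 ≤ C₂ := by positivity
  refine ⟨2 / p.θ * (C₁ + C₂), k₀ + 4 * B / p.θ + D * t, fun k v hk hv0 hv1 => ?_⟩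
  have e1 : 0 ≤ 4 * B / p.θ := by positivity
  have e2 : 0 ≤ D * t := by positivity
  have hkn : ‖(k : ℂ)‖ = |k| := by rw [Complex.norm_real, Real.norm_eq_abs]
  obtain ⟨a, b, hab, hb, ha, hd, ha2⟩ := hpair k (by rw [hkn]; linarith)
  rw [hkn] at hd ha2
  have hk1 : 1 ≤ |k| := by linarith
  have hk0 : 0 < |k| := by linarith
  have hkk : |k| ≤ |k| ^ 2 := by nlinarith
  have hk2 : 0 < |k| ^ 2 := by positivity
  have hksq : |k| ^ 2 = k ^ 2 := sq_abs k
  have hY1 : Y / |k| ≤ Y := div_le_self hY hk1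
  have hθk : ‖(p.θ * k ^ 2 : ℂ)‖ = p.θ * |k| ^ 2 := by
    rw [norm_mul, norm_pow, hkn, Complex.norm_real, Real.norm_eq_abs, abs_of_pos hθ]
  have ha3 : p.θ * |k| ^ 2 * (3 / 4) ≤ ‖a‖ := by
    have h1 := norm_sub_norm_le (p.θ * k ^ 2 : ℂ) a
    rw [norm_sub_rev, hθk] at h1
    have h2 : 4 * B / p.θ ≤ |k| ^ 2 := by linarith
    rw [div_le_iff₀ hθ] at h2
    linarith
  have hbd : ‖b - p.β / p.θ‖ ≤ D / |k| ^ 2 := by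
    have hθ' : (p.θ : ℂ) ≠ 0 := by exact_mod_cast hθ.ne'
    have h1 : p.θ * a * (b - p.β / p.θ) = -(p.β * (a - p.θ * k ^ 2)) := by
      field_simp
      linear_combination p.θ * hab.mul
    have h2 := congrArg norm h1
    rw [norm_neg, norm_mul, norm_mul, norm_mul, Complex.norm_real, Complex.norm_real,
      Real.norm_eq_abs, Real.norm_eq_abs, abs_of_pos hθ, abs_of_pos hβ] at h2
    have h3 : p.θ * (p.θ * |k| ^ 2 / 4) * ‖b - p.β / p.θ‖ ≤ p.β * B := by
      calc p.θ * (p.θ * |k| ^ 2 / 4) * ‖b - p.β / p.θ‖ ≤ p.θ * ‖a‖ * ‖b - p.β / p.θ‖ := by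
            gcongr
            have : 0 ≤ p.θ * |k| ^ 2 := by positivity
            linarith
        _ = p.β * ‖a - p.θ * k ^ 2‖ := h2
        _ ≤ _ := by gcongr
    rw [hD, le_div_iff₀ hk2, le_div_iff₀ (by positivity)]
    linarith
  -- the exponentials
  have hre : p.θ * |k| ^ 2 - B ≤ a.re := by
    have h1 := (Complex.abs_re_le_norm _).trans ha
    have h2 : (a - p.θ * k ^ 2 : ℂ).re = a.re - p.θ * |k| ^ 2 := by
      rw [hksq, Complex.sub_re]
      have : (p.θ * k ^ 2 : ℂ) = ((p.θ * k ^ 2 : ℝ) : ℂ) := by push_cast; rfl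
      rw [this, Complex.ofReal_re]
    rw [h2] at h1
    linarith [(abs_le.1 h1).1]
  have hEa : ‖Complex.exp (-(a * t))‖ ≤ G / (p.θ * t) / |k| ^ 2 := by
    rw [norm_exp_neg_mul]
    have h1 := pow_mul_exp_neg_le 1 (mul_pos hθ ht) hk2.le
    rw [pow_one, pow_one, Nat.factorial_one, Nat.cast_one] at h1
    have h2 : Real.exp (-(a.re * t)) ≤ G * Real.exp (-(p.θ * t * |k| ^ 2)) := by
      rw [hG, ← Real.exp_add]
      refine Real.exp_le_exp.2 ?_
      have := mul_le_mul_of_nonneg_right hre ht.le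
      linarith
    refine h2.trans ?_
    rw [le_div_iff₀ hk2]
    calc G * Real.exp (-(p.θ * t * |k| ^ 2)) * |k| ^ 2
        = G * (|k| ^ 2 * Real.exp (-(p.θ * t * |k| ^ 2))) := by ring
      _ ≤ G * (1 / (p.θ * t)) := by gcongr
      _ = _ := by ring
  have hEb : ‖Complex.exp (-(b * t))‖ ≤ G := by
    rw [norm_exp_neg_mul]
    refine Real.exp_le_exp.2 ?_
    have h1 : -b.re ≤ B := (neg_le_abs _).trans ((Complex.abs_re_le_norm b).trans hb)
    have := mul_le_mul_of_nonneg_right h1 ht.le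
    linarith
  have hωre : (-(p.β / p.θ * t) : ℂ).re ≤ 0 := by
    have : (-(p.β / p.θ * t) : ℂ) = ((-(p.β / p.θ * t) : ℝ) : ℂ) := by push_cast; rfl
    rw [this, Complex.ofReal_re]
    have : 0 ≤ p.β / p.θ * t := by positivity
    linarith
  have hE1 : ‖Complex.exp (-(p.β / p.θ * t))‖ ≤ 1 := by
    rw [Complex.norm_exp]; exact Real.exp_le_one_iff.2 hωre
  have hEd : ‖Complex.exp (-(b * t)) - Complex.exp (-(p.β / p.θ * t))‖
      ≤ 2 * D * t / |k| ^ 2 := by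
    have h1 : ‖-(b * t) - -(p.β / p.θ * t : ℂ)‖ ≤ D * t / |k| ^ 2 := by
      have : -(b * t) - -(p.β / p.θ * t : ℂ) = -((b - p.β / p.θ) * t) := by ring
      rw [this, norm_neg, norm_mul, Complex.norm_real, Real.norm_eq_abs, abs_of_pos ht,
        mul_div_right_comm]
      gcongr
    have h2 : D * t / |k| ^ 2 ≤ 1 := by
      rw [div_le_one hk2]; linarith
    refine (norm_exp_sub_exp_le (h1.trans h2)).trans ?_
    have h3 : Real.exp (-(p.β / p.θ * t) : ℂ).re ≤ 1 := Real.exp_le_one_iff.2 hωre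
    calc _ ≤ 1 * (2 * (D * t / |k| ^ 2)) := by gcongr
      _ = _ := by ring
  -- the coordinates
  have hIk : ‖I * (k : ℂ)‖ = |k| := by rw [norm_mul, Complex.norm_I, one_mul, hkn]
  have hψ : ‖I * (k : ℂ) * v 1‖ ≤ Y := by
    rw [norm_mul, hIk]
    calc |k| * ‖v 1‖ ≤ |k| * (Y / |k|) := by gcongr
      _ = Y := by field_simp
  have hca : ‖coord k b v‖ ≤ (B + 1) * Y := by
    refine (norm_add_le _ _).trans ?_
    rw [norm_mul (-b), norm_neg]
    have : ‖b‖ * ‖v 0‖ ≤ B * Y := by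
      have := hv0.trans hY1
      gcongr
    linarith
  have haφ : ‖a * v 0‖ ≤ A * Y * |k| := by
    rw [norm_mul]
    calc ‖a‖ * ‖v 0‖ ≤ (A * |k| ^ 2) * (Y / |k|) := by gcongr
      _ = _ := by field_simp
  have hcb : ‖coord k a v‖ ≤ (A * Y + Y) * |k| := by
    refine (norm_add_le _ _).trans ?_
    rw [neg_mul, norm_neg]
    have : Y ≤ Y * |k| := le_mul_of_one_le_right hY hk1
    linarith
  have hab0 : a - b ≠ 0 := sub_ne_zero.2 hab.ne
  have hkC : (k : ℂ) ≠ 0 := hab.k_ne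
  have hden : 0 < p.θ / 2 * |k| ^ 2 := by positivity
  -- Since `|a - b| ≥ θ k²/2`, it suffices to bound the numerators uniformly in `k`.
  have hfin {x : ℂ} {c : ℝ} (hc : 0 ≤ c) (hx : ‖x‖ ≤ c) : ‖x / (a - b)‖ ≤ 2 / p.θ * c / k ^ 2 := by
    rw [norm_div, ← hksq]
    calc ‖x‖ / ‖a - b‖ ≤ c / (p.θ / 2 * |k| ^ 2) := by gcongr
      _ = _ := by field_simp
  have hle {c : ℝ} (hc : c ≤ C₁ + C₂) : 2 / p.θ * c / k ^ 2 ≤ 2 / p.θ * (C₁ + C₂) / k ^ 2 := by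
    gcongr
  refine (pi_norm_le_iff_of_nonneg (by positivity)).2 fun i => ?_
  rw [hab.exp_mulVec_eq]
  fin_cases i
  · have e : (eigenSum (k : ℂ) a b (Complex.exp (-(a * t)) * coord k b v)
        (Complex.exp (-(b * t)) * coord k a v)
        - (Complex.exp (-(p.β / p.θ * t)) * v 0) • (![1, 0] : Fin 2 → ℂ)) 0
        = (Complex.exp (-(a * t)) * coord k b v - Complex.exp (-(b * t)) * (I * k * v 1)
          + (Complex.exp (-(b * t)) - Complex.exp (-(p.β / p.θ * t))) * (a * v 0)
          + Complex.exp (-(p.β / p.θ * t)) * (b * v 0)) / (a - b) := by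
      simp [eigenSum, coord]
      field_simp
      ring
    refine (le_of_eq (congrArg norm e)).trans ((hfin hC₁0 ?_).trans (hle (by linarith)))
    refine (norm_add_le _ _).trans (add_le_add ((norm_add_le _ _).trans
      (add_le_add ((norm_sub_le _ _).trans (add_le_add ?_ ?_)) ?_)) ?_)
    · rw [norm_mul]
      have : G / (p.θ * t) / |k| ^ 2 ≤ G / (p.θ * t) :=
        div_le_self (by positivity) (by linarith)
      have := hEa.trans this
      gcongr
    · rw [norm_mul]; gcongr
    · rw [norm_mul]
      calc _ ≤ 2 * D * t / |k| ^ 2 * (A * Y * |k|) := by gcongr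
        _ = 2 * D * t * A * Y / |k| := by field_simp
        _ ≤ _ := div_le_self (by positivity) hk1
    · rw [norm_mul, norm_mul]
      have := hv0.trans hY1
      calc _ ≤ 1 * (B * Y) := by gcongr
        _ = _ := one_mul _
  · have e : (eigenSum (k : ℂ) a b (Complex.exp (-(a * t)) * coord k b v)
        (Complex.exp (-(b * t)) * coord k a v)
        - (Complex.exp (-(p.β / p.θ * t)) * v 0) • (![1, 0] : Fin 2 → ℂ)) 1
        = ((Complex.exp (-(a * t)) * coord k b v * a - Complex.exp (-(b * t)) * (coord k a v * b))
          / (I * k)) / (a - b) := by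
      simp [eigenSum]
      field_simp
    refine (le_of_eq (congrArg norm e)).trans ((hfin hC₂0 ?_).trans (hle (by linarith)))
    rw [norm_div, hIk, div_le_iff₀ hk0]
    refine (norm_sub_le _ _).trans ?_
    rw [hC₂, add_mul]
    refine add_le_add ?_ ?_
    · rw [norm_mul, norm_mul]
      calc _ ≤ G / (p.θ * t) / |k| ^ 2 * ((B + 1) * Y) * (A * |k| ^ 2) := by gcongr
        _ = G / (p.θ * t) * ((B + 1) * Y) * A := by field_simp
        _ ≤ _ := le_mul_of_one_le_right (by positivity) hk1
    · rw [norm_mul, norm_mul]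
      calc _ ≤ G * ((A * Y + Y) * |k| * B) := by gcongr
        _ = _ := by ring

end Params

open Params

theorem tendsto_integral_pi {F : ℝ → Fin 2 → ℂ} (hF : Continuous F) {A : Fin 2 → ℂ}
    (h : ∀ i, Tendsto (fun z : ℝ × ℝ => ∫ k in z.1..z.2, F k i) (atBot ×ˢ atTop) (𝓝 (A i))) :
    Tendsto (fun z : ℝ × ℝ => ∫ k in z.1..z.2, F k) (atBot ×ˢ atTop) (𝓝 A) := by
  refine tendsto_pi_nhds.2 fun i => (h i).congr fun z => ?_
  exact (ContinuousLinearMap.proj (R := ℂ) (φ := fun _ : Fin 2 => ℂ) i).intervalIntegral_comp_comm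
    (hF.intervalIntegrable _ _)

namespace IsSolution

variable {p : Params} {d : Data} {e q : ℝ → ℝ → ℝ}

theorem continuous_uHat (hp : p.Admissible) (hs : IsSolution p d e q) {t : ℝ} (ht : 0 ≤ t) :
    Continuous fun k : ℝ => uHat p e q k t := by
  have h := (hs.continuousOn_uHat hp).comp_continuous (f := fun k : ℝ => ((k : ℂ), t))
    (by fun_prop) fun k => ⟨mem_univ _, ht⟩
  exact h

theorem tendsto_integral_uHat (hp : p.Admissible) (hs : IsSolution p d e q) {x t : ℝ}
    (hx : x ∈ Ioo 0 p.l) (ht : 0 ≤ t) :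
    Tendsto (fun z : ℝ × ℝ => ∫ k in z.1..z.2, Complex.exp (I * (k : ℝ) * x) • uHat p e q k t)
      (atBot ×ˢ atTop) (𝓝 ((2 * Real.pi : ℂ) • ![(e x t : ℂ), (q x t : ℂ)])) := by
  have hc : Continuous fun k : ℝ => Complex.exp (I * (k : ℝ) * x) • uHat p e q k t :=
    (by fun_prop : Continuous fun k : ℝ => Complex.exp (I * (k : ℝ) * x)).smul
      (hs.continuous_uHat hp ht)
  refine tendsto_integral_pi hc fun i => ?_
  fin_cases i
  · have h := tendsto_fourier_inversion hx (hs.e_dx.1 t ht) (continuousOn_slice_left hs.e_dx.2 ht)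
    simpa [uHat] using h
  · have h := tendsto_fourier_inversion hx (hs.q_dx.1 t ht) (continuousOn_slice_left hs.q_dx.2 ht)
    simpa [uHat] using h

/-- The bounded root gives no decay in `k`, so convergence may be only conditional. Up to an
absolutely integrable error of order `k⁻²` the integrand is `e^{-βt/θ} e^{ikx} φ̂(k)` in the first
component, and Fourier inversion supplies its improper integral. -/
theorem exists_tendsto_initial (hp : p.Admissible) (hs : IsSolution p d e q) {x t : ℝ}
    (hx : x ∈ Ioo 0 p.l) (ht : 0 < t) :
    ∃ A : Fin 2 → ℂ, HasImproperIntegral (initialIntegrand p d x t) A := by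
  have hl := hp.l_pos
  have hu : Continuous fun k : ℝ => u0Hat p d k := by
    refine (hs.continuous_uHat hp le_rfl).congr fun k => hs.uHat_zero hp k
  have hexp : Continuous fun k : ℝ => Complex.exp (I * (k : ℝ) * x) := by fun_prop
  have hLam : Continuous fun k : ℝ => -(t : ℂ) • p.Lam k :=
    (continuous_Lam.comp Complex.continuous_ofReal).const_smul (-(t : ℂ))
  have hc : Continuous (initialIntegrand p d x t) := hexp.smul (continuous_exp_mulVec hLam hu)
  obtain ⟨Y₁, hY₁, h1⟩ := norm_hat_real_le hl (hs.e_dx.1 0 (mem_Ici.2 le_rfl))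
    (continuousOn_slice_left hs.e_dx.2 le_rfl)
  obtain ⟨Y₂, hY₂, h2⟩ := norm_hat_real_le hl (hs.q_dx.1 0 (mem_Ici.2 le_rfl))
    (continuousOn_slice_left hs.q_dx.2 le_rfl)
  obtain ⟨C, N, hb⟩ := exists_norm_exp_sub_le hp ht (add_nonneg hY₁ hY₂)
  set E : ℂ := Complex.exp (-(p.β / p.θ * t)) with hE
  set G : ℝ → Fin 2 → ℂ := fun k => Complex.exp (I * (k : ℝ) * x) •
    ((E * u0Hat p d k 0) • ![1, 0]) with hG
  have hGc : Continuous G := by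
    have h : Continuous fun k : ℝ => E * u0Hat p d k 0 :=
      continuous_const.mul ((continuous_apply 0).comp hu)
    fun_prop
  have hdiff := tendsto_integral_of_le (hc.sub hGc) (C := C) (N := max N 1) fun k hk => ?_
  · have hG' : Tendsto (fun z : ℝ × ℝ => ∫ k in z.1..z.2, G k) (atBot ×ˢ atTop)
        (𝓝 ![E * (2 * Real.pi * e x 0), 0]) := by
      refine tendsto_integral_pi hGc fun i => ?_
      have h := tendsto_fourier_inversion hx (hs.e_dx.1 0 (mem_Ici.2 le_rfl))
        (continuousOn_slice_left hs.e_dx.2 le_rfl)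
      fin_cases i
      · refine (h.const_mul E).congr fun z => ?_
        rw [← intervalIntegral.integral_const_mul]
        refine intervalIntegral.integral_congr fun k _ => ?_
        have : u0Hat p d k 0 = hat p.l (fun x => e x 0) k := by
          rw [← hs.uHat_zero hp]; rfl
        simp only [hG, Fin.zero_eta, Pi.smul_apply, Matrix.cons_val_zero, smul_eq_mul, mul_one,
          this]
        ring
      · simp [hG]
    refine ⟨_, fun a b => hc.intervalIntegrable _ _, (hdiff.add hG').congr fun z => ?_⟩
    rw [← intervalIntegral.integral_add ((hc.sub hGc).intervalIntegrable _ _)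
      (hGc.intervalIntegrable _ _)]
    simp
  · have hk1 : 1 ≤ |k| := (le_max_right _ _).trans hk
    have hk0 : 0 < |k| := by linarith
    have hexp1 : ‖Complex.exp (I * (k : ℝ) * x)‖ = 1 := by
      rw [norm_exp_I_mul]; simp
    simp only [Pi.sub_apply, hG, initialIntegrand]
    rw [← smul_sub, norm_smul, hexp1, one_mul]
    refine hb k _ ((le_max_left _ _).trans hk) ?_ ?_
    · have : u0Hat p d k 0 = hat p.l (fun x => e x 0) k := by
        rw [← hs.uHat_zero hp]; rfl
      rw [this]
      refine (h1 k hk1).trans ?_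
      gcongr; linarith
    · have : u0Hat p d k 1 = hat p.l (fun x => q x 0) k := by
        rw [← hs.uHat_zero hp]; rfl
      rw [this]
      refine (h2 k hk1).trans ?_
      gcongr; linarith

theorem continuous_sourceIntegrand (hp : p.Admissible) (hs : IsSolution p d e q) (x : ℝ) {t : ℝ}
    (ht : 0 ≤ t) : Continuous (sourceIntegrand p d x t) := by
  have hF := (hs.continuousOn_FHat hp).mono (prod_mono (subset_univ _) fun s hs => hs.1 :
    univ ×ˢ Icc 0 t ⊆ univ ×ˢ Ici 0)
  have h := (continuous_intervalIntegral_param ht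
    (F := fun k s => (NormedSpace.exp (-((t : ℂ) - s) • p.Lam k)).mulVec (FHat p d k s))
    (continuousOn_exp_mulVec (p := p) hF)).comp
    Complex.continuous_ofReal
  exact (by fun_prop : Continuous fun k : ℝ => Complex.exp (I * (k : ℝ) * x)).smul h

/-- The source integral needs no estimate of its own: by `uHat_eq` its integrand is a combination of
four others whose improper integrals exist. Its value obtained in this way already is the
representation. -/
theorem integral_representation (hp : p.Admissible) (hs : IsSolution p d e q) {R : ℝ} (hR : 0 < R)
    (hpole : p.PoleFree R) {x t : ℝ} (hx : x ∈ Ioo 0 p.l) (ht : 0 < t) :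
    ∃ A B : Fin 2 → ℂ, HasImproperIntegral (initialIntegrand p d x t) A ∧
      HasImproperIntegral (sourceIntegrand p d x t) B ∧
      p.IntegrableUpper R (upperIntegrand p d x t) ∧
      p.IntegrableLower R (lowerIntegrand p d x t) ∧
      (2 * Real.pi : ℂ) • ![(e x t : ℂ), (q x t : ℂ)] = A + B
        - p.integralUpper R (upperIntegrand p d x t)
        - p.integralLower R (lowerIntegrand p d x t) := by
  have hl := hp.l_pos
  have h0 : (0 : ℝ) ∈ Icc 0 p.l := left_mem_Icc.2 hl.le
  have h1 : p.l ∈ Icc 0 p.l := right_mem_Icc.2 hl.le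
  have hsub : Icc 0 t ⊆ Ici 0 := fun s hs => hs.1
  have hq0 := (continuousOn_slice_right hs.continuousOn_q h0).mono hsub
  have hr0 := (hs.continuousOn_flux h0).mono hsub
  have hq1 := (continuousOn_slice_right hs.continuousOn_q h1).mono hsub
  have hr1 := (hs.continuousOn_flux h1).mono hsub
  obtain ⟨ν₀, y₀, hc⟩ := exists_isCorner hp hR
  have hdL : Differentiable ℂ (p.boundaryInt (q 0) (flux p e q 0) t) :=
    differentiable_boundaryInt ht.le hq0 hr0
  have hdR : Differentiable ℂ (p.boundaryInt (q p.l) (flux p e q p.l) t) :=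
    differentiable_boundaryInt ht.le hq1 hr1
  obtain ⟨k₁, C₁, hk₁, hC₁, b1, b2⟩ := exists_norm_boundaryInt_le hp hq0 hr0 ht.le
  obtain ⟨k₂, C₂, hk₂, hC₂, b3, b4⟩ := exists_norm_boundaryInt_le hp hq1 hr1 ht.le
  obtain ⟨iL, tL⟩ := hc.tendsto_integral_of_bound hp hdL hk₁ hC₁ b1 b2 hx.1
  obtain ⟨iR, tR⟩ := hc.tendsto_integral_of_bound hp (hdR.comp differentiable_neg) hk₂ hC₂
    (fun k hk h => by simpa using b3 (-k) (by rwa [norm_neg]) (by rwa [neg_sq]))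
    (fun k hk h => by simpa using b4 (-k) (by rwa [norm_neg]) (by rwa [norm_neg, neg_sq]))
    (sub_pos.2 hx.2)
  obtain ⟨uI, uE⟩ := hs.integralUpper_upperIntegrand hp hR hpole hx.1 ht.le iL
  obtain ⟨lI, lE⟩ := hs.integralLower_lowerIntegrand hp hR hpole hx.2 ht.le iR
  obtain ⟨A, hA⟩ := hs.exists_tendsto_initial hp hx ht
  set CL := p.integralUpper R
    (fun k => Complex.exp (I * k * x) • p.boundaryInt (q 0) (flux p e q 0) t k) with hCL
  set CR := p.integralUpper R (fun k => Complex.exp (I * k * (p.l - x : ℝ)) •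
          p.boundaryInt (q p.l) (flux p e q p.l) t (-k)) with hCR
  -- The factor `e^{ik(x-l)}` decays downwards, so the right boundary integral is obtained from the
  -- upper half-plane by `k ↦ -k`; the two independent limits exchange their roles.
  have tR' : Tendsto (fun z : ℝ × ℝ => ∫ k in z.1..z.2, Complex.exp (I * (k : ℝ) * (x - p.l)) •
      p.boundaryInt (q p.l) (flux p e q p.l) t (k : ℝ)) (atBot ×ˢ atTop) (𝓝 CR) := by
    have hm : Tendsto (fun z : ℝ × ℝ => ((-z.2, -z.1) : ℝ × ℝ)) (atBot ×ˢ atTop)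
        (atBot ×ˢ atTop) :=
      (tendsto_neg_atTop_atBot.comp tendsto_snd).prodMk (tendsto_neg_atBot_atTop.comp tendsto_fst)
    refine (tR.comp hm).congr fun z => ?_
    have h := intervalIntegral.integral_comp_neg (a := -z.2) (b := -z.1) (fun k : ℝ =>
      Complex.exp (I * (k : ℝ) * (x - p.l)) •
      p.boundaryInt (q p.l) (flux p e q p.l) t (k : ℝ))
    simp only [neg_neg] at h
    rw [← h]
    refine intervalIntegral.integral_congr fun k _ => ?_
    have : I * (-k : ℂ) * (x - p.l) = I * k * (p.l - x : ℝ) := by push_cast; ring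
    simp only [Complex.ofReal_neg, Function.comp, this]
  have tU := hs.tendsto_integral_uHat hp hx ht.le
  have hexp (y : ℂ) : Continuous fun k : ℝ => Complex.exp (I * (k : ℝ) * y) := by fun_prop
  have cU : Continuous fun k : ℝ => Complex.exp (I * k * x) • uHat p e q k t :=
    (hexp x).smul (hs.continuous_uHat hp ht.le)
  have cL : Continuous fun k : ℝ => Complex.exp (I * k * x) •
      p.boundaryInt (q 0) (flux p e q 0) t k :=
    (hexp x).smul (hdL.continuous.comp Complex.continuous_ofReal)
  have cR : Continuous fun k : ℝ => Complex.exp (I * k * (x - p.l)) •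
      p.boundaryInt (q p.l) (flux p e q p.l) t k :=
    (hexp (x - p.l)).smul (hdR.continuous.comp Complex.continuous_ofReal)
  have cS := hs.continuous_sourceIntegrand hp x ht.le
  have hsplit (k : ℝ) : sourceIntegrand p d x t k = Complex.exp (I * k * x) • uHat p e q k t
      - initialIntegrand p d x t k
      - Complex.exp (I * k * x) • p.boundaryInt (q 0) (flux p e q 0) t k
      + Complex.exp (I * k * (x - p.l)) • p.boundaryInt (q p.l) (flux p e q p.l) t k := by
    have e1 : Complex.exp (I * k * (x - p.l))
        = Complex.exp (I * k * x) * Complex.exp (-(I * k * p.l)) := by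
      rw [← Complex.exp_add]; congr 1; ring
    rw [hs.uHat_eq hp k ht.le, sourceIntegrand, initialIntegrand, e1]
    simp only [smul_sub, smul_add, smul_smul]
    abel
  have tS : Tendsto (fun z : ℝ × ℝ => ∫ k in z.1..z.2, sourceIntegrand p d x t k)
      (atBot ×ˢ atTop) (𝓝 ((2 * Real.pi : ℂ) • ![(e x t : ℂ), (q x t : ℂ)] - A - CL + CR)) := by
    refine (((tU.sub hA.2).sub tL).add tR').congr fun z => ?_
    have j0 := (cU.intervalIntegrable z.1 z.2 (μ := volume)).sub (hA.1 z.1 z.2)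
    have j1 := j0.sub (cL.intervalIntegrable _ _)
    have s0 := intervalIntegral.integral_sub (cU.intervalIntegrable z.1 z.2 (μ := volume))
      (hA.1 z.1 z.2)
    have s1 := intervalIntegral.integral_sub j0 (cL.intervalIntegrable _ _)
    have s2 := intervalIntegral.integral_add j1 (cR.intervalIntegrable _ _)
    rw [s1, s0] at s2
    refine s2.symm.trans ?_
    exact intervalIntegral.integral_congr fun k _ => (hsplit k).symm
  refine ⟨A, _, hA, ⟨fun a b => cS.intervalIntegrable _ _, tS⟩, uI, lI, ?_⟩
  rw [uE, lE]
  abel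

end IsSolution

end GK

theorem mainTheorem1 (p : GK.Params) (hp : p.Admissible) :
    (∃ R₀ : ℝ, 0 < R₀ ∧ ∀ R : ℝ, R₀ ≤ R → p.PoleFree R) ∧
    ∀ R : ℝ, 0 < R → p.PoleFree R →
      ∀ (d : GK.Data) (e q : ℝ → ℝ → ℝ), GK.IsSolution p d e q →
        ∀ x ∈ Set.Ioo 0 p.l, ∀ t : ℝ, 0 < t →
          ∃ A B : Fin 2 → ℂ,
            GK.HasImproperIntegral (GK.initialIntegrand p d x t) A ∧
            GK.HasImproperIntegral (GK.sourceIntegrand p d x t) B ∧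
            p.IntegrableUpper R (GK.upperIntegrand p d x t) ∧
            p.IntegrableLower R (GK.lowerIntegrand p d x t) ∧
            (![(e x t : ℂ), (q x t : ℂ)] : Fin 2 → ℂ) =
              (1 / (2 * Real.pi) : ℂ) • A + (1 / (2 * Real.pi) : ℂ) • B
                - (1 / (2 * Real.pi) : ℂ) •
                    p.integralUpper R (GK.upperIntegrand p d x t)
                - (1 / (2 * Real.pi) : ℂ) •
                    p.integralLower R (GK.lowerIntegrand p d x t) := by
  refine ⟨GK.Params.exists_poleFree hp, fun R hR hpole d e q hs x hx t ht => ?_⟩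
  obtain ⟨A, B, hA, hB, hU, hL, h⟩ := hs.integral_representation hp hR hpole hx ht
  refine ⟨A, B, hA, hB, hU, hL, ?_⟩
  have hpi : (2 * Real.pi : ℂ) ≠ 0 := by exact_mod_cast Real.two_pi_pos.ne'
  rw [← smul_add, ← smul_sub, ← smul_sub, ← h, smul_smul, one_div, inv_mul_cancel₀ hpi, one_smul]

end
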